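/- **Setting.** Let $k\in\mathbb N$ and let $A\subset\mathbb Z^k$ be a finite set with $|A|>1$. For $\nu:A\to\mathbb R$ put $H_a(u)=a\cdot u-\nu(a)$ on $\mathbb R^k$, $C_a=\{u : H_b(u)\le H_a(u)\ \forall b\in A\}$, and let $\Pi_\nu$ be the nonsmooth locus of $u\mapsto\max_{a\in A}H_a(u)$. Assume that $\nu$ is strictly convex on $A$ (for each $a\in A$ there is an affine function equal to $\nu$ at $a$ and smaller than $\nu$ on $A\setminus\{a\}$) and that the polyhedral subdivision of $\mathrm{conv}(A)$ induced by $\nu$ is a triangulation (for each $u$ the set $\{a\in A: u\in C_a\}$ is affinely independent). Let $d$ be the distance of a constant Riemannian metric on $\mathbb R^k$. For $0<\epsilon_1<\epsilon_2$ and $p\in\mathbb R^k$ put $\tau(p)=\{a\in A : d(p,C_a)\le\epsilon_2\}$. *Cutoff functions* are smooth functions $\chi_a:\mathbb R^k\to[0,1]$, $a\in A$, such that: $\chi_a(p)=1$ if $d(p,C_a)\le\epsilon_1$ and $\chi_a(p)=0$ if $d(p,C_a)\ge\epsilon_2$; where $0<\chi_a<1$, $\chi_a$ is strictly decreasing in the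 radial direction from $C_a$ (if $q\in C_a$ is the point nearest to $p$, then $\chi_a(p)<\chi_a(q+r(p-q))$ for $0\le r<1$); for $0<\xi<1$ the level sets $\{\chi_a=\xi\}$ are convex, i.e. $\{\chi_a\ge\xi\}$ is convex; and there is a compact set outside of which, at every $p$ with $a\in\tau(p)$ and $0<\chi_a(p)<1$, the level surface of $\chi_a$ is parallel to $C_{\tau(p)}=\bigcap_{b\in\tau(p)}C_b$, i.e. $d\chi_a(p)(v)=0$ for all $v$ on which all $b\in\tau(p)$ have the same value $b\cdot v$. For $\alpha\in(\mathbb C^*)^A$, $t>1$ and $s\in[0,1]$, the *tailored* function on $(\mathbb C^*)^k$ is $$f_{t,s}(x)=\sum_{a\in A}\alpha_a\bigl((1-s)+s\,\chi_a(\mathrm{Log}_t x)\bigr)t^{-\nu(a)}x^a,\qquad \mathrm{Log}_t x=\Bigl(\frac{\log|x_j|}{\log t}\Bigr)_j .$$ A *potential homogeneous of degree two* is a smooth function $\psi$ of $\rho=(\log|x_j|)_j\in\mathbb R^k\setminus\{0\}$ with positive definite Hessian and $\psi(\lambda\rho)=\lambda^2\psi(\rho)$ for $\lambda>0$; it is *toric*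 if it is a positive definite quadratic form in $\rho$ (and then it is defined also at $\rho=0$). Its Liouville form is $\theta=-d\psi\circ J$, with $J$ multiplication by $i$. An *exact symplectic manifold* $(N,\theta)$ is a manifold with a 1-form such that $d\theta$ is nondegenerate; its Liouville vector field $Z$ is given by $i_Zd\theta=\theta$. A *generating Liouville domain* of $(N,\theta)$, where $Z$ is complete, is a compact codimension-zero submanifold with boundary $M\subset N$ such that $Z$ is outward pointing along $\partial M$ and the images of $M$ under the flow of $Z$ in times $\ge0$ cover $N$. $(N,\theta)$ is a *Liouville manifold* if $Z$ is complete and a generating Liouville domain exists. A *family of Liouville manifolds* over $B$ is a surjective submersion $N\to B$ with smoothly varying 1-forms $\theta_s$ on its fibers $N_s$ such that every $(N_s,\theta_s)$ is a Liouville manifold. It *locally has families of generating Liouville domains* if every point of $B$ has an open neighbourhood $V$ with a submanifold with boundary $M\subset N|_V$, proper over $V$, which is a smooth family of manifolds with boundary over $V$ and whose fibers $M_s$ are generating Liouville domains of $(N_s,\theta_s)$. **Theorem.** There is $\epsilon_0>0$, depending only on $A$, $\nu$ and the metric, such that the following holds for all $0<\epsilon_1<\epsilon_2\le\epsilon_0$,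 all cutoff functions $(\chi_a)_{a\in A}$ as above, all $\alpha\in(\mathbb C^*)^A$ and every family $(\psi_s)_{s\in[0,1]}$ of potentials homogeneous of degree two, smooth in $(s,\rho)\in[0,1]\times(\mathbb R^k\setminus\{0\})$, with Liouville forms $\theta_s$. Assume that $0\notin\Pi_\nu$, or that all $\psi_s$ are toric. Then there is $T>1$ such that for all $t\ge T$ the family $(f_{t,s}^{-1}(0),\theta_s|_{f_{t,s}^{-1}(0)})_{s\in[0,1]}$, of submanifolds of $(\mathbb C^*)^k$ of real codimension two, is a family of Liouville manifolds over $[0,1]$ which locally has families of generating Liouville domains. -/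

import Mathlib

open Set Filter Topology
open scoped ContDiff Matrix

noncomputable section

section ExactSymplectic

variable {E : Type*} [NormedAddCommGroup E] [NormedSpace ℝ E]

/-- `N ⊆ E` is a smooth embedded submanifold (without boundary) of codimension `c`: near each of
its points it is a regular level set. -/
def IsEmbeddedSubmanifold (c : ℕ) (N : Set E) : Prop :=
  ∀ x ∈ N, ∃ U : Set E, IsOpen U ∧ x ∈ U ∧ ∃ F : E → (Fin c → ℝ),
    ContDiffOn ℝ ∞ F U ∧ (∀ y ∈ U, y ∈ N ↔ F y = 0) ∧
      Function.Surjective (fderiv ℝ F x)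

/-- The tangent space `T_x N`: velocities at `x` of curves in `N`. -/
def tangentVectors (N : Set E) (x : E) : Set E :=
  {v | ∃ γ : ℝ → E, γ 0 = x ∧ HasDerivAt γ v 0 ∧ ∀ᶠ r in 𝓝 (0 : ℝ), γ r ∈ N}

/-- The exterior derivative of a 1-form: `(dθ)_x(v, w) = (D_v θ)(w) - (D_w θ)(v)`. -/
def oneFormDeriv (θ : E → E →L[ℝ] ℝ) (x v w : E) : ℝ :=
  fderiv ℝ θ x v w - fderiv ℝ θ x w v

/-- `(N, θ|_N)` is an exact symplectic manifold: `N` is a submanifold, `θ` is a smooth 1-form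
defined near `N`, and `d(θ|_N) = (dθ)|_{TN}` is nondegenerate. -/
structure IsExactSymplectic (c : ℕ) (N : Set E) (θ : E → E →L[ℝ] ℝ) : Prop where
  submanifold : IsEmbeddedSubmanifold c N
  smooth : ∀ x ∈ N, ∃ U : Set E, IsOpen U ∧ x ∈ U ∧ ContDiffOn ℝ ∞ θ U
  nondegenerate : ∀ x ∈ N, ∀ v ∈ tangentVectors N x,
    (∀ w ∈ tangentVectors N x, oneFormDeriv θ x v w = 0) → v = 0

/-- `z` is the value at `x` of the Liouville vector field of `(N, θ|_N)`: it is tangent to `N` and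
`i_z dθ = θ` on `T_x N`. -/
def IsLiouvilleVector (N : Set E) (θ : E → E →L[ℝ] ℝ) (x z : E) : Prop :=
  z ∈ tangentVectors N x ∧ ∀ w ∈ tangentVectors N x, oneFormDeriv θ x z w = θ x w

/-- `γ` is an integral curve in `N`, defined for all times, of the Liouville vector field. -/
def IsLiouvilleCurve (N : Set E) (θ : E → E →L[ℝ] ℝ) (γ : ℝ → E) : Prop :=
  ∀ r : ℝ, γ r ∈ N ∧ ∃ z : E, IsLiouvilleVector N θ (γ r) z ∧ HasDerivAt γ z r

/-- `g` is a local defining function at `x` for the boundary of the codimension zero submanifold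
with boundary `M` of `N`: near `x`, `M = {g ≤ 0}` inside `N`, where `g x = 0` and
`d(g|_N) ≠ 0` at `x`. -/
def IsBoundaryDefining (N M : Set E) (x : E) (g : E → ℝ) : Prop :=
  g x = 0 ∧ (∃ v ∈ tangentVectors N x, fderiv ℝ g x v ≠ 0) ∧
    ∃ U : Set E, IsOpen U ∧ x ∈ U ∧ ContDiffOn ℝ ∞ g U ∧ ∀ y ∈ U ∩ N, y ∈ M ↔ g y ≤ 0

/-- `M` is a generating Liouville domain of the exact symplectic manifold `(N, θ|_N)`: a compact
codimension zero submanifold with boundary, along whose boundary the Liouville vector field points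
outward, and whose images under the Liouville flow in nonnegative time cover `N`. -/
structure IsGeneratingLiouvilleDomain (N : Set E) (θ : E → E →L[ℝ] ℝ) (M : Set E) : Prop where
  subset : M ⊆ N
  compact : IsCompact M
  submanifold : ∀ x ∈ M, M ∈ 𝓝[N] x ∨ ∃ g : E → ℝ, IsBoundaryDefining N M x g
  outward : ∀ x ∈ M, ∀ g : E → ℝ, IsBoundaryDefining N M x g →
    ∀ z : E, IsLiouvilleVector N θ x z → 0 < fderiv ℝ g x z
  generates : ∀ x ∈ N, ∃ γ : ℝ → E, IsLiouvilleCurve N θ γ ∧ γ 0 ∈ M ∧ ∃ r : ℝ, 0 ≤ r ∧ γ r = x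

/-- A Liouville manifold (of finite type): an exact symplectic manifold whose Liouville vector
field is complete and which contains a generating Liouville domain. -/
structure IsLiouvilleManifold (c : ℕ) (N : Set E) (θ : E → E →L[ℝ] ℝ) : Prop where
  exactSymplectic : IsExactSymplectic c N θ
  complete : ∀ x ∈ N, ∃ γ : ℝ → E, IsLiouvilleCurve N θ γ ∧ γ 0 = x
  exists_domain : ∃ M : Set E, IsGeneratingLiouvilleDomain N θ M

/-- The fibers `N s ⊆ E`, `s ∈ B`, form a smooth family of submanifolds of codimension `c`: the
total space `{(x, s) | s ∈ B, x ∈ N s}` is a smooth submanifold of `E × B`, and its projection to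
`B` is a surjective submersion. Both are expressed by local equations `F (x, s) = 0`, smooth up to
the boundary of `B`, whose differential in the direction of `E` is onto. -/
structure IsSmoothFamily (c : ℕ) (B : Set ℝ) (N : ℝ → Set E) : Prop where
  nonempty : ∀ s ∈ B, (N s).Nonempty
  submersion : ∀ s ∈ B, ∀ x ∈ N s, ∃ U : Set (E × ℝ), IsOpen U ∧ (x, s) ∈ U ∧
    ∃ F : E × ℝ → (Fin c → ℝ), ContDiffOn ℝ ∞ F (U ∩ univ ×ˢ B) ∧
      (∀ p ∈ U, p.2 ∈ B → (p.1 ∈ N p.2 ↔ F p = 0)) ∧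
      Function.Surjective (fderiv ℝ (fun y => F (y, s)) x)

/-- `(N s, θ s)`, `s ∈ B`, is a family of Liouville manifolds: a smooth family of submanifolds, with
1-forms depending smoothly on the point and the parameter, all of whose members are Liouville
manifolds. -/
structure IsLiouvilleFamily (c : ℕ) (B : Set ℝ) (N : ℝ → Set E)
    (θ : ℝ → E → E →L[ℝ] ℝ) : Prop where
  family : IsSmoothFamily c B N
  smooth : ∀ s ∈ B, ∀ x ∈ N s, ∃ U : Set (E × ℝ), IsOpen U ∧ (x, s) ∈ U ∧
    ContDiffOn ℝ ∞ (fun p : E × ℝ => θ p.2 p.1) (U ∩ univ ×ˢ B)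
  fiber : ∀ s ∈ B, IsLiouvilleManifold c (N s) (θ s)

/-- `M s`, `s ∈ B`, is a family of generating Liouville domains of `(N s, θ s)`: the total space is
proper over `B` and is a submanifold with boundary of the total space of `N` (with local defining
functions, smooth up to the boundary of `B`, whose restrictions to the fibers are regular), and
each `M s` is a generating Liouville domain of `(N s, θ s)`. -/
structure IsGeneratingDomainFamily (B : Set ℝ) (N : ℝ → Set E)
    (θ : ℝ → E → E →L[ℝ] ℝ) (M : ℝ → Set E) : Prop where
  proper : ∀ K : Set ℝ, K ⊆ B → IsCompact K → IsCompact {p : E × ℝ | p.2 ∈ K ∧ p.1 ∈ M p.2}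
  submanifold : ∀ s ∈ B, ∀ x ∈ M s, ∃ U : Set (E × ℝ), IsOpen U ∧ (x, s) ∈ U ∧
    ((∀ p ∈ U, p.2 ∈ B → p.1 ∈ N p.2 → p.1 ∈ M p.2) ∨
      ∃ g : E × ℝ → ℝ, ContDiffOn ℝ ∞ g (U ∩ univ ×ˢ B) ∧ g (x, s) = 0 ∧
        (∃ v ∈ tangentVectors (N s) x, fderiv ℝ (fun y => g (y, s)) x v ≠ 0) ∧
        ∀ p ∈ U, p.2 ∈ B → p.1 ∈ N p.2 → (p.1 ∈ M p.2 ↔ g p ≤ 0))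
  fiber : ∀ s ∈ B, IsGeneratingLiouvilleDomain (N s) (θ s) (M s)

/-- Every point of `B` has an open neighbourhood in `B` over which there is a family of generating
Liouville domains. -/
def LocallyHasGeneratingDomains (B : Set ℝ) (N : ℝ → Set E) (θ : ℝ → E → E →L[ℝ] ℝ) : Prop :=
  ∀ s ∈ B, ∃ V : Set ℝ, IsOpen V ∧ s ∈ V ∧
    ∃ M : ℝ → Set E, IsGeneratingDomainFamily (V ∩ B) N θ M

end ExactSymplectic

section Tropical

variable {k : ℕ}

/-- The affine function `u ↦ a · u - ν a` on `ℝ^k`. -/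
def tropicalTerm (ν : (Fin k → ℤ) → ℝ) (a : Fin k → ℤ) (u : Fin k → ℝ) : ℝ :=
  (∑ j, (a j : ℝ) * u j) - ν a

/-- The chamber `C_a`, where the term of `a` is maximal. -/
def chamber (A : Finset (Fin k → ℤ)) (ν : (Fin k → ℤ) → ℝ) (a : Fin k → ℤ) :
    Set (Fin k → ℝ) :=
  {u | ∀ b ∈ A, tropicalTerm ν b u ≤ tropicalTerm ν a u}

/-- The tropical amoeba `Π_ν`: the nonsmooth locus of `u ↦ max_{a ∈ A} (a · u - ν a)`. -/
def tropicalAmoeba (A : Finset (Fin k → ℤ)) (ν : (Fin k → ℤ) → ℝ) : Set (Fin k → ℝ) :=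
  {u | ¬ ContDiffAt ℝ ∞ (fun w : Fin k → ℝ => ⨆ a : A, tropicalTerm ν a w) u}

/-- `ν` is strictly convex on `A` (each `a ∈ A` is singled out by an affine function that is equal
to `ν` at `a` and less than `ν` on the rest of `A`), and the polyhedral subdivision of `conv A` that
it induces is a triangulation. The cells of this subdivision are the convex hulls of the sets
`{a ∈ A | ℓ a = ν a}`, for affine functions `ℓ ≤ ν` on `A` attaining equality, that is, of the
sets `{a ∈ A | u ∈ C_a}` with `u ∈ ℝ^k`. -/
structure InducesTriangulation (A : Finset (Fin k → ℤ)) (ν : (Fin k → ℤ) → ℝ) : Prop where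
  strictlyConvex : ∀ a ∈ A, ∃ u : Fin k → ℝ, ∀ b ∈ A, b ≠ a →
    tropicalTerm ν b u < tropicalTerm ν a u
  simplices : ∀ u : Fin k → ℝ, AffineIndependent ℝ
    (fun (a : {a : Fin k → ℤ // a ∈ A ∧ u ∈ chamber A ν a}) (j : Fin k) => ((a : Fin k → ℤ) j : ℝ))

/-- The norm of the constant Riemannian metric on `ℝ^k` with Gram matrix `G`. -/
def metricNorm (G : Matrix (Fin k) (Fin k) ℝ) (v : Fin k → ℝ) : ℝ :=
  Real.sqrt (v ⬝ᵥ (G *ᵥ v))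

/-- The distance of `p` to `C`, for the constant Riemannian metric with Gram matrix `G`. -/
def metricDist (G : Matrix (Fin k) (Fin k) ℝ) (p : Fin k → ℝ) (C : Set (Fin k → ℝ)) : ℝ :=
  sInf ((fun q => metricNorm G (p - q)) '' C)

/-- `τ(p) = {a ∈ A | d(p, C_a) ≤ ε}`. -/
def nearbyFace (A : Finset (Fin k → ℤ)) (ν : (Fin k → ℤ) → ℝ) (G : Matrix (Fin k) (Fin k) ℝ)
    (ε : ℝ) (p : Fin k → ℝ) : Set (Fin k → ℤ) :=
  {a | a ∈ A ∧ metricDist G p (chamber A ν a) ≤ ε}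

/-- The directions parallel to `C_τ = ⋂_{a ∈ τ} C_a`: its affine span is given by the equations
`a · u - ν a = b · u - ν b` for `a, b ∈ τ`. -/
def faceDirections (τ : Set (Fin k → ℤ)) : Set (Fin k → ℝ) :=
  {v | ∀ a ∈ τ, ∀ b ∈ τ, ∑ j, (a j : ℝ) * v j = ∑ j, (b j : ℝ) * v j}

/-- The conditions on the cutoff functions `χ_a`, `a ∈ A`, for parameters `ε₁ < ε₂`. -/
structure IsCutoffFamily (A : Finset (Fin k → ℤ)) (ν : (Fin k → ℤ) → ℝ)
    (G : Matrix (Fin k) (Fin k) ℝ) (ε₁ ε₂ : ℝ) (χ : (Fin k → ℤ) → (Fin k → ℝ) → ℝ) : Prop where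
  smooth : ∀ a ∈ A, ContDiff ℝ ∞ (χ a)
  mem_Icc : ∀ a ∈ A, ∀ p, χ a p ∈ Icc (0 : ℝ) 1
  eq_one : ∀ a ∈ A, ∀ p, metricDist G p (chamber A ν a) ≤ ε₁ → χ a p = 1
  eq_zero : ∀ a ∈ A, ∀ p, ε₂ ≤ metricDist G p (chamber A ν a) → χ a p = 0
  /-- In the transition region, `χ_a` is strictly decreasing along the rays that start at a point
  `q` of `C_a` and run orthogonally to `C_a`. -/
  radial : ∀ a ∈ A, ∀ p, ∀ q ∈ chamber A ν a,
    metricNorm G (p - q) = metricDist G p (chamber A ν a) → 0 < χ a p → χ a p < 1 →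
      ∀ r : ℝ, 0 ≤ r → r < 1 → χ a p < χ a (q + r • (p - q))
  /-- The level sets in the transition region bound convex sets. -/
  convex : ∀ a ∈ A, ∀ ξ : ℝ, 0 < ξ → ξ < 1 → Convex ℝ {p | ξ ≤ χ a p}
  /-- Outside a compact set, the level surfaces of `χ_a` in the transition region are parallel to
  `C_τ` at the points `p` with `τ(p) = τ ∋ a`. -/
  parallel : ∃ K : Set (Fin k → ℝ), IsCompact K ∧ ∀ p, p ∉ K →
    ∀ a ∈ nearbyFace A ν G ε₂ p, 0 < χ a p → χ a p < 1 →
      ∀ v ∈ faceDirections (nearbyFace A ν G ε₂ p), fderiv ℝ (χ a) p v = 0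

end Tropical

section Torus

variable {k : ℕ}

/-- `Log x = (log |x_j|)_j`. -/
def logMap (x : Fin k → ℂ) : Fin k → ℝ := fun j => Real.log ‖x j‖

/-- `Log_t x = Log x / log t`. -/
def logMapBase (t : ℝ) (x : Fin k → ℂ) : Fin k → ℝ := fun j => Real.log ‖x j‖ / Real.log t

/-- The tailored function
`f_{t,s}(x) = ∑_{a ∈ A} α_a ((1 - s) + s χ_a(Log_t x)) t^{-ν(a)} x^a`. -/
def tailoredFun (A : Finset (Fin k → ℤ)) (ν : (Fin k → ℤ) → ℝ) (α : (Fin k → ℤ) → ℂ)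
    (χ : (Fin k → ℤ) → (Fin k → ℝ) → ℝ) (t s : ℝ) (x : Fin k → ℂ) : ℂ :=
  ∑ a ∈ A, α a * (((1 - s) + s * χ a (logMapBase t x) : ℝ) : ℂ) * ((t ^ (-ν a) : ℝ) : ℂ) *
    ∏ j, x j ^ a j

/-- The zero set of `f_{t,s}` in the torus `(ℂ^*)^k`, as a subset of `ℂ^k`. -/
def tailoredHypersurface (A : Finset (Fin k → ℤ)) (ν : (Fin k → ℤ) → ℝ) (α : (Fin k → ℤ) → ℂ)
    (χ : (Fin k → ℤ) → (Fin k → ℝ) → ℝ) (t s : ℝ) : Set (Fin k → ℂ) :=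
  {x | (∀ j, x j ≠ 0) ∧ tailoredFun A ν α χ t s x = 0}

/-- A potential homogeneous of degree two, as a function of `ρ = Log x`: it is smooth with positive
definite Hessian (so that it is a Kähler potential) and homogeneous on `ρ ≠ 0`. -/
structure IsHomogeneousPotential (ψ : (Fin k → ℝ) → ℝ) : Prop where
  smooth : ContDiffOn ℝ ∞ ψ {0}ᶜ
  homogeneous : ∀ ρ : Fin k → ℝ, ρ ≠ 0 → ∀ r : ℝ, 0 < r → ψ (r • ρ) = r ^ 2 * ψ ρ
  posDef : ∀ ρ : Fin k → ℝ, ρ ≠ 0 → ∀ v : Fin k → ℝ, v ≠ 0 → 0 < fderiv ℝ (fderiv ℝ ψ) ρ v v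

/-- A toric potential: a positive definite quadratic form in `ρ`. -/
def IsToricPotential (ψ : (Fin k → ℝ) → ℝ) : Prop :=
  ∃ Q : Matrix (Fin k) (Fin k) ℝ, Q.PosDef ∧ ∀ ρ, ψ ρ = ρ ⬝ᵥ (Q *ᵥ ρ)

/-- The Liouville form `θ = -d(ψ ∘ Log) ∘ J` on the torus, where `J` is multiplication by `i`. -/
def liouvilleForm (ψ : (Fin k → ℝ) → ℝ) (x : Fin k → ℂ) : (Fin k → ℂ) →L[ℝ] ℝ :=
  -((fderiv ℝ (fun y : Fin k → ℂ => ψ (logMap y)) x).comp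
    (Complex.I • ContinuousLinearMap.id ℝ (Fin k → ℂ)))

end Torus

end

/-! In logarithmic coordinates x = exp(w) the monomial of `a` has size |α_a| t^m, where m is its
tropical term at u = Log_t x. For large t only the terms within a small δ of the maximum matter; the
others are smaller by a factor t^(-δ). If δ is small compared with ε₁, all almost maximal terms lie
in the region where their cutoff is identically 1, so the cutoffs disturb only negligible terms. The
derivatives of the cutoffs are bounded, because outside a compact set they do not change along the
faces. Hence df is complex linear up to a relative error O(t^(-δ)). Its linear part is bounded below
because the exponents of the almost maximal terms are affinely independent. So ker df is nearly
invariant under multiplication by i. The vector Log x itself nearly lies in ker df when it is large: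
up to a bounded error it is a direction on which the almost maximal exponents agree, and along it df
is a multiple of the sum of the dominant terms, which nearly vanishes on f = 0. All this is
`tailored_estimates`.

A potential homogeneous of degree two has, by Euler's identity, the radial vector Log x as its
Liouville field on the torus, and its Hessian has uniform bounds. On a nearly complex kernel the
Kähler form is therefore nondegenerate with a uniform constant (`IsMetricBetween.exists_coercive`),
and the Liouville field of the hypersurface is the symplectic projection of the radial one. It has
linear growth in the coordinate w, hence is complete, and it is close to the radial field far out,
so |Log x|² increases along it. A large sublevel set of |Log x|² is a generating domain, with a
radius independent of s. Near Log x = 0, where a general potential is singular, a single term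
dominates if 0 is not in the tropical amoeba, so f has no zero there; a toric potential is smooth
there anyway.

The fibers are nonempty because the fiber at s = 0 is the zero set of a Laurent polynomial with at
least two terms, and nonemptiness is an open and closed condition on s. -/

noncomputable section

/-! ### Systems of affine inequalities, and functions constant along faces -/

section Polyhedral

variable {V : Type*} [NormedAddCommGroup V] [NormedSpace ℝ V] [FiniteDimensional ℝ V]
  {ι : Type*} [Finite ι]

/-- A vector on which finitely many linear forms are small is close to their common kernel. -/
theorem exists_bound_dist_ker (L : ι → V →L[ℝ] ℝ) (s : Set ι) :
    ∃ C : ℝ, 0 ≤ C ∧ ∀ (M : ℝ) (u : V), 0 ≤ M → (∀ i ∈ s, |L i u| ≤ M) →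
      ∃ v : V, (∀ i ∈ s, L i v = 0) ∧ ‖u - v‖ ≤ C * M := by
  classical
  have := Fintype.ofFinite s
  let Φ : V →ₗ[ℝ] (s → ℝ) := LinearMap.pi fun i => (L i : V →ₗ[ℝ] ℝ)
  obtain ⟨g, hg⟩ := Φ.rangeRestrict.exists_rightInverse_of_surjective Φ.range_rangeRestrict
  let g' : Φ.range →L[ℝ] V := LinearMap.toContinuousLinearMap g
  refine ⟨‖g'‖, by positivity, fun M u hM hu => ⟨u - g' (Φ.rangeRestrict u), ?_, ?_⟩⟩
  · intro i hi
    have h1 : Φ (g' (Φ.rangeRestrict u)) = Φ u := by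
      have := congrArg Subtype.val (LinearMap.congr_fun hg (Φ.rangeRestrict u))
      exact this
    have h2 : L i (g' (Φ.rangeRestrict u)) = L i u := by
      simpa [Φ] using congrFun h1 ⟨i, hi⟩
    simp [h2]
  · have h3 : ‖Φ.rangeRestrict u‖ ≤ M := by
      change ‖Φ u‖ ≤ M
      refine (pi_norm_le_iff_of_nonneg hM).2 fun i => ?_
      simpa [Φ] using hu i i.2
    calc ‖u - (u - g' (Φ.rangeRestrict u))‖ = ‖g' (Φ.rangeRestrict u)‖ := by simp
      _ ≤ ‖g'‖ * ‖Φ.rangeRestrict u‖ := g'.le_opNorm _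
      _ ≤ ‖g'‖ * M := by gcongr

/-- Going back from `1` to `0`, there is a first time at which a closed condition holds, unless
it never holds. -/
theorem exists_last_time {P : ℝ → Prop} (hP : IsClosed {r | P r}) :
    ∃ r₀ ∈ Icc (0 : ℝ) 1, (∀ r, r₀ < r → r ≤ 1 → ¬ P r) ∧ (P r₀ ∨ r₀ = 0) := by
  by_cases h : (Icc (0 : ℝ) 1 ∩ {r | P r}).Nonempty
  · obtain ⟨r₀, ⟨h1, h2⟩, h3⟩ := (isCompact_Icc.inter_right hP).exists_isGreatest h
    refine ⟨r₀, h1, fun r hr hr1 hPr => ?_, Or.inl h2⟩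
    exact absurd (h3 ⟨⟨h1.1.trans hr.le, hr1⟩, hPr⟩) (not_le.2 hr)
  · refine ⟨0, by simp, fun r hr hr1 hPr => h ⟨r, ⟨hr.le, hr1⟩, hPr⟩, Or.inr rfl⟩

/-- Compactness: approximate solutions with errors tending to 0 accumulate at an exact solution. -/
theorem exists_near_solution_of_bounded {ι : Type*} (L : ι → V →L[ℝ] ℝ) (c : ι → ℝ)
    (R ε : ℝ) (hε : 0 < ε) :
    ∃ δ : ℝ, 0 < δ ∧ ∀ u : V, ‖u‖ ≤ R → (∀ i, L i u + c i ≤ δ) →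
      ∃ q : V, (∀ i, L i q + c i ≤ 0) ∧ ‖u - q‖ ≤ ε := by
  by_contra! H
  choose u hu hL hq using fun n : ℕ => H (1 / ((n : ℝ) + 1)) (by positivity)
  obtain ⟨x, -, φ, hφ, hx⟩ := (isCompact_closedBall (0 : V) R).tendsto_subseq
    (x := u) (fun n => by simpa using hu n)
  have h0 : ∀ i, L i x + c i ≤ 0 := fun i => by
    have h1 : Tendsto (fun n => L i (u (φ n)) + c i) atTop (𝓝 (L i x + c i)) :=
      (((L i).continuous.tendsto x).comp hx).add_const _
    have h2 : Tendsto (fun n : ℕ => 1 / (((φ n : ℕ) : ℝ) + 1)) atTop (𝓝 0) :=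
      tendsto_one_div_add_atTop_nhds_zero_nat.comp hφ.tendsto_atTop
    exact le_of_tendsto_of_tendsto' h1 h2 fun n => hL (φ n) i
  have h3 : Tendsto (fun n => ‖u (φ n) - x‖) atTop (𝓝 0) := by
    simpa using (hx.sub_const x).norm
  obtain ⟨n, hn⟩ := (h3.eventually_lt_const hε).exists
  exact absurd hn (not_lt.2 (hq (φ n) x h0).le)

/-- Bounded regions are covered by compactness. Otherwise one slides `u` along the common kernel of
the forms in `s`, until either another form becomes small and joins `s`, or a bounded region is
reached. The induction is on the number of forms outside `s`. -/
theorem exists_near_solution_aux (L : ι → V →L[ℝ] ℝ) (c : ι → ℝ) (n : ℕ) :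
    ∀ (s : Set ι), sᶜ.ncard = n → ∀ (M ε : ℝ), 0 < M → 0 < ε →
    ∃ δ : ℝ, 0 < δ ∧ ∀ u : V, (∀ i ∈ s, |L i u + c i| ≤ M) → (∀ i, L i u + c i ≤ δ) →
      ∃ q : V, (∀ i, L i q + c i ≤ 0) ∧ ‖u - q‖ ≤ ε := by
  classical
  have := Fintype.ofFinite ι
  induction n using Nat.strong_induction_on with
  | _ n ih =>
  intro s hs M ε hM hε
  -- a common bound for the linear parts
  obtain ⟨Λ, hΛ, hLΛ⟩ : ∃ Λ : ℝ, 0 < Λ ∧ ∀ i, ‖L i‖ ≤ Λ :=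
    ⟨1 + ∑ i, ‖L i‖, by positivity, fun i => by
      have := Finset.single_le_sum (f := fun i => ‖L i‖) (fun _ _ => norm_nonneg _)
        (Finset.mem_univ i)
      linarith⟩
  obtain ⟨Γ, hΓ, hcΓ⟩ : ∃ Γ : ℝ, 0 ≤ Γ ∧ ∀ i, |c i| ≤ Γ :=
    ⟨∑ i, |c i|, by positivity, fun i =>
      Finset.single_le_sum (f := fun i => |c i|) (fun _ _ => abs_nonneg _) (Finset.mem_univ i)⟩
  obtain ⟨C, hC, hker⟩ := exists_bound_dist_ker L s
  -- A displacement of length at most `1 / Λ` changes each form by at most 1.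
  set ε' : ℝ := min ε (1 / Λ) with hε'
  have hε'0 : 0 < ε' := lt_min hε (by positivity)
  obtain ⟨δ₀, hδ₀, hsol₀⟩ :=
    exists_near_solution_of_bounded L c (C * (M + Γ)) ε' hε'0
  have hstep : ∀ i : ι, ∃ δ : ℝ, 0 < δ ∧ (i ∉ s → ∀ u : V,
      (∀ j ∈ insert i s, |L j u + c j| ≤ max M 1) → (∀ j, L j u + c j ≤ δ) →
      ∃ q : V, (∀ j, L j q + c j ≤ 0) ∧ ‖u - q‖ ≤ ε') := by
    intro i
    by_cases hi : i ∈ s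
    · exact ⟨1, one_pos, fun h => absurd hi h⟩
    · have hlt : (insert i s)ᶜ.ncard < n := by
        rw [← hs]
        refine ncard_lt_ncard ?_ (toFinite _)
        refine (ssubset_iff_of_subset (compl_subset_compl.2 (subset_insert i s))).2
          ⟨i, hi, by simp⟩
      obtain ⟨δ, hδ, h⟩ := ih _ hlt (insert i s) rfl (max M 1) ε' (by positivity) hε'0
      exact ⟨δ, hδ, fun _ => h⟩
  choose δ hδ hsol using hstep
  obtain ⟨δ', hδ', hδ'i⟩ : ∃ δ' : ℝ, 0 < δ' ∧ ∀ i, δ' ≤ δ i := by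
    have : ∀ᶠ x in 𝓝[>] (0 : ℝ), ∀ i, x ≤ δ i :=
      eventually_all.2 fun i => (eventually_le_nhds (hδ i)).filter_mono nhdsWithin_le_nhds
    obtain ⟨x, hx, hx0⟩ := (this.and self_mem_nhdsWithin).exists
    exact ⟨x, hx0, hx⟩
  -- With the values bounded above by 1/2, a form of absolute value greater than 1 must be below -1.
  refine ⟨min (min δ' δ₀) (1 / 2), by positivity, fun u hus hu => ?_⟩
  obtain ⟨v, hv, huv⟩ := hker (M + Γ) u (by positivity) fun i hi => by
    have h1 := abs_le.1 (hus i hi)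
    have h2 := abs_le.1 (hcΓ i)
    exact abs_le.2 ⟨by linarith [h1.1, h2.2], by linarith [h1.2, h2.1]⟩
  -- This path goes from a bounded point at time 0 to `u` at time 1, and the forms in `s` are
  -- constant along it.
  let p : ℝ → V := fun r => (u - v) + r • v
  have hp1 : p 1 = u := by simp [p]
  have hps : ∀ r, ∀ i ∈ s, L i (p r) = L i u := fun r i hi => by simp [p, hv i hi]
  have hpr : ∀ r i, L i (p r) = L i (u - v) + r * L i v := fun r i => by simp [p]
  have hpc : Continuous p := by fun_prop
  obtain ⟨r₀, hr₀, hlast, hend⟩ := exists_last_time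
    (P := fun r => ∃ i ∉ s, |L i (p r) + c i| ≤ 1) (by
    have : {r | ∃ i ∉ s, |L i (p r) + c i| ≤ 1} = ⋃ i ∈ sᶜ, {r | |L i (p r) + c i| ≤ 1} := by
      ext; simp
    rw [this]
    exact (toFinite _).isClosed_biUnion fun i _ => isClosed_le (by fun_prop) continuous_const)
  -- the forms outside `s` are very negative after the last time
  have hneg : r₀ < 1 → ∀ i ∉ s, L i u + c i ≤ -1 ∧ L i (p r₀) + c i ≤ -1 := by
    intro hr1 i hi
    have hcont : ContinuousOn (fun r => L i (p r) + c i) (Icc r₀ 1) := by fun_prop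
    have hno : ∀ r ∈ Ioc r₀ 1, L i (p r) + c i < -1 := by
      intro r hr
      by_contra hcon
      have hgt : ∀ x, r₀ < x → x ≤ 1 → 1 < |L i (p x) + c i| := fun x h1 h2 => by
        have := hlast x h1 h2
        push Not at this
        exact this i hi
      have h1 : L i (p 1) + c i < -1 := by
        have h2 := hgt 1 hr1 le_rfl
        have h3 : L i (p 1) + c i ≤ 1 / 2 := by
          rw [hp1]; exact (hu i).trans (min_le_right _ _)
        rcases lt_abs.1 h2 with h | h <;> linarith
      have h0 : (0 : ℝ) ∈ Icc (L i (p 1) + c i) (L i (p r) + c i) := by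
        have h2 := hgt r hr.1 hr.2
        rcases lt_abs.1 h2 with h | h
        · exact ⟨by linarith, by linarith⟩
        · exact absurd (by linarith : L i (p r) + c i < -1) hcon
      obtain ⟨x, hx, hx0⟩ := intermediate_value_Icc' hr.2
        (f := fun r => L i (p r) + c i) (by fun_prop) h0
      have := hgt x (hr.1.trans_le hx.1) hx.2
      simp only at hx0
      rw [hx0] at this
      norm_num at this
    refine ⟨by simpa [hp1] using (hno 1 ⟨hr1, le_rfl⟩).le, ?_⟩
    have htend : Tendsto (fun r => L i (p r) + c i) (𝓝[>] r₀) (𝓝 (L i (p r₀) + c i)) :=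
      ((by fun_prop : Continuous fun r => L i (p r) + c i).tendsto r₀).mono_left
        nhdsWithin_le_nhds
    refine le_of_tendsto htend ?_
    filter_upwards [Ioc_mem_nhdsGT hr1] with r hr using (hno r hr).le
  have hle : ∀ i, L i (p r₀) + c i ≤ min (min δ' δ₀) (1 / 2) := fun i => by
    by_cases hi : i ∈ s
    · rw [hps r₀ i hi]; exact hu i
    · rcases hr₀.2.lt_or_eq with h | h
      · have : (0 : ℝ) ≤ min (min δ' δ₀) (1 / 2) := by positivity
        linarith [(hneg h i hi).2]
      · rw [h, hp1]; exact hu i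
  have hq' : ∃ q : V, (∀ i, L i q + c i ≤ 0) ∧ ‖p r₀ - q‖ ≤ ε' := by
    rcases hend with ⟨i, hi, hir⟩ | h0
    · refine hsol i hi (p r₀) ?_ fun j => (hle j).trans
        ((min_le_left _ _).trans ((min_le_left _ _).trans (hδ'i i)))
      intro j hj
      rcases mem_insert_iff.1 hj with rfl | hj
      · exact hir.trans (le_max_right _ _)
      · rw [hps r₀ j hj]; exact (hus j hj).trans (le_max_left _ _)
    · refine hsol₀ (p r₀) ?_ fun j => (hle j).trans
        ((min_le_left _ _).trans (min_le_right _ _))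
      simpa [p, h0] using huv
  obtain ⟨q', hq', hqn⟩ := hq'
  rcases hr₀.2.lt_or_eq with h | h
  -- The correction found at `p r₀` is applied at `u`: the forms in `s` have the same values at both
  -- points, and the others are at most -1 at `u` and grow by at most 1.
  · refine ⟨u + (q' - p r₀), fun i => ?_, ?_⟩
    · by_cases hi : i ∈ s
      · have := hq' i
        simp only [map_add, map_sub, hps r₀ i hi]
        linarith
      · have h1 := (hneg h i hi).1
        have h2 : L i (q' - p r₀) ≤ 1 := by
          calc L i (q' - p r₀) ≤ ‖L i (q' - p r₀)‖ := le_abs_self _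
            _ ≤ ‖L i‖ * ‖q' - p r₀‖ := (L i).le_opNorm _
            _ ≤ Λ * (1 / Λ) := by
              gcongr
              · exact hLΛ i
              · rw [norm_sub_rev]; exact hqn.trans (min_le_right _ _)
            _ = 1 := by field_simp
        simp only [map_add]
        linarith
    · rw [show u - (u + (q' - p r₀)) = p r₀ - q' by abel]
      exact hqn.trans (min_le_left _ _)
  · refine ⟨q', hq', ?_⟩
    rw [h, hp1] at hqn
    exact hqn.trans (min_le_left _ _)

/-- Approximate solutions of a finite system of affine inequalities are near to exact solutions. In
particular, if there are approximate solutions, then there are exact ones. -/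
theorem exists_near_solution (L : ι → V →L[ℝ] ℝ) (c : ι → ℝ) {ε : ℝ} (hε : 0 < ε) :
    ∃ δ : ℝ, 0 < δ ∧ ∀ u : V, (∀ i, L i u + c i ≤ δ) →
      ∃ q : V, (∀ i, L i q + c i ≤ 0) ∧ ‖u - q‖ ≤ ε := by
  obtain ⟨δ, hδ, h⟩ := exists_near_solution_aux L c _ ∅ rfl 1 ε one_pos hε
  exact ⟨δ, hδ, fun u hu => h u (by simp) hu⟩

/-- If the directional derivatives along `v` vanish near an open segment parallel to `v`, then the
derivative is the same at both ends of the segment. -/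
theorem fderiv_eq_of_segment {E : Type*} [NormedAddCommGroup E] [NormedSpace ℝ E] {g : E → ℝ}
    (hg : ContDiff ℝ ∞ g) (p v : E) {r₀ r₁ : ℝ} (hr : r₀ ≤ r₁)
    (h : ∀ r ∈ Ioo r₀ r₁, ∀ᶠ q in 𝓝 (p + r • v), fderiv ℝ g q v = 0) :
    fderiv ℝ g (p + r₀ • v) = fderiv ℝ g (p + r₁ • v) := by
  have hg1 : ContDiff ℝ ∞ (fderiv ℝ g) := hg.fderiv_right (by simp)
  have hd1 : Differentiable ℝ (fderiv ℝ g) := hg1.differentiable (by simp)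
  rcases hr.eq_or_lt with rfl | hr
  · rfl
  ext w
  have hderiv : ∀ r, HasDerivAt (fun r : ℝ => fderiv ℝ g (p + r • v) w)
      (fderiv ℝ (fderiv ℝ g) (p + r • v) v w) r := fun r => by
    have h1 : HasDerivAt (fun r : ℝ => p + r • v) v r := by
      simpa using ((hasDerivAt_id r).smul_const v).const_add p
    have h2 := (hd1 (p + r • v)).hasFDerivAt.comp_hasDerivAt r h1
    simpa using h2.clm_apply (hasDerivAt_const r w)
  obtain ⟨r, hr', hslope⟩ := exists_hasDerivAt_eq_slope _ _ hr
    (fun r _ => (hderiv r).continuousAt.continuousWithinAt) fun r _ => hderiv r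
  -- By symmetry of the second derivative, the change of dg(w) along `v` is the change along `w` of
  -- dg(v), which vanishes near the segment.
  have hsymm : fderiv ℝ (fderiv ℝ g) (p + r • v) v w = fderiv ℝ (fderiv ℝ g) (p + r • v) w v :=
    (hg.contDiffAt.isSymmSndFDerivAt
      (by simpa using WithTop.coe_le_coe.2 (le_top : (2 : ℕ∞) ≤ ⊤))).eq v w
  have hz : fderiv ℝ (fderiv ℝ g) (p + r • v) w v = 0 := by
    have h1 : HasFDerivAt (fun q => fderiv ℝ g q v)
        ((fderiv ℝ (fderiv ℝ g) (p + r • v)).flip v) (p + r • v) := by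
      simpa using (hd1 (p + r • v)).hasFDerivAt.clm_apply (hasFDerivAt_const v (p + r • v))
    have h2 : HasFDerivAt (fun q => fderiv ℝ g q v) (0 : E →L[ℝ] ℝ) (p + r • v) :=
      (hasFDerivAt_const (0 : ℝ) _).congr_of_eventuallyEq (h r hr')
    have := congrArg (fun T : E →L[ℝ] ℝ => T w) (h1.unique h2)
    simpa using this
  rw [hsymm, hz, eq_comm, div_eq_zero_iff] at hslope
  rcases hslope with h | h <;> linarith

/-- The sliding argument of `exists_near_solution_aux` again. While the path avoids `K` and no form
outside `s` is small, the direction of motion is one in which `g` is locally constant, so the full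
differential is transported unchanged to a point where a bound is known. -/
theorem exists_bound_fderiv_aux {g : V → ℝ} (hg : ContDiff ℝ ∞ g) (L : ι → V →L[ℝ] ℝ) (c : ι → ℝ)
    {K : Set V} (hK : IsCompact K) (M' : ℝ)
    (hpar : ∀ p, p ∉ K → ∀ v : V, (∀ i, |L i p + c i| ≤ M' → L i v = 0) → fderiv ℝ g p v = 0)
    (n : ℕ) :
    ∀ (s : Set ι), sᶜ.ncard = n → ∀ M : ℝ, 0 ≤ M →
      ∃ B : ℝ, ∀ p, (∀ i ∈ s, |L i p + c i| ≤ M) → ‖fderiv ℝ g p‖ ≤ B := by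
  classical
  have := Fintype.ofFinite ι
  have hcont : Continuous (fderiv ℝ g) := hg.continuous_fderiv (by simp)
  induction n using Nat.strong_induction_on with
  | _ n ih =>
  intro s hs M hM
  obtain ⟨Γ, hΓ, hcΓ⟩ : ∃ Γ : ℝ, 0 ≤ Γ ∧ ∀ i, |c i| ≤ Γ :=
    ⟨∑ i, |c i|, by positivity, fun i =>
      Finset.single_le_sum (f := fun i => |c i|) (fun _ _ => abs_nonneg _) (Finset.mem_univ i)⟩
  obtain ⟨C, hC, hker⟩ := exists_bound_dist_ker L s
  obtain ⟨B₁, hB₁⟩ := hK.exists_bound_of_continuousOn hcont.continuousOn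
  obtain ⟨B₂, hB₂⟩ := (isCompact_closedBall (0 : V) (C * (M + Γ))).exists_bound_of_continuousOn
    hcont.continuousOn
  have hstep : ∀ i : ι, ∃ B : ℝ, i ∉ s → ∀ p,
      (∀ j ∈ insert i s, |L j p + c j| ≤ max M M') → ‖fderiv ℝ g p‖ ≤ B := by
    intro i
    by_cases hi : i ∈ s
    · exact ⟨0, fun h => absurd hi h⟩
    · have hlt : (insert i s)ᶜ.ncard < n := by
        rw [← hs]
        refine ncard_lt_ncard ?_ (toFinite _)
        refine (ssubset_iff_of_subset (compl_subset_compl.2 (subset_insert i s))).2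
          ⟨i, hi, by simp⟩
      obtain ⟨B, hB⟩ := ih _ hlt (insert i s) rfl (max M M') (le_max_of_le_left hM)
      exact ⟨B, fun _ => hB⟩
  choose B hB using hstep
  refine ⟨max (max B₁ B₂) (∑ i, |B i|), fun u hus => ?_⟩
  obtain ⟨v, hv, huv⟩ := hker (M + Γ) u (by positivity) fun i hi => by
    have h1 := abs_le.1 (hus i hi)
    have h2 := abs_le.1 (hcΓ i)
    exact abs_le.2 ⟨by linarith [h1.1, h2.2], by linarith [h1.2, h2.1]⟩
  let p : ℝ → V := fun r => (u - v) + r • v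
  have hp1 : p 1 = u := by simp [p]
  have hps : ∀ r, ∀ i ∈ s, L i (p r) = L i u := fun r i hi => by simp [p, hv i hi]
  have hpc : Continuous p := by fun_prop
  have hbad : IsClosed {q : V | q ∈ K ∨ ∃ i ∉ s, |L i q + c i| ≤ M'} := by
    have : {q : V | q ∈ K ∨ ∃ i ∉ s, |L i q + c i| ≤ M'} =
        K ∪ ⋃ i ∈ sᶜ, {q | |L i q + c i| ≤ M'} := by
      ext; simp
    rw [this]
    exact hK.isClosed.union ((toFinite _).isClosed_biUnion fun i _ =>
      isClosed_le (by fun_prop) continuous_const)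
  obtain ⟨r₀, hr₀, hlast, hend⟩ := exists_last_time
    (P := fun r => p r ∈ K ∨ ∃ i ∉ s, |L i (p r) + c i| ≤ M') (hbad.preimage hpc)
  have heq : fderiv ℝ g (p r₀) = fderiv ℝ g u := by
    rw [← hp1]
    refine fderiv_eq_of_segment hg (u - v) v hr₀.2 fun r hr => ?_
    have hnot := hlast r hr.1 hr.2.le
    filter_upwards [hbad.isOpen_compl.mem_nhds hnot] with q hq
    simp only [mem_compl_iff, mem_ofPred_eq, not_or, not_exists, not_and] at hq
    refine hpar q hq.1 v fun i hi => ?_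
    by_cases his : i ∈ s
    · exact hv i his
    · exact absurd hi (hq.2 i his)
  rw [← heq]
  rcases hend with (hk | ⟨i, hi, hir⟩) | h0
  · exact (hB₁ _ hk).trans ((le_max_left _ _).trans (le_max_left _ _))
  · refine (hB i hi (p r₀) ?_).trans ((le_abs_self _).trans ((Finset.single_le_sum
      (f := fun i => |B i|) (fun _ _ => abs_nonneg _) (Finset.mem_univ i)).trans
        (le_max_right _ _)))
    intro j hj
    rcases mem_insert_iff.1 hj with rfl | hj
    · exact hir.trans (le_max_right _ _)
    · rw [hps r₀ j hj]; exact (hus j hj).trans (le_max_left _ _)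
  · refine (hB₂ _ ?_).trans ((le_max_right _ _).trans (le_max_left _ _))
    simpa [p, h0] using huv

/-- A smooth function that is, outside a compact set, locally constant in the directions in which
all the affine functions that are small at the point are constant, has bounded derivative. -/
theorem exists_bound_fderiv {g : V → ℝ} (hg : ContDiff ℝ ∞ g) (L : ι → V →L[ℝ] ℝ) (c : ι → ℝ)
    {K : Set V} (hK : IsCompact K) (M' : ℝ)
    (hpar : ∀ p, p ∉ K → ∀ v : V, (∀ i, |L i p + c i| ≤ M' → L i v = 0) → fderiv ℝ g p v = 0) :
    ∃ B : ℝ, ∀ p, ‖fderiv ℝ g p‖ ≤ B := by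
  obtain ⟨B, hB⟩ := exists_bound_fderiv_aux hg L c hK M' hpar _ ∅ rfl 0 le_rfl
  exact ⟨B, fun p => hB p (by simp)⟩

end Polyhedral

/-! ### Almost maximal terms and the triangulation -/

section TropicalEstimates

variable {k : ℕ}

/-- The linear form `u ↦ a · u`. -/
def dotForm (a : Fin k → ℤ) : (Fin k → ℝ) →L[ℝ] ℝ :=
  ∑ j, (a j : ℝ) • ContinuousLinearMap.proj j

theorem dotForm_apply (a : Fin k → ℤ) (u : Fin k → ℝ) : dotForm a u = ∑ j, (a j : ℝ) * u j := by
  simp [dotForm]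

theorem tropicalTerm_eq (ν : (Fin k → ℤ) → ℝ) (a : Fin k → ℤ) (u : Fin k → ℝ) :
    tropicalTerm ν a u = dotForm a u - ν a := by
  rw [tropicalTerm, dotForm_apply]

open Classical in
/-- The indices of the terms that are maximal at `u` up to `δ`. -/
def nearMax (A : Finset (Fin k → ℤ)) (ν : (Fin k → ℤ) → ℝ) (δ : ℝ) (u : Fin k → ℝ) :
    Finset (Fin k → ℤ) :=
  A.filter fun a => ∀ b ∈ A, tropicalTerm ν b u ≤ tropicalTerm ν a u + δ

theorem mem_nearMax {A : Finset (Fin k → ℤ)} {ν : (Fin k → ℤ) → ℝ} {δ : ℝ} {u : Fin k → ℝ}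
    {a : Fin k → ℤ} : a ∈ nearMax A ν δ u ↔
      a ∈ A ∧ ∀ b ∈ A, tropicalTerm ν b u ≤ tropicalTerm ν a u + δ := by
  simp [nearMax]

theorem nearMax_mono {A : Finset (Fin k → ℤ)} {ν : (Fin k → ℤ) → ℝ} {δ δ' : ℝ} (h : δ ≤ δ')
    (u : Fin k → ℝ) : nearMax A ν δ u ⊆ nearMax A ν δ' u := fun a ha => by
  rw [mem_nearMax] at ha ⊢
  exact ⟨ha.1, fun b hb => (ha.2 b hb).trans (by linarith)⟩

theorem exists_metricNorm_le (G : Matrix (Fin k) (Fin k) ℝ) :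
    ∃ C : ℝ, 0 < C ∧ ∀ v : Fin k → ℝ, metricNorm G v ≤ C * ‖v‖ := by
  refine ⟨1 + ∑ i, ∑ j, |G i j|, by positivity, fun v => ?_⟩
  set S : ℝ := ∑ i, ∑ j, |G i j| with hS
  have hS0 : 0 ≤ S := by positivity
  refine Real.sqrt_le_iff.2 ⟨by positivity, ?_⟩
  have h1 : v ⬝ᵥ (G *ᵥ v) ≤ S * ‖v‖ ^ 2 := by
    simp only [dotProduct, Matrix.mulVec, Finset.mul_sum, hS, Finset.sum_mul]
    refine Finset.sum_le_sum fun i _ => Finset.sum_le_sum fun j _ => ?_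
    have hi := norm_le_pi_norm v i
    have hj := norm_le_pi_norm v j
    calc v i * (G i j * v j) ≤ |v i * (G i j * v j)| := le_abs_self _
      _ = |G i j| * (‖v i‖ * ‖v j‖) := by rw [abs_mul, abs_mul]; simp only [Real.norm_eq_abs]; ring
      _ ≤ |G i j| * (‖v‖ * ‖v‖) := by gcongr
      _ = |G i j| * ‖v‖ ^ 2 := by ring
  have h2 : 0 ≤ ‖v‖ ^ 2 := by positivity
  nlinarith [mul_nonneg hS0 h2, mul_nonneg (mul_nonneg hS0 hS0) h2]

theorem exists_le_metricNorm {G : Matrix (Fin k) (Fin k) ℝ} (hG : G.PosDef) :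
    ∃ c : ℝ, 0 < c ∧ ∀ v : Fin k → ℝ, c * ‖v‖ ≤ metricNorm G v := by
  have hcont : Continuous fun v : Fin k → ℝ => v ⬝ᵥ (G *ᵥ v) := by
    simp only [dotProduct, Matrix.mulVec]
    fun_prop
  obtain ⟨m, hm, hmv⟩ : ∃ m : ℝ, 0 < m ∧ ∀ v : Fin k → ℝ, ‖v‖ = 1 → m ≤ v ⬝ᵥ (G *ᵥ v) := by
    rcases (Metric.sphere (0 : Fin k → ℝ) 1).eq_empty_or_nonempty with h | h
    · exact ⟨1, one_pos, fun v hv => absurd (show v ∈ Metric.sphere (0 : Fin k → ℝ) 1 by simpa)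
        (by simp [h])⟩
    · obtain ⟨v₀, hv₀, hmin⟩ := (isCompact_sphere (0 : Fin k → ℝ) 1).exists_isMinOn h
        hcont.continuousOn
      refine ⟨_, ?_, fun v hv => hmin (show v ∈ Metric.sphere (0 : Fin k → ℝ) 1 by simpa)⟩
      have hne : v₀ ≠ 0 := by rintro rfl; simp at hv₀
      simpa using hG.dotProduct_mulVec_pos hne
  refine ⟨Real.sqrt m, Real.sqrt_pos.2 hm, fun v => ?_⟩
  rcases eq_or_ne v 0 with rfl | hv
  · simp [metricNorm]
  have hv0 : 0 < ‖v‖ := norm_pos_iff.2 hv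
  have h1 := hmv (‖v‖⁻¹ • v) (by rw [norm_smul, norm_inv, norm_norm, inv_mul_cancel₀ hv0.ne'])
  have h2 : (‖v‖⁻¹ • v) ⬝ᵥ (G *ᵥ (‖v‖⁻¹ • v)) = (v ⬝ᵥ (G *ᵥ v)) / ‖v‖ ^ 2 := by
    rw [Matrix.mulVec_smul, smul_dotProduct, dotProduct_smul, smul_eq_mul, smul_eq_mul]
    field_simp
  rw [h2, le_div_iff₀ (by positivity)] at h1
  rw [metricNorm]
  refine Real.le_sqrt_of_sq_le ?_
  rw [mul_pow, Real.sq_sqrt hm.le]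
  exact h1

theorem metricNorm_nonneg (G : Matrix (Fin k) (Fin k) ℝ) (v : Fin k → ℝ) : 0 ≤ metricNorm G v :=
  Real.sqrt_nonneg _

theorem metricDist_le (G : Matrix (Fin k) (Fin k) ℝ) (p : Fin k → ℝ) {C : Set (Fin k → ℝ)}
    {q : Fin k → ℝ} (hq : q ∈ C) : metricDist G p C ≤ metricNorm G (p - q) :=
  csInf_le ⟨0, by rintro _ ⟨y, -, rfl⟩; exact metricNorm_nonneg _ _⟩ ⟨q, hq, rfl⟩

/-- A term that is almost maximal at `u` has its chamber close to `u`. -/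
theorem exists_metricDist_chamber_le (A : Finset (Fin k → ℤ)) (ν : (Fin k → ℤ) → ℝ)
    (G : Matrix (Fin k) (Fin k) ℝ) {ε : ℝ} (hε : 0 < ε) :
    ∃ δ : ℝ, 0 < δ ∧ ∀ u, ∀ a ∈ nearMax A ν δ u, metricDist G u (chamber A ν a) ≤ ε := by
  obtain ⟨C, hC, hCn⟩ := exists_metricNorm_le G
  have h1 : ∀ a : Fin k → ℤ, ∀ᶠ δ in 𝓝[>] (0 : ℝ), ∀ u, a ∈ nearMax A ν δ u →
      metricDist G u (chamber A ν a) ≤ ε := by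
    intro a
    obtain ⟨δ₀, hδ₀, h⟩ := exists_near_solution (ι := A) (fun b => dotForm b.1 - dotForm a)
      (fun b => ν a - ν b) (show 0 < ε / C by positivity)
    filter_upwards [Ioc_mem_nhdsGT hδ₀] with δ hδ u hu
    rw [mem_nearMax] at hu
    obtain ⟨q, hq, hqn⟩ := h u fun b => by
      have := hu.2 b b.2
      rw [tropicalTerm_eq, tropicalTerm_eq] at this
      simp only [sub_apply]
      linarith [hδ.2]
    refine (metricDist_le G u (q := q) fun b hb => ?_).trans ((hCn _).trans ?_)
    · have := hq ⟨b, hb⟩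
      simp only [sub_apply] at this
      rw [tropicalTerm_eq, tropicalTerm_eq]
      linarith
    · calc C * ‖u - q‖ ≤ C * (ε / C) := by gcongr
        _ = ε := by field_simp
  obtain ⟨δ, h, hδ⟩ := (((Filter.eventually_all_finset A).2 fun a _ => h1 a).and
    self_mem_nhdsWithin).exists
  exact ⟨δ, hδ, fun u a ha => h a (mem_nearMax.1 ha).1 u ha⟩

/-- The terms that are almost maximal at some point are all maximal at another point. -/
theorem exists_common_chamber_point (A : Finset (Fin k → ℤ)) (ν : (Fin k → ℤ) → ℝ) :
    ∃ δ : ℝ, 0 < δ ∧ ∀ u, ∃ q, ∀ a ∈ nearMax A ν δ u, q ∈ chamber A ν a := by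
  -- For a fixed `τ`, maximality of all its terms is a finite system of affine inequalities;
  -- approximate solvability implies solvability. There are finitely many `τ`.
  have h1 : ∀ τ ∈ A.powerset, ∀ᶠ δ in 𝓝[>] (0 : ℝ), ∀ u, τ = nearMax A ν δ u →
      ∃ q, ∀ a ∈ τ, q ∈ chamber A ν a := by
    intro τ _
    obtain ⟨δ₀, hδ₀, h⟩ := exists_near_solution (ι := A × τ)
      (fun b => dotForm b.1.1 - dotForm b.2.1) (fun b => ν b.2 - ν b.1) one_pos
    filter_upwards [Ioc_mem_nhdsGT hδ₀] with δ hδ u hu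
    obtain ⟨q, hq, -⟩ := h u fun b => by
      have := (mem_nearMax.1 (show (b.2 : Fin k → ℤ) ∈ nearMax A ν δ u from by
        rw [← hu]; exact b.2.2)).2 b.1 b.1.2
      rw [tropicalTerm_eq, tropicalTerm_eq] at this
      simp only [sub_apply]
      linarith [hδ.2]
    refine ⟨q, fun a ha b hb => ?_⟩
    have := hq (⟨b, hb⟩, ⟨a, ha⟩)
    simp only [sub_apply] at this
    rw [tropicalTerm_eq, tropicalTerm_eq]
    linarith
  obtain ⟨δ, h, hδ⟩ := (((Filter.eventually_all_finset _).2 h1).and self_mem_nhdsWithin).exists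
  refine ⟨δ, hδ, fun u => h _ (Finset.mem_powerset.2 ?_) u rfl⟩
  exact fun a ha => (mem_nearMax.1 ha).1

/-- The map sending coefficients to their sum and their moments is injective, by affine independence
applied to real and imaginary parts, and an injective linear map in finite dimension is bounded
below. -/
theorem exists_bound_of_affineIndependent {τ : Finset (Fin k → ℤ)}
    (hτ : ∀ w : (Fin k → ℤ) → ℝ, ∑ a ∈ τ, w a = 0 → (∀ j, ∑ a ∈ τ, w a * (a j : ℝ) = 0) →
      ∀ a ∈ τ, w a = 0) :
    ∃ c : ℝ, 0 < c ∧ ∀ (g : (Fin k → ℤ) → ℂ) (N : ℝ), ‖∑ a ∈ τ, g a‖ ≤ N →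
      (∀ j, ‖∑ a ∈ τ, g a * (a j : ℂ)‖ ≤ N) → ∀ a ∈ τ, c * ‖g a‖ ≤ N := by
  classical
  let Φ : (τ → ℂ) →ₗ[ℝ] ℂ × (Fin k → ℂ) :=
    { toFun := fun g => (∑ a, g a, fun j => ∑ a, g a * ((a : Fin k → ℤ) j : ℂ))
      map_add' := fun g h => by
        ext j <;> simp [Finset.sum_add_distrib, add_mul]
      map_smul' := fun r g => by
        ext j <;> simp [Finset.mul_sum, mul_assoc] }
  have hker : LinearMap.ker Φ = ⊥ := by
    refine (LinearMap.ker_eq_bot').2 fun g hg => ?_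
    have h0 : ∑ a, g a = 0 := congrArg Prod.fst hg
    have hj : ∀ j, ∑ a, g a * ((a : Fin k → ℤ) j : ℂ) = 0 := fun j =>
      congrFun (congrArg Prod.snd hg) j
    have key : ∀ T : ℂ →L[ℝ] ℝ, ∀ a, T (g a) = 0 := by
      intro T a
      have := hτ (fun b => if hb : b ∈ τ then T (g ⟨b, hb⟩) else 0) ?_ ?_ a a.2
      · simpa using this
      · rw [← Finset.sum_coe_sort]
        simpa using congrArg T h0
      · intro j
        rw [← Finset.sum_coe_sort]
        have := congrArg T (hj j)
        rw [map_sum, map_zero] at this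
        rw [← this]
        refine Finset.sum_congr rfl fun b _ => ?_
        have h3 : g b * ((b : Fin k → ℤ) j : ℂ) = ((b : Fin k → ℤ) j : ℝ) • g b := by
          rw [Complex.real_smul, mul_comm]; simp
        rw [h3, map_smul]
        simp [mul_comm]
    funext a
    exact Complex.ext (key Complex.reCLM a) (key Complex.imCLM a)
  obtain ⟨C, hC, hanti⟩ := Φ.exists_antilipschitzWith hker
  refine ⟨(C : ℝ)⁻¹, by positivity, fun g N h0 hj a ha => ?_⟩
  have h1 := hanti.le_mul_norm (f := Φ) (map_zero Φ) (fun b : τ => g b)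
  have hN : 0 ≤ N := (norm_nonneg _).trans h0
  have h2 : ‖Φ fun b : τ => g b‖ ≤ N := by
    refine max_le ?_ ((pi_norm_le_iff_of_nonneg hN).2 fun j => ?_)
    · rw [← Finset.sum_coe_sort] at h0
      exact h0
    · have := hj j
      rw [← Finset.sum_coe_sort τ (fun a => g a * (a j : ℂ))] at this
      exact this
  have h3 := norm_le_pi_norm (fun b : τ => g b) ⟨a, ha⟩
  have hC' : (0 : ℝ) < C := hC
  rw [inv_mul_le_iff₀ hC']
  calc ‖g a‖ ≤ _ := h3
    _ ≤ _ := h1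
    _ ≤ C * N := by gcongr

/-- If the induced subdivision is a triangulation, then the coefficients of an almost maximal
collection of terms are controlled by the sum of the terms and its logarithmic derivatives. -/
theorem exists_nearMax_bound {A : Finset (Fin k → ℤ)} {ν : (Fin k → ℤ) → ℝ}
    (hν : InducesTriangulation A ν) :
    ∃ δ : ℝ, 0 < δ ∧ ∃ c : ℝ, 0 < c ∧ ∀ u, ∀ τ ⊆ nearMax A ν δ u, ∀ (g : (Fin k → ℤ) → ℂ) (N : ℝ),
      ‖∑ a ∈ τ, g a‖ ≤ N → (∀ j, ‖∑ a ∈ τ, g a * (a j : ℂ)‖ ≤ N) → ∀ a ∈ τ, c * ‖g a‖ ≤ N := by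
  classical
  obtain ⟨δ, hδ, hq⟩ := exists_common_chamber_point A ν
  have h1 : ∀ τ : Finset (Fin k → ℤ), ∃ c : ℝ, 0 < c ∧ ((∃ u, τ ⊆ nearMax A ν δ u) →
      ∀ (g : (Fin k → ℤ) → ℂ) (N : ℝ), ‖∑ a ∈ τ, g a‖ ≤ N →
        (∀ j, ‖∑ a ∈ τ, g a * (a j : ℂ)‖ ≤ N) → ∀ a ∈ τ, c * ‖g a‖ ≤ N) := by
    intro τ
    by_cases hτ : ∃ u, τ ⊆ nearMax A ν δ u
    · obtain ⟨u, hu⟩ := hτ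
      -- Affine independence is known only for terms that are maximal at one point, so `u` is
      -- replaced by such a point `q`.
      obtain ⟨q, hq⟩ := hq u
      have hind := hν.simplices q
      rw [affineIndependent_iff] at hind
      obtain ⟨c, hc, h⟩ := exists_bound_of_affineIndependent (τ := τ) fun w hw hwj a ha => by
        let e : τ ↪ {a : Fin k → ℤ // a ∈ A ∧ q ∈ chamber A ν a} :=
          ⟨fun b => ⟨b, (mem_nearMax.1 (hu b.2)).1, hq b (hu b.2)⟩, fun b b' hbb => by
            exact Subtype.ext (congrArg
              (fun x : {a : Fin k → ℤ // a ∈ A ∧ q ∈ chamber A ν a} => (x : Fin k → ℤ)) hbb)⟩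
        have := hind (Finset.univ.map e) (fun b => w b) ?_ ?_ (e ⟨a, ha⟩) (by simp)
        · exact this
        · rw [Finset.sum_map]
          exact (Finset.sum_coe_sort τ w).trans hw
        · rw [Finset.sum_map]
          funext j
          simp only [Finset.sum_apply, Pi.smul_apply, smul_eq_mul, Pi.zero_apply]
          exact (Finset.sum_coe_sort τ fun b => w b * (b j : ℝ)).trans (hwj j)
      exact ⟨c, hc, fun _ => h⟩
    · exact ⟨1, one_pos, fun h => absurd h hτ⟩
  choose c hc h using h1
  obtain ⟨c', hc', hc0⟩ : ∃ c', (∀ τ ∈ A.powerset, c' ≤ c τ) ∧ 0 < c' :=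
    ((((Filter.eventually_all_finset A.powerset).2 fun τ _ =>
      (eventually_le_nhds (hc τ)).filter_mono nhdsWithin_le_nhds).and
        self_mem_nhdsWithin : ∀ᶠ x in 𝓝[>] (0 : ℝ), _)).exists
  refine ⟨δ, hδ, c', hc0, fun u τ hτ g N h0 hj a ha => ?_⟩
  have hmem : τ ∈ A.powerset :=
    Finset.mem_powerset.2 fun b hb => (mem_nearMax.1 (hτ hb)).1
  calc c' * ‖g a‖ ≤ c τ * ‖g a‖ := by gcongr; exact hc' τ hmem
    _ ≤ N := h τ ⟨u, hτ⟩ g N h0 hj a ha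

/-- Up to a bounded error, each point is a direction in which the almost maximal terms agree. -/
theorem exists_dist_direction_le (A : Finset (Fin k → ℤ)) (ν : (Fin k → ℤ) → ℝ) :
    ∃ C : ℝ, 0 ≤ C ∧ ∀ δ ≤ (1 : ℝ), ∀ u, ∃ v, ‖u - v‖ ≤ C ∧
      ∀ a ∈ nearMax A ν δ u, ∀ b ∈ nearMax A ν δ u, dotForm a v = dotForm b v := by
  classical
  choose C hC h using fun s : Set (A × A) =>
    exists_bound_dist_ker (fun p : A × A => dotForm p.1.1 - dotForm p.2.1) s
  -- Two almost maximal terms differ by at most δ ≤ 1, so their linear parts differ by at most 1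
  -- plus the two values of `ν`.
  set M : ℝ := 1 + 2 * ∑ a ∈ A, |ν a| with hM
  have hM0 : 0 ≤ M := by positivity
  refine ⟨(∑ s, C s) * M, mul_nonneg (Finset.sum_nonneg fun s _ => hC s) hM0, fun δ hδ u => ?_⟩
  let s : Set (A × A) := {p | p.1.1 ∈ nearMax A ν δ u ∧ p.2.1 ∈ nearMax A ν δ u}
  obtain ⟨v, hv, huv⟩ := h s M u hM0 fun p hp => by
    have h1 := (mem_nearMax.1 hp.1).2 p.2 p.2.2
    have h2 := (mem_nearMax.1 hp.2).2 p.1 p.1.2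
    have h3 := Finset.single_le_sum (f := fun a => |ν a|) (fun _ _ => abs_nonneg _) p.1.2
    have h4 := Finset.single_le_sum (f := fun a => |ν a|) (fun _ _ => abs_nonneg _) p.2.2
    rw [tropicalTerm_eq, tropicalTerm_eq] at h1 h2
    simp only [sub_apply]
    have h5 := abs_le.1 h3
    have h6 := abs_le.1 h4
    have h7 := neg_abs_le (ν p.1)
    have h8 := le_abs_self (ν p.1)
    have h9 := neg_abs_le (ν p.2)
    have h10 := le_abs_self (ν p.2)
    exact abs_le.2 ⟨by linarith, by linarith⟩
  refine ⟨v, huv.trans ?_, fun a ha b hb => ?_⟩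
  · gcongr
    exact Finset.single_le_sum (f := C) (fun s _ => hC s) (Finset.mem_univ s)
  · have := hv (⟨a, (mem_nearMax.1 ha).1⟩, ⟨b, (mem_nearMax.1 hb).1⟩) ⟨ha, hb⟩
    simpa [sub_eq_zero] using this

/-- Where the maximum of the terms is smooth, it is attained only once. -/
theorem eq_of_mem_chamber {A : Finset (Fin k → ℤ)} {ν : (Fin k → ℤ) → ℝ} {u : Fin k → ℝ}
    (hu : u ∉ tropicalAmoeba A ν) {a b : Fin k → ℤ} (ha : a ∈ A) (hb : b ∈ A)
    (hua : u ∈ chamber A ν a) (hub : u ∈ chamber A ν b) : a = b := by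
  simp only [tropicalAmoeba, mem_ofPred_eq, not_not] at hu
  have hne : Nonempty A := ⟨⟨a, ha⟩⟩
  set m : (Fin k → ℝ) → ℝ := fun w => ⨆ a : A, tropicalTerm ν a w with hm
  have hdm : HasFDerivAt m (fderiv ℝ m u) u := (hu.differentiableAt (by simp)).hasFDerivAt
  -- The maximum minus the term of `c` is nonnegative and vanishes at `u`, so its differential
  -- vanishes there.
  have key : ∀ c ∈ A, u ∈ chamber A ν c → fderiv ℝ m u = dotForm c := by
    intro c hc huc
    have hle : ∀ w, tropicalTerm ν c w ≤ m w := fun w =>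
      le_ciSup (f := fun a : A => tropicalTerm ν a w) (Finite.bddAbove_range _) ⟨c, hc⟩
    have heq : m u = tropicalTerm ν c u :=
      le_antisymm (ciSup_le fun d => huc d d.2) (hle u)
    have hdc : HasFDerivAt (tropicalTerm ν c) (dotForm c) u := by
      have : tropicalTerm ν c = fun w => dotForm c w - ν c := funext (tropicalTerm_eq ν c)
      rw [this]
      exact (dotForm c).hasFDerivAt.sub_const _
    have hmin : IsLocalMin (fun w => m w - tropicalTerm ν c w) u :=
      Filter.Eventually.of_forall fun w => by
        simp only [heq, sub_self, sub_nonneg]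
        exact hle w
    have := hmin.hasFDerivAt_eq_zero (hdm.sub hdc)
    exact sub_eq_zero.1 this
  have h := (key a ha hua).symm.trans (key b hb hub)
  funext j
  have := congrArg (fun T : (Fin k → ℝ) →L[ℝ] ℝ => T (Pi.single j 1)) h
  simpa [dotForm_apply, Pi.single_apply] using this

/-- Terms that are not maximal at `u` stay below the maximum by a definite gap, as there are
finitely many; only one term is maximal. -/
theorem exists_nearMax_subsingleton {A : Finset (Fin k → ℤ)} {ν : (Fin k → ℤ) → ℝ}
    {u : Fin k → ℝ} (hu : u ∉ tropicalAmoeba A ν) :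
    ∃ δ : ℝ, 0 < δ ∧ ∀ a ∈ nearMax A ν δ u, ∀ b ∈ nearMax A ν δ u, a = b := by
  have h1 : ∀ a ∈ A, ∀ᶠ δ in 𝓝[>] (0 : ℝ), a ∈ nearMax A ν δ u → u ∈ chamber A ν a := by
    intro a _
    have : ∀ b ∈ A, ∀ᶠ δ in 𝓝[>] (0 : ℝ), tropicalTerm ν b u ≤ tropicalTerm ν a u + δ →
        tropicalTerm ν b u ≤ tropicalTerm ν a u := by
      intro b _
      rcases le_or_gt (tropicalTerm ν b u) (tropicalTerm ν a u) with h | h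
      · exact Filter.Eventually.of_forall fun _ _ => h
      · filter_upwards [Ioo_mem_nhdsGT (sub_pos.2 h)] with δ hδ hle
        linarith [hδ.2]
    filter_upwards [(Filter.eventually_all_finset A).2 this] with δ hδ ha b hb
    exact hδ b hb ((mem_nearMax.1 ha).2 b hb)
  obtain ⟨δ, h, hδ⟩ := (((Filter.eventually_all_finset A).2 h1).and self_mem_nhdsWithin).exists
  refine ⟨δ, hδ, fun a ha b hb => eq_of_mem_chamber hu (mem_nearMax.1 ha).1 (mem_nearMax.1 hb).1
    (h a (mem_nearMax.1 ha).1 ha) (h b (mem_nearMax.1 hb).1 hb)⟩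

theorem IsCutoffFamily.fderiv_eq_zero {A : Finset (Fin k → ℤ)} {ν : (Fin k → ℤ) → ℝ}
    {G : Matrix (Fin k) (Fin k) ℝ} {ε₁ ε₂ : ℝ} {χ : (Fin k → ℤ) → (Fin k → ℝ) → ℝ}
    (hχ : IsCutoffFamily A ν G ε₁ ε₂ χ) {a : Fin k → ℤ} (ha : a ∈ A) {p : Fin k → ℝ}
    (hp : χ a p = 0 ∨ χ a p = 1) : fderiv ℝ (χ a) p = 0 := by
  rcases hp with hp | hp
  · refine IsLocalMin.fderiv_eq_zero (Filter.Eventually.of_forall fun q => ?_)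
    rw [hp]; exact (hχ.mem_Icc a ha q).1
  · refine IsLocalMax.fderiv_eq_zero (Filter.Eventually.of_forall fun q => ?_)
    rw [hp]; exact (hχ.mem_Icc a ha q).2

/-- The chambers near a point have almost maximal terms. -/
theorem exists_abs_sub_le_of_mem_nearbyFace {A : Finset (Fin k → ℤ)} {ν : (Fin k → ℤ) → ℝ}
    (hν : InducesTriangulation A ν) {G : Matrix (Fin k) (Fin k) ℝ} (hG : G.PosDef) (ε : ℝ) :
    ∃ M : ℝ, ∀ p, ∀ a ∈ nearbyFace A ν G ε p, ∀ b ∈ nearbyFace A ν G ε p,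
      |tropicalTerm ν b p - tropicalTerm ν a p| ≤ M := by
  obtain ⟨c, hc, hcn⟩ := exists_le_metricNorm hG
  set D : ℝ := ∑ a ∈ A, ‖dotForm a‖ with hD
  have hDa : ∀ a ∈ A, ‖dotForm a‖ ≤ D := fun a ha =>
    Finset.single_le_sum (f := fun a => ‖dotForm a‖) (fun _ _ => norm_nonneg _) ha
  have hD0 : 0 ≤ D := Finset.sum_nonneg fun _ _ => norm_nonneg _
  have key : ∀ p, ∀ a ∈ nearbyFace A ν G ε p, ∀ b ∈ A,
      tropicalTerm ν b p - tropicalTerm ν a p ≤ 2 * D * ((ε + 1) / c) := by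
    intro p a ha b hb
    -- Strict convexity makes the chamber nonempty. For an empty chamber the infimum defining the
    -- distance would be 0 and say nothing. The slack `ε + 1` replaces attainment of the infimum.
    obtain ⟨u, hu⟩ := hν.strictlyConvex a ha.1
    have hne : ((fun q => metricNorm G (p - q)) '' chamber A ν a).Nonempty :=
      ⟨_, u, fun b hb => by
        rcases eq_or_ne b a with rfl | h
        · exact le_rfl
        · exact (hu b hb h).le, rfl⟩
    obtain ⟨_, ⟨q, hq, rfl⟩, hlt⟩ := exists_lt_of_csInf_lt hne
      (show metricDist G p (chamber A ν a) < ε + 1 by linarith [ha.2])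
    have hn : ‖p - q‖ ≤ (ε + 1) / c := by
      rw [le_div_iff₀ hc]
      have := hcn (p - q)
      linarith [mul_comm c ‖p - q‖]
    have h1 : tropicalTerm ν b q ≤ tropicalTerm ν a q := hq b hb
    have h2 : ∀ d ∈ A, |dotForm d (p - q)| ≤ D * ((ε + 1) / c) := fun d hd => by
      calc |dotForm d (p - q)| ≤ ‖dotForm d‖ * ‖p - q‖ := (dotForm d).le_opNorm _
        _ ≤ D * ((ε + 1) / c) := by gcongr; exact hDa d hd
    have h3 := (abs_le.1 (h2 b hb)).2
    have h4 := (abs_le.1 (h2 a ha.1)).1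
    rw [tropicalTerm_eq, tropicalTerm_eq] at h1 ⊢
    rw [map_sub] at h3 h4
    linarith
  refine ⟨2 * D * ((ε + 1) / c), fun p a ha b hb => abs_le.2 ⟨?_, key p a ha b hb.1⟩⟩
  linarith [key p b hb a ha.1]

/-- The forms are the differences of the terms of `b` and `a`. Chambers near `p` have forms of size
at most `M`, so a vector killed by all such forms is parallel to the face, where the `parallel`
condition applies. Where the cutoff is 0 or 1 its differential vanishes. -/
theorem IsCutoffFamily.exists_bound_fderiv {A : Finset (Fin k → ℤ)} {ν : (Fin k → ℤ) → ℝ}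
    (hν : InducesTriangulation A ν) {G : Matrix (Fin k) (Fin k) ℝ} (hG : G.PosDef) {ε₁ ε₂ : ℝ}
    {χ : (Fin k → ℤ) → (Fin k → ℝ) → ℝ} (hχ : IsCutoffFamily A ν G ε₁ ε₂ χ) :
    ∃ B : ℝ, 0 ≤ B ∧ ∀ a ∈ A, ∀ p, ‖fderiv ℝ (χ a) p‖ ≤ B := by
  obtain ⟨M, hM⟩ := exists_abs_sub_le_of_mem_nearbyFace hν hG ε₂
  obtain ⟨K, hK, hpar⟩ := hχ.parallel
  have h1 : ∀ a : Fin k → ℤ, ∃ B : ℝ, a ∈ A → ∀ p, ‖fderiv ℝ (χ a) p‖ ≤ B := by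
    intro a
    by_cases ha : a ∈ A
    · obtain ⟨B, hB⟩ := _root_.exists_bound_fderiv (hχ.smooth a ha) (ι := A)
        (fun b => dotForm b.1 - dotForm a) (fun b => ν a - ν b) hK M fun p hp v hv => by
          have h0 := hχ.mem_Icc a ha p
          rcases h0.1.eq_or_lt with h | hpos
          · rw [hχ.fderiv_eq_zero ha (Or.inl h.symm)]; rfl
          rcases h0.2.eq_or_lt with h | hlt
          · rw [hχ.fderiv_eq_zero ha (Or.inr h)]; rfl
          have hmem : a ∈ nearbyFace A ν G ε₂ p := by
            refine ⟨ha, ?_⟩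
            by_contra hcon
            exact hpos.ne' (hχ.eq_zero a ha p (not_le.1 hcon).le)
          refine hpar p hp a hmem hpos hlt v ?_
          have hall : ∀ b ∈ nearbyFace A ν G ε₂ p, dotForm b v = dotForm a v := fun b hb => by
            have h2 := hM p a hmem b hb
            rw [tropicalTerm_eq, tropicalTerm_eq] at h2
            have h3 := hv ⟨b, hb.1⟩ (by
              simp only [sub_apply]
              rwa [show dotForm b p - dotForm a p + (ν a - ν b) =
                dotForm b p - ν b - (dotForm a p - ν a) by ring])
            simpa [sub_eq_zero] using h3
          intro b hb d hd
          rw [← dotForm_apply, ← dotForm_apply, hall b hb, hall d hd]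
      exact ⟨B, fun _ => hB⟩
    · exact ⟨0, fun h => absurd h ha⟩
  choose B hB using h1
  refine ⟨∑ a ∈ A, |B a|, Finset.sum_nonneg fun _ _ => abs_nonneg _, fun a ha p => ?_⟩
  exact (hB a ha p).trans ((le_abs_self _).trans
    (Finset.single_le_sum (f := fun a => |B a|) (fun _ _ => abs_nonneg _) ha))

end TropicalEstimates

/-! ### Differentiation in logarithmic coordinates -/

section TorusDerivative

variable {k : ℕ}

/-- The componentwise real part. -/
def reL (k : ℕ) : (Fin k → ℂ) →L[ℝ] (Fin k → ℝ) :=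
  ContinuousLinearMap.pi fun j => Complex.reCLM.comp (ContinuousLinearMap.proj j)

/-- The componentwise imaginary part. -/
def imL (k : ℕ) : (Fin k → ℂ) →L[ℝ] (Fin k → ℝ) :=
  ContinuousLinearMap.pi fun j => Complex.imCLM.comp (ContinuousLinearMap.proj j)

/-- The inclusion of `ℝ^k` in `ℂ^k`. -/
def ofRealL (k : ℕ) : (Fin k → ℝ) →L[ℝ] (Fin k → ℂ) :=
  ContinuousLinearMap.pi fun j => Complex.ofRealCLM.comp (ContinuousLinearMap.proj j)

@[simp] theorem reL_apply (ζ : Fin k → ℂ) (j : Fin k) : reL k ζ j = (ζ j).re := rfl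
@[simp] theorem imL_apply (ζ : Fin k → ℂ) (j : Fin k) : imL k ζ j = (ζ j).im := rfl
@[simp] theorem ofRealL_apply (v : Fin k → ℝ) (j : Fin k) : ofRealL k v j = (v j : ℂ) := rfl

theorem norm_reL_le (ζ : Fin k → ℂ) : ‖reL k ζ‖ ≤ ‖ζ‖ :=
  (pi_norm_le_iff_of_nonneg (norm_nonneg _)).2 fun j =>
    (Complex.abs_re_le_norm (ζ j)).trans (norm_le_pi_norm ζ j)

theorem norm_imL_le (ζ : Fin k → ℂ) : ‖imL k ζ‖ ≤ ‖ζ‖ :=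
  (pi_norm_le_iff_of_nonneg (norm_nonneg _)).2 fun j =>
    (Complex.abs_im_le_norm (ζ j)).trans (norm_le_pi_norm ζ j)

@[simp] theorem norm_ofRealL (v : Fin k → ℝ) : ‖ofRealL k v‖ = ‖v‖ := by
  refine le_antisymm ((pi_norm_le_iff_of_nonneg (norm_nonneg _)).2 fun j => ?_)
    ((pi_norm_le_iff_of_nonneg (norm_nonneg _)).2 fun j => ?_)
  · simpa using norm_le_pi_norm v j
  · simpa using norm_le_pi_norm (ofRealL k v) j

@[simp] theorem reL_ofRealL (v : Fin k → ℝ) : reL k (ofRealL k v) = v := by ext; simp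
@[simp] theorem imL_ofRealL (v : Fin k → ℝ) : imL k (ofRealL k v) = 0 := by ext; simp

/-- The derivative of `f` at `x` in logarithmic coordinates. -/
def torusDeriv (f : (Fin k → ℂ) → ℂ) (x : Fin k → ℂ) : (Fin k → ℂ) →L[ℝ] ℂ :=
  (fderiv ℝ f x).comp (ContinuousLinearMap.mul ℝ (Fin k → ℂ) x)

theorem torusDeriv_apply (f : (Fin k → ℂ) → ℂ) (x ζ : Fin k → ℂ) :
    torusDeriv f x ζ = fderiv ℝ f x (x * ζ) := rfl

theorem ContDiffAt.zpow_const {E : Type*} [NormedAddCommGroup E] [NormedSpace ℝ E] {f : E → ℂ}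
    {x : E} {n : WithTop ℕ∞} (hf : ContDiffAt ℝ n f x) (h : f x ≠ 0) (m : ℤ) :
    ContDiffAt ℝ n (fun y => f y ^ m) x := by
  cases m with
  | ofNat m => simpa using hf.pow m
  | negSucc m =>
    simp only [zpow_negSucc]
    exact (hf.pow (m + 1)).inv (pow_ne_zero _ h)

theorem contDiffAt_logMap {n : WithTop ℕ∞} {x : Fin k → ℂ} (hx : ∀ j, x j ≠ 0) :
    ContDiffAt ℝ n logMap x := by
  refine contDiffAt_pi.2 fun j => ?_
  have h1 : ContDiffAt ℝ n (fun y : Fin k → ℂ => y j) x :=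
    (contDiff_apply ℝ ℂ j).contDiffAt
  exact (h1.norm ℝ (hx j)).log (norm_ne_zero_iff.2 (hx j))

theorem logMapBase_eq (t : ℝ) (x : Fin k → ℂ) : logMapBase t x = (Real.log t)⁻¹ • logMap x := by
  ext j
  simp [logMapBase, logMap, div_eq_inv_mul]

theorem contDiffAt_tailoredFun {A : Finset (Fin k → ℤ)} (ν : (Fin k → ℤ) → ℝ)
    (α : (Fin k → ℤ) → ℂ) {χ : (Fin k → ℤ) → (Fin k → ℝ) → ℝ} (hχ : ∀ a ∈ A, ContDiff ℝ ∞ (χ a))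
    (t s : ℝ) {x : Fin k → ℂ} (hx : ∀ j, x j ≠ 0) :
    ContDiffAt ℝ ∞ (fun p : (Fin k → ℂ) × ℝ => tailoredFun A ν α χ t p.2 p.1) (x, s) := by
  refine ContDiffAt.sum fun a ha => ?_
  have h1 : ContDiffAt ℝ ∞ (fun p : (Fin k → ℂ) × ℝ => χ a (logMapBase t p.1)) (x, s) := by
    have h0 : ContDiffAt ℝ ∞ (fun p : (Fin k → ℂ) × ℝ => logMapBase t p.1) (x, s) := by
      simp only [logMapBase_eq]
      have hl : ContDiffAt ℝ ∞ (fun p : (Fin k → ℂ) × ℝ => logMap p.1) (x, s) :=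
        (contDiffAt_logMap hx).comp (x, s) contDiffAt_fst
      exact hl.const_smul (Real.log t)⁻¹
    exact (hχ a ha).contDiffAt.comp (x, s) h0
  have h2 : ContDiffAt ℝ ∞ (fun p : (Fin k → ℂ) × ℝ =>
      (1 - p.2) + p.2 * χ a (logMapBase t p.1)) (x, s) :=
    (contDiffAt_const.sub contDiffAt_snd).add (contDiffAt_snd.mul h1)
  have h3 : ContDiffAt ℝ ∞ (fun p : (Fin k → ℂ) × ℝ =>
      (((1 - p.2) + p.2 * χ a (logMapBase t p.1) : ℝ) : ℂ)) (x, s) :=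
    Complex.ofRealCLM.contDiff.contDiffAt.comp (x, s) h2
  have h4 : ContDiffAt ℝ ∞ (fun p : (Fin k → ℂ) × ℝ => ∏ j, p.1 j ^ a j) (x, s) := by
    refine contDiffAt_prod fun j _ =>
      ContDiffAt.zpow_const (f := fun p : (Fin k → ℂ) × ℝ => p.1 j) ?_ (hx j) _
    exact ((contDiff_apply ℝ ℂ j).comp contDiff_fst).contDiffAt
  exact ((contDiffAt_const.mul h3).mul contDiffAt_const).mul h4

theorem contDiffAt_tailoredFun_left {A : Finset (Fin k → ℤ)} (ν : (Fin k → ℤ) → ℝ)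
    (α : (Fin k → ℤ) → ℂ) {χ : (Fin k → ℤ) → (Fin k → ℝ) → ℝ} (hχ : ∀ a ∈ A, ContDiff ℝ ∞ (χ a))
    (t s : ℝ) {x : Fin k → ℂ} (hx : ∀ j, x j ≠ 0) :
    ContDiffAt ℝ ∞ (tailoredFun A ν α χ t s) x :=
  ContDiffAt.comp (f := fun y => (y, s)) (g := fun p : (Fin k → ℂ) × ℝ => tailoredFun A ν α χ t p.2 p.1)
    x (contDiffAt_tailoredFun ν α hχ t s hx) (contDiffAt_id.prodMk contDiffAt_const)

/-- The monomial of `a` in the function `f_{t,0}`. -/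
def scaledMonomial (ν : (Fin k → ℤ) → ℝ) (α : (Fin k → ℤ) → ℂ) (t : ℝ) (x : Fin k → ℂ)
    (a : Fin k → ℤ) : ℂ :=
  α a * ((t ^ (-ν a) : ℝ) : ℂ) * ∏ j, x j ^ a j

/-- The coefficient of the monomial of `a` in the function `f_{t,s}`. -/
def cutoffCoeff (χ : (Fin k → ℤ) → (Fin k → ℝ) → ℝ) (t s : ℝ) (x : Fin k → ℂ) (a : Fin k → ℤ) : ℝ :=
  (1 - s) + s * χ a (logMapBase t x)

theorem tailoredFun_eq (A : Finset (Fin k → ℤ)) (ν : (Fin k → ℤ) → ℝ) (α : (Fin k → ℤ) → ℂ)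
    (χ : (Fin k → ℤ) → (Fin k → ℝ) → ℝ) (t s : ℝ) (x : Fin k → ℂ) :
    tailoredFun A ν α χ t s x =
      ∑ a ∈ A, (cutoffCoeff χ t s x a : ℂ) * scaledMonomial ν α t x a := by
  refine Finset.sum_congr rfl fun a _ => ?_
  rw [cutoffCoeff, scaledMonomial]
  ring

theorem norm_scaledMonomial (ν : (Fin k → ℤ) → ℝ) (α : (Fin k → ℤ) → ℂ) {t : ℝ} (ht : 1 < t)
    {x : Fin k → ℂ} (hx : ∀ j, x j ≠ 0) (a : Fin k → ℤ) :
    ‖scaledMonomial ν α t x a‖ =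
      ‖α a‖ * Real.exp (Real.log t * tropicalTerm ν a (logMapBase t x)) := by
  have ht0 : 0 < t := by linarith
  have hlog : Real.log t ≠ 0 := (Real.log_pos ht).ne'
  have h1 : ∀ j, ‖x j‖ ^ a j = Real.exp (a j * Real.log ‖x j‖) := fun j => by
    rw [← Real.rpow_intCast, Real.rpow_def_of_pos (norm_pos_iff.2 (hx j)), mul_comm]
  rw [scaledMonomial, norm_mul, norm_mul, norm_prod, Complex.norm_real, Real.norm_eq_abs,
    abs_of_pos (Real.rpow_pos_of_pos ht0 _), Real.rpow_def_of_pos ht0, mul_assoc]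
  simp only [norm_zpow, h1]
  rw [← Real.exp_sum, ← Real.exp_add]
  congr 2
  simp only [tropicalTerm, logMapBase, mul_sub, Finset.mul_sum]
  rw [add_comm, mul_neg, ← sub_eq_add_neg]
  congr 1
  refine Finset.sum_congr rfl fun j _ => ?_
  field_simp

theorem logMapBase_mul_exp (t : ℝ) {x : Fin k → ℂ} (hx : ∀ j, x j ≠ 0) (ζ : Fin k → ℂ) (r : ℝ) :
    logMapBase t (fun j => x j * Complex.exp (r * ζ j)) =
      logMapBase t x + r • ((Real.log t)⁻¹ • reL k ζ) := by
  ext j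
  simp only [logMapBase, norm_mul, Complex.norm_exp, Pi.add_apply, Pi.smul_apply, reL_apply,
    smul_eq_mul]
  rw [Real.log_mul (norm_ne_zero_iff.2 (hx j)) (Real.exp_pos _).ne', Real.log_exp]
  simp
  ring

theorem prod_zpow_mul_exp (x ζ : Fin k → ℂ) (r : ℝ) (a : Fin k → ℤ) :
    ∏ j, (x j * Complex.exp (r * ζ j)) ^ a j =
      (∏ j, x j ^ a j) * Complex.exp (r * ∑ j, (a j : ℂ) * ζ j) := by
  simp only [mul_zpow, Finset.prod_mul_distrib, ← Complex.exp_int_mul]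
  rw [← Complex.exp_sum, Finset.mul_sum]
  congr 2
  exact Finset.sum_congr rfl fun j _ => by ring

theorem hasDerivAt_mul_exp (x ζ : Fin k → ℂ) :
    HasDerivAt (fun (r : ℝ) (j : Fin k) => x j * Complex.exp (r * ζ j)) (x * ζ) 0 := by
  refine hasDerivAt_pi.2 fun j => ?_
  have h1 : HasDerivAt (fun r : ℝ => (r : ℂ) * ζ j) (ζ j) 0 := by
    simpa using (hasDerivAt_id (0 : ℝ)).ofReal_comp.mul_const (ζ j)
  simpa using h1.cexp.const_mul (x j)

/-- Along r ↦ x exp(rζ) the monomial of `a` is multiplied by exp(r a·ζ) and Log_t moves with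
velocity Re ζ / log t. The second summand, from the cutoff, is the only part that is not complex
linear. -/
theorem torusDeriv_tailoredFun {A : Finset (Fin k → ℤ)} (ν : (Fin k → ℤ) → ℝ)
    (α : (Fin k → ℤ) → ℂ) {χ : (Fin k → ℤ) → (Fin k → ℝ) → ℝ} (hχ : ∀ a ∈ A, ContDiff ℝ ∞ (χ a))
    (t s : ℝ) {x : Fin k → ℂ} (hx : ∀ j, x j ≠ 0) (ζ : Fin k → ℂ) :
    torusDeriv (tailoredFun A ν α χ t s) x ζ =
      ∑ a ∈ A, scaledMonomial ν α t x a * ((cutoffCoeff χ t s x a : ℂ) * (∑ j, (a j : ℂ) * ζ j) +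
        ((s * ((Real.log t)⁻¹ * fderiv ℝ (χ a) (logMapBase t x) (reL k ζ)) : ℝ) : ℂ)) := by
  have hd : HasFDerivAt (tailoredFun A ν α χ t s) (fderiv ℝ (tailoredFun A ν α χ t s) x) x :=
    ((contDiffAt_tailoredFun_left ν α hχ t s hx).differentiableAt (by simp)).hasFDerivAt
  have h1 : HasDerivAt (fun r : ℝ => tailoredFun A ν α χ t s fun j => x j * Complex.exp (r * ζ j))
      (torusDeriv (tailoredFun A ν α χ t s) x ζ) 0 := by
    rw [torusDeriv_apply]
    have hd' : HasFDerivAt (tailoredFun A ν α χ t s) (fderiv ℝ (tailoredFun A ν α χ t s) x)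
        ((fun (r : ℝ) (j : Fin k) => x j * Complex.exp (r * ζ j)) 0) := by simpa using hd
    exact hd'.comp_hasDerivAt (0 : ℝ) (hasDerivAt_mul_exp x ζ)
  refine h1.unique ?_
  refine HasDerivAt.fun_sum fun a ha => ?_
  simp only [logMapBase_mul_exp t hx, prod_zpow_mul_exp]
  have h2 : HasDerivAt (fun r : ℝ => logMapBase t x + r • ((Real.log t)⁻¹ • reL k ζ))
      ((Real.log t)⁻¹ • reL k ζ) 0 := by
    simpa using ((hasDerivAt_id (0 : ℝ)).smul_const ((Real.log t)⁻¹ • reL k ζ)).const_add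
      (logMapBase t x)
  have h3 : HasDerivAt (fun r : ℝ => χ a (logMapBase t x + r • ((Real.log t)⁻¹ • reL k ζ)))
      (fderiv ℝ (χ a) (logMapBase t x) ((Real.log t)⁻¹ • reL k ζ)) 0 := by
    refine HasFDerivAt.comp_hasDerivAt (0 : ℝ) ?_ h2
    simpa using ((hχ a ha).differentiable (by simp) _).hasFDerivAt
  have h4 := (((h3.const_mul s).const_add (1 - s)).ofReal_comp.const_mul (α a)).mul_const
    ((t ^ (-ν a) : ℝ) : ℂ)
  have h5 : HasDerivAt (fun r : ℝ => (r : ℂ) * ∑ j, (a j : ℂ) * ζ j) (∑ j, (a j : ℂ) * ζ j) 0 := by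
    simpa using (hasDerivAt_id (0 : ℝ)).ofReal_comp.mul_const (∑ j, (a j : ℂ) * ζ j)
  have h6 := h4.mul (h5.cexp.const_mul (∏ j, x j ^ a j))
  refine h6.congr_deriv ?_
  simp only [scaledMonomial, cutoffCoeff, map_smul, smul_eq_mul]
  push_cast
  simp
  ring

end TorusDerivative

/-! ### Kernels of nearly complex-linear forms -/

section NearlyComplex

variable {k : ℕ}

/-- A real-linear form on `ℂ^k` close to a complex-linear one has a bounded right inverse. -/
theorem exists_bounded_preimage {D : (Fin k → ℂ) →L[ℝ] ℂ} {L : Fin k → ℂ} {B η : ℝ} (hB : 0 < B)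
    (hη : η ≤ 1 / 2) {j₀ : Fin k} (hj₀ : B ≤ ‖L j₀‖)
    (hD : ∀ ζ, ‖D ζ - ∑ j, L j * ζ j‖ ≤ η * B * ‖ζ‖) (y : ℂ) :
    ∃ n, D n = y ∧ ‖n‖ ≤ 2 / B * ‖y‖ := by
  have hL0 : L j₀ ≠ 0 := norm_pos_iff.1 (hB.trans_le hj₀)
  -- A right inverse of the complex-linear form, supported on the coordinate `j₀`. Composed with `D`
  -- it is within 1/2 of the identity, hence injective, hence onto.
  let n : ℂ →ₗ[ℝ] (Fin k → ℂ) :=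
    { toFun := fun z => Pi.single j₀ (z / L j₀)
      map_add' := fun z w => by rw [add_div, Pi.single_add]
      map_smul' := fun r z => by
        rw [RingHom.id_apply, smul_div_assoc, ← Pi.single_smul] }
  have hn : ∀ z, ‖n z‖ ≤ ‖z‖ / B := fun z => by
    change ‖(Pi.single j₀ (z / L j₀) : Fin k → ℂ)‖ ≤ _
    rw [Pi.norm_single, norm_div]
    gcongr
  have hnear : ∀ z, ‖D (n z) - z‖ ≤ 1 / 2 * ‖z‖ := fun z => by
    have h1 := hD (n z)
    have h2 : ∑ j, L j * n z j = z := by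
      change ∑ j, L j * (Pi.single j₀ (z / L j₀) : Fin k → ℂ) j = z
      rw [Finset.sum_eq_single j₀]
      · rw [Pi.single_eq_same]; field_simp
      · intro j _ hj; rw [Pi.single_eq_of_ne hj, mul_zero]
      · simp
    rw [h2] at h1
    have h3 := norm_nonneg (D (n z) - z)
    have h4 := hn z
    rw [le_div_iff₀ hB] at h4
    have h5 : η * B * ‖n z‖ ≤ 1 / 2 * (‖n z‖ * B) := by
      have := mul_nonneg (norm_nonneg (n z)) hB.le
      nlinarith
    linarith
  have hlow : ∀ z, ‖z‖ ≤ 2 * ‖D (n z)‖ := fun z => by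
    have h1 := hnear z
    have h2 : ‖z‖ ≤ ‖D (n z)‖ + ‖D (n z) - z‖ := by
      simpa using norm_sub_le (D (n z)) (D (n z) - z)
    linarith
  have hinj : Function.Injective ((D : (Fin k → ℂ) →ₗ[ℝ] ℂ) ∘ₗ n) := by
    refine (injective_iff_map_eq_zero _).2 fun z hz => ?_
    have h1 := hlow z
    have h2 : D (n z) = 0 := hz
    rw [h2, norm_zero, mul_zero] at h1
    exact norm_le_zero_iff.1 h1
  obtain ⟨z, hz⟩ := LinearMap.surjective_of_injective hinj y
  have hz' : D (n z) = y := hz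
  refine ⟨n z, hz', (hn z).trans ?_⟩
  have := hlow z
  rw [hz'] at this
  rw [div_mul_eq_mul_div]
  gcongr

/-- The complex-linear part is small at ζ, hence also at iζ, so D(iζ) is small; a bounded preimage
of it corrects iζ to lie in the kernel. -/
theorem exists_ker_near_I_smul {D : (Fin k → ℂ) →L[ℝ] ℂ} {L : Fin k → ℂ} {B η : ℝ} (hB : 0 < B)
    (hη : η ≤ 1 / 2) {j₀ : Fin k} (hj₀ : B ≤ ‖L j₀‖)
    (hD : ∀ ζ, ‖D ζ - ∑ j, L j * ζ j‖ ≤ η * B * ‖ζ‖) {ζ : Fin k → ℂ} (hζ : D ζ = 0) :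
    ∃ ξ, D ξ = 0 ∧ ‖ξ - Complex.I • ζ‖ ≤ 4 * η * ‖ζ‖ := by
  have h1 := hD ζ
  rw [hζ, zero_sub, norm_neg] at h1
  have h2 := hD (Complex.I • ζ)
  have h3 : ∑ j, L j * (Complex.I • ζ) j = Complex.I * ∑ j, L j * ζ j := by
    rw [Finset.mul_sum]
    exact Finset.sum_congr rfl fun j _ => by simp; ring
  have h4 : ‖Complex.I • ζ‖ = ‖ζ‖ := by rw [norm_smul, Complex.norm_I, one_mul]
  rw [h3, h4] at h2
  have h5 : ‖D (Complex.I • ζ)‖ ≤ 2 * (η * B * ‖ζ‖) := by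
    have h6 : ‖Complex.I * ∑ j, L j * ζ j‖ ≤ η * B * ‖ζ‖ := by
      rwa [norm_mul, Complex.norm_I, one_mul]
    have h7 := norm_add_le (D (Complex.I • ζ) - Complex.I * ∑ j, L j * ζ j)
      (Complex.I * ∑ j, L j * ζ j)
    rw [sub_add_cancel] at h7
    linarith
  obtain ⟨n, hn, hnn⟩ := exists_bounded_preimage hB hη hj₀ hD (D (Complex.I • ζ))
  refine ⟨Complex.I • ζ - n, by rw [map_sub, hn, sub_self], ?_⟩
  rw [show Complex.I • ζ - n - Complex.I • ζ = -n by abel, norm_neg]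
  calc ‖n‖ ≤ 2 / B * ‖D (Complex.I • ζ)‖ := hnn
    _ ≤ 2 / B * (2 * (η * B * ‖ζ‖)) := by gcongr
    _ = 4 * η * ‖ζ‖ := by field_simp; ring

theorem exists_ker_near {D : (Fin k → ℂ) →L[ℝ] ℂ} {L : Fin k → ℂ} {B η : ℝ} (hB : 0 < B)
    (hη : η ≤ 1 / 2) {j₀ : Fin k} (hj₀ : B ≤ ‖L j₀‖)
    (hD : ∀ ζ, ‖D ζ - ∑ j, L j * ζ j‖ ≤ η * B * ‖ζ‖) {ζ : Fin k → ℂ}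
    (hζ : ‖D ζ‖ ≤ η * B * ‖ζ‖) :
    ∃ ξ, D ξ = 0 ∧ ‖ξ - ζ‖ ≤ 2 * η * ‖ζ‖ := by
  obtain ⟨n, hn, hnn⟩ := exists_bounded_preimage hB hη hj₀ hD (D ζ)
  refine ⟨ζ - n, by rw [map_sub, hn, sub_self], ?_⟩
  rw [show ζ - n - ζ = -n by abel, norm_neg]
  calc ‖n‖ ≤ 2 / B * ‖D ζ‖ := hnn
    _ ≤ 2 / B * (η * B * ‖ζ‖) := by gcongr
    _ = 2 * η * ‖ζ‖ := by field_simp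

end NearlyComplex

/-! ### Dominant terms, and the estimates along the tailored hypersurface -/

section TailoredEstimates

variable {k : ℕ}

theorem abs_dotForm_le {A : Finset (Fin k → ℤ)} {a : Fin k → ℤ} (ha : a ∈ A) (u : Fin k → ℝ) :
    |dotForm a u| ≤ (∑ b ∈ A, ∑ j, |(b j : ℝ)|) * ‖u‖ := by
  have h1 : ∑ j, |(a j : ℝ)| ≤ ∑ b ∈ A, ∑ j, |(b j : ℝ)| :=
    Finset.single_le_sum (f := fun b : Fin k → ℤ => ∑ j, |(b j : ℝ)|)
      (fun _ _ => by positivity) ha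
  rw [dotForm_apply]
  calc |∑ j, (a j : ℝ) * u j| ≤ ∑ j, |(a j : ℝ) * u j| := Finset.abs_sum_le_sum_abs _ _
    _ ≤ ∑ j, |(a j : ℝ)| * ‖u‖ := by
      refine Finset.sum_le_sum fun j _ => ?_
      rw [abs_mul]
      gcongr
      exact norm_le_pi_norm u j
    _ = (∑ j, |(a j : ℝ)|) * ‖u‖ := by rw [Finset.sum_mul]
    _ ≤ _ := by gcongr

theorem abs_coord_le {A : Finset (Fin k → ℤ)} {a : Fin k → ℤ} (ha : a ∈ A) (j : Fin k) :
    |(a j : ℝ)| ≤ ∑ b ∈ A, ∑ i, |(b i : ℝ)| :=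
  (Finset.single_le_sum (f := fun i => |(a i : ℝ)|) (fun _ _ => abs_nonneg _)
    (Finset.mem_univ j)).trans (Finset.single_le_sum
      (f := fun b : Fin k → ℤ => ∑ j, |(b j : ℝ)|) (fun _ _ => by positivity) ha)

theorem norm_sum_mul_le {A : Finset (Fin k → ℤ)} {g h : (Fin k → ℤ) → ℂ} {w : (Fin k → ℤ) → ℝ}
    {C D : ℝ} (hg : ∀ a ∈ A, ‖g a‖ ≤ w a * C) (hh : ∀ a ∈ A, ‖h a‖ ≤ D) :
    ‖∑ a ∈ A, g a * h a‖ ≤ (∑ a ∈ A, w a) * C * D := by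
  calc ‖∑ a ∈ A, g a * h a‖ ≤ ∑ a ∈ A, ‖g a‖ * ‖h a‖ := by
        simpa only [norm_mul] using norm_sum_le A fun a => g a * h a
    _ ≤ ∑ a ∈ A, w a * C * D := Finset.sum_le_sum fun a ha => by
        have := hg a ha
        exact mul_le_mul this (hh a ha) (norm_nonneg _) ((norm_nonneg _).trans this)
    _ = _ := by rw [Finset.sum_mul, Finset.sum_mul]

/-- A collection of terms `g a`, `a ∈ A`, of size at most `E`, of which those outside `τ` are of
size at most `q * E`, and of which the term of `a₀ ∈ τ` has size `E`, up to constants. -/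
structure IsDominatedBy (A τ : Finset (Fin k → ℤ)) (a₀ : Fin k → ℤ) (w : (Fin k → ℤ) → ℝ) (q E : ℝ)
    (g : (Fin k → ℤ) → ℂ) : Prop where
  subset : τ ⊆ A
  mem : a₀ ∈ τ
  pos : 0 < E
  nonneg : 0 ≤ q
  le_one : q ≤ 1
  weight : ∀ a ∈ A, 0 ≤ w a
  le : ∀ a ∈ A, ‖g a‖ ≤ w a * E
  small : ∀ a ∈ A, a ∉ τ → ‖g a‖ ≤ w a * (q * E)
  eq : ‖g a₀‖ = w a₀ * E

namespace IsDominatedBy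

variable {A τ : Finset (Fin k → ℤ)} {a₀ : Fin k → ℤ} {w : (Fin k → ℤ) → ℝ} {q E : ℝ}
  {g : (Fin k → ℤ) → ℂ}

theorem norm_sum_sdiff_le (h : IsDominatedBy A τ a₀ w q E g) {f : (Fin k → ℤ) → ℂ} {D : ℝ}
    (hD : 0 ≤ D) (hf : ∀ a ∈ A, ‖f a‖ ≤ D) :
    ‖∑ a ∈ A \ τ, g a * f a‖ ≤ (∑ a ∈ A, w a) * (q * E) * D := by
  refine (norm_sum_mul_le (fun a ha => h.small a (Finset.mem_sdiff.1 ha).1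
    (Finset.mem_sdiff.1 ha).2) fun a ha => hf a (Finset.mem_sdiff.1 ha).1).trans ?_
  have h1 := h.pos
  have h2 := h.nonneg
  gcongr ?_ * (q * E) * D
  exact Finset.sum_le_sum_of_subset_of_nonneg Finset.sdiff_subset fun a ha _ => h.weight a ha

/-- The sum over `τ` is minus the sum over the complement, which is small. -/
theorem norm_sum_mem_le (h : IsDominatedBy A τ a₀ w q E g) (h0 : ∑ a ∈ A, g a = 0) :
    ‖∑ a ∈ τ, g a‖ ≤ (∑ a ∈ A, w a) * (q * E) := by
  have h1 := h.norm_sum_sdiff_le (f := fun _ => 1) zero_le_one (by simp)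
  simp only [mul_one] at h1
  rw [← Finset.sum_sdiff h.subset] at h0
  rwa [eq_neg_of_add_eq_zero_left h0, norm_neg] at h1

/-- If all moments over `τ` were small, then so would be the dominant term, by `hc`, since the sum
over `τ` is already small. Half of the resulting bound is given up to the terms outside `τ`. -/
theorem exists_le_norm_sum (h : IsDominatedBy A τ a₀ w q E g) (h0 : ∑ a ∈ A, g a = 0) {c b : ℝ}
    (hc : ∀ N : ℝ, ‖∑ a ∈ τ, g a‖ ≤ N → (∀ j, ‖∑ a ∈ τ, g a * (a j : ℂ)‖ ≤ N) → c * ‖g a₀‖ ≤ N)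
    (hb : 0 < b) (hbw : b ≤ c * w a₀) (hq1 : (∑ a ∈ A, w a) * q ≤ b / 4)
    (hq2 : (∑ a ∈ A, w a) * q * (∑ a ∈ A, ∑ j, |(a j : ℝ)|) ≤ b / 4) :
    ∃ j, b / 4 * E ≤ ‖∑ a ∈ A, g a * (a j : ℂ)‖ := by
  have hE := h.pos
  have h1 : ∃ j, b / 2 * E < ‖∑ a ∈ τ, g a * (a j : ℂ)‖ := by
    by_contra! hcon
    have h2 := hc (b / 2 * E) ?_ hcon
    · rw [h.eq] at h2
      nlinarith
    · refine (h.norm_sum_mem_le h0).trans ?_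
      nlinarith
  obtain ⟨j, hj⟩ := h1
  refine ⟨j, ?_⟩
  have h3 := h.norm_sum_sdiff_le (f := fun a => (a j : ℂ))
    (D := ∑ a ∈ A, ∑ j, |(a j : ℝ)|) (by positivity) fun a ha => by
      simpa using abs_coord_le ha j
  have h4 := Finset.sum_sdiff h.subset (f := fun a => g a * (a j : ℂ))
  have h5 := norm_sub_le (∑ a ∈ A, g a * (a j : ℂ)) (∑ a ∈ A \ τ, g a * (a j : ℂ))
  rw [← h4, add_sub_cancel_left, h4] at h5
  nlinarith

/-- On `τ` the part `v` of `u` contributes the common value a₀·v times the sum over `τ`, which is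
small because the total sum vanishes. The part `u - v` is bounded, and the terms outside `τ` carry
the factor `q`. -/
theorem norm_sum_dotForm_le (h : IsDominatedBy A τ a₀ w q E g) (h0 : ∑ a ∈ A, g a = 0)
    {u v : Fin k → ℝ} {C : ℝ} (hC : 0 ≤ C) (huv : ‖u - v‖ ≤ C)
    (hv : ∀ a ∈ τ, dotForm a v = dotForm a₀ v) :
    ‖∑ a ∈ A, g a * (dotForm a u : ℂ)‖ ≤
      (∑ a ∈ A, w a) * (∑ a ∈ A, ∑ j, |(a j : ℝ)|) * E * (2 * q * ‖u‖ + 2 * C) := by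
  set S := ∑ a ∈ A, w a
  set W := ∑ a ∈ A, ∑ j, |(a j : ℝ)|
  have hS : 0 ≤ S := Finset.sum_nonneg h.weight
  have hW : 0 ≤ W := by positivity
  have hE := h.pos
  have hq := h.nonneg
  have ha₀ := h.subset h.mem
  have hvn : ‖v‖ ≤ ‖u‖ + C := by
    have := norm_sub_norm_le v u
    rw [norm_sub_rev] at this
    linarith
  have h1 : ‖∑ a ∈ A \ τ, g a * (dotForm a u : ℂ)‖ ≤ S * (q * E) * (W * ‖u‖) :=
    h.norm_sum_sdiff_le (by positivity) fun a ha => by simpa using abs_dotForm_le ha u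
  have h2 : ‖∑ a ∈ τ, g a * (dotForm a (u - v) : ℂ)‖ ≤ S * E * (W * C) := by
    refine (norm_sum_mul_le (fun a ha => h.le a (h.subset ha))
      (D := W * C) fun a ha => ?_).trans ?_
    · rw [Complex.norm_real]
      exact (abs_dotForm_le (h.subset ha) (u - v)).trans (by gcongr)
    · gcongr
      exact Finset.sum_le_sum_of_subset_of_nonneg h.subset fun a ha _ => h.weight a ha
  have h3 : ‖∑ a ∈ τ, g a * (dotForm a v : ℂ)‖ ≤ S * (q * E) * (W * (‖u‖ + C)) := by
    rw [Finset.sum_congr rfl fun a ha => by rw [hv a ha], ← Finset.sum_mul, norm_mul,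
      Complex.norm_real]
    gcongr
    · exact h.norm_sum_mem_le h0
    · exact (abs_dotForm_le ha₀ v).trans (by gcongr)
  have h4 : ∑ a ∈ A, g a * (dotForm a u : ℂ) = ∑ a ∈ A \ τ, g a * (dotForm a u : ℂ) +
      (∑ a ∈ τ, g a * (dotForm a (u - v) : ℂ) + ∑ a ∈ τ, g a * (dotForm a v : ℂ)) := by
    rw [← Finset.sum_add_distrib, ← Finset.sum_sdiff h.subset]
    congr 1
    refine Finset.sum_congr rfl fun a _ => ?_
    rw [← mul_add, ← Complex.ofReal_add, ← map_add, sub_add_cancel]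
  rw [h4]
  have h5 := norm_add₃_le (a := ∑ a ∈ A \ τ, g a * (dotForm a u : ℂ))
    (b := ∑ a ∈ τ, g a * (dotForm a (u - v) : ℂ)) (c := ∑ a ∈ τ, g a * (dotForm a v : ℂ))
  rw [add_assoc] at h5
  have h6 : S * (q * E) * (W * C) ≤ S * E * (W * C) := by
    have : q * E ≤ E := mul_le_of_le_one_left hE.le h.le_one
    gcongr
  nlinarith

end IsDominatedBy

theorem exists_max_tropicalTerm {A : Finset (Fin k → ℤ)} (hA : A.Nonempty)
    (ν : (Fin k → ℤ) → ℝ) (u : Fin k → ℝ) :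
    ∃ a₀ ∈ A, ∀ b ∈ A, tropicalTerm ν b u ≤ tropicalTerm ν a₀ u :=
  A.exists_max_image (fun a => tropicalTerm ν a u) hA

/-- Here `E` is t to the maximal tropical term; a term outside `nearMax` lies more than δ below it,
which costs a factor t^(-δ). -/
theorem exists_isDominatedBy_nearMax {A : Finset (Fin k → ℤ)} (hA : A.Nonempty)
    (ν : (Fin k → ℤ) → ℝ) (α : (Fin k → ℤ) → ℂ) {δ : ℝ} (hδ : 0 < δ) {t : ℝ} (ht : 1 < t)
    {x : Fin k → ℂ} (hx : ∀ j, x j ≠ 0) :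
    ∃ a₀ E, IsDominatedBy A (nearMax A ν δ (logMapBase t x)) a₀ (fun a => ‖α a‖)
      (Real.exp (-δ * Real.log t)) E (scaledMonomial ν α t x) := by
  obtain ⟨a₀, ha₀, hmax⟩ := exists_max_tropicalTerm hA ν (logMapBase t x)
  have hlog := Real.log_pos ht
  refine ⟨a₀, Real.exp (Real.log t * tropicalTerm ν a₀ (logMapBase t x)),
    fun a ha => (mem_nearMax.1 ha).1,
    mem_nearMax.2 ⟨ha₀, fun b hb => (hmax b hb).trans (by linarith)⟩, Real.exp_pos _,
    (Real.exp_pos _).le, Real.exp_le_one_iff.2 (by nlinarith), fun _ _ => norm_nonneg _,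
    fun a ha => ?_, fun a ha haτ => ?_, norm_scaledMonomial ν α ht hx a₀⟩
  · rw [norm_scaledMonomial ν α ht hx]
    gcongr
    exact hmax a ha
  · rw [norm_scaledMonomial ν α ht hx, ← Real.exp_add]
    have h1 : ∃ b ∈ A, tropicalTerm ν a (logMapBase t x) + δ < tropicalTerm ν b (logMapBase t x) := by
      by_contra! hcon
      exact haτ (mem_nearMax.2 ⟨ha, hcon⟩)
    obtain ⟨b, hb, hlt⟩ := h1
    gcongr
    nlinarith [hmax b hb]

/-- Cutoff coefficients that are 1 on `τ` keep the dominant term and do not enlarge the others. -/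
theorem IsDominatedBy.mul {A τ : Finset (Fin k → ℤ)} {a₀ : Fin k → ℤ} {w : (Fin k → ℤ) → ℝ}
    {q E : ℝ} {g : (Fin k → ℤ) → ℂ} (h : IsDominatedBy A τ a₀ w q E g) {c : (Fin k → ℤ) → ℝ}
    (hc : ∀ a ∈ A, c a ∈ Icc (0 : ℝ) 1) (hcτ : ∀ a ∈ τ, c a = 1) :
    IsDominatedBy A τ a₀ w q E fun a => (c a : ℂ) * g a := by
  have hle : ∀ a ∈ A, ‖(c a : ℂ) * g a‖ ≤ ‖g a‖ := fun a ha => by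
    rw [norm_mul, Complex.norm_real, Real.norm_eq_abs, abs_of_nonneg (hc a ha).1]
    exact mul_le_of_le_one_left (norm_nonneg _) (hc a ha).2
  exact ⟨h.subset, h.mem, h.pos, h.nonneg, h.le_one, h.weight,
    fun a ha => (hle a ha).trans (h.le a ha), fun a ha haτ => (hle a ha).trans (h.small a ha haτ),
    by simp only [hcτ a₀ h.mem, Complex.ofReal_one, one_mul, h.eq]⟩

set_option maxHeartbeats 1000000 in
/-- For large `t`, along the tailored hypersurface, the kernel of the differential is nearly
complex, and far away from the origin it nearly contains the radial direction. -/
theorem tailored_estimates {A : Finset (Fin k → ℤ)} (hA : A.Nonempty) {ν : (Fin k → ℤ) → ℝ}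
    (hν : InducesTriangulation A ν) {G : Matrix (Fin k) (Fin k) ℝ} (hG : G.PosDef) {ε₁ ε₂ : ℝ}
    (hε₁ : 0 < ε₁) {χ : (Fin k → ℤ) → (Fin k → ℝ) → ℝ} (hχ : IsCutoffFamily A ν G ε₁ ε₂ χ)
    {α : (Fin k → ℤ) → ℂ} (hα : ∀ a ∈ A, α a ≠ 0) {κ : ℝ} (hκ : 0 < κ) :
    ∃ T : ℝ, 1 < T ∧ ∃ R : ℝ, 0 < R ∧ ∀ t, T ≤ t → ∀ s ∈ Icc (0 : ℝ) 1,
      ∀ x ∈ tailoredHypersurface A ν α χ t s,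
        (∀ y, ∃ ζ, torusDeriv (tailoredFun A ν α χ t s) x ζ = y) ∧
        (∀ ζ, torusDeriv (tailoredFun A ν α χ t s) x ζ = 0 →
          ∃ ξ, torusDeriv (tailoredFun A ν α χ t s) x ξ = 0 ∧
            ‖ξ - Complex.I • ζ‖ ≤ κ * ‖ζ‖) ∧
        (R * Real.log t ≤ ‖logMap x‖ →
          ∃ ξ, torusDeriv (tailoredFun A ν α χ t s) x ξ = 0 ∧
            ‖ξ - ofRealL k (logMap x)‖ ≤ κ * ‖logMap x‖) ∧
        (0 ∉ tropicalAmoeba A ν → logMap x ≠ 0) := by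
  obtain ⟨δ₁, hδ₁, hδ₁'⟩ := exists_metricDist_chamber_le A ν G hε₁
  obtain ⟨δ₂, hδ₂, c, hc, hbound⟩ := exists_nearMax_bound hν
  obtain ⟨δ₃, hδ₃, hsub⟩ : ∃ δ : ℝ, 0 < δ ∧ (0 ∉ tropicalAmoeba A ν →
      ∀ a ∈ nearMax A ν δ 0, ∀ b ∈ nearMax A ν δ 0, a = b) := by
    by_cases h : 0 ∈ tropicalAmoeba A ν
    · exact ⟨1, one_pos, fun h' => absurd h h'⟩
    · obtain ⟨δ, hδ, h'⟩ := exists_nearMax_subsingleton h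
      exact ⟨δ, hδ, fun _ => h'⟩
  obtain ⟨C, hC, hdir⟩ := exists_dist_direction_le A ν
  obtain ⟨Bχ, hBχ, hfd⟩ := hχ.exists_bound_fderiv hν hG
  -- The bounds on δ ensure in turn: cutoffs equal to 1 on the almost maximal terms, the lower bound
  -- from affine independence, a single almost maximal term at the origin off the amoeba, and the
  -- hypothesis of `exists_dist_direction_le`.
  obtain ⟨δ, hδ, hδ1, hδ2, hδ3, hδ4⟩ : ∃ δ : ℝ, 0 < δ ∧ δ ≤ δ₁ ∧ δ ≤ δ₂ ∧ δ ≤ δ₃ ∧ δ ≤ 1 :=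
    ⟨min (min δ₁ δ₂) (min δ₃ 1), by positivity, (min_le_left _ _).trans (min_le_left _ _),
      (min_le_left _ _).trans (min_le_right _ _), (min_le_right _ _).trans (min_le_left _ _),
      (min_le_right _ _).trans (min_le_right _ _)⟩
  obtain ⟨w₀, hw₀, hw₀α⟩ : ∃ w₀ : ℝ, 0 < w₀ ∧ ∀ a ∈ A, w₀ ≤ ‖α a‖ := by
    obtain ⟨a, ha, hmin⟩ := A.exists_min_image (fun a => ‖α a‖) hA
    exact ⟨‖α a‖, norm_pos_iff.2 (hα a ha), hmin⟩
  set S : ℝ := ∑ a ∈ A, ‖α a‖ with hS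
  set W : ℝ := ∑ a ∈ A, ∑ j, |(a j : ℝ)| with hW
  have hS0 : 0 ≤ S := Finset.sum_nonneg fun _ _ => norm_nonneg _
  have hW0 : 0 ≤ W := by positivity
  set b : ℝ := c * w₀ with hb
  have hb0 : 0 < b := by positivity
  set η : ℝ := min (1 / 2) (κ / 4) with hη
  have hη0 : 0 < η := by positivity
  have hηhalf : η ≤ 1 / 2 := min_le_left _ _
  have hηκ : 4 * η ≤ κ := by linarith [min_le_right (1 / 2) (κ / 4)]
  -- Beyond this radius the bounded error from `u - v` is at most η b / 8 times ‖u‖.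
  set R : ℝ := 1 + 16 * S * W * C / (η * b) with hR
  have hR0 : 0 < R := by positivity
  -- the bounds on `q = t ^ (-δ)` that are used below
  set q₀ : ℝ := min (min (w₀ / (2 * (S + 1))) (b / (4 * (S + 1) * (W + 1))))
    (η * b / (8 * (2 * S * W + S * Bχ + 1))) with hq₀
  have hq₀0 : 0 < q₀ := by positivity
  obtain ⟨T, hT, hT1⟩ : ∃ T : ℝ, (∀ t, T ≤ t → Real.exp (-δ * Real.log t) ≤ q₀ ∧
      1 ≤ Real.log t) ∧ 1 < T := by
    have h1 : Tendsto (fun t => Real.exp (-δ * Real.log t)) atTop (𝓝 0) :=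
      Real.tendsto_exp_atBot.comp
        (Real.tendsto_log_atTop.const_mul_atTop_of_neg (by linarith))
    obtain ⟨T, hT⟩ := eventually_atTop.1 ((h1.eventually_le_const hq₀0).and
      (Real.tendsto_log_atTop.eventually_ge_atTop 1))
    exact ⟨max T 2, fun t ht => hT t ((le_max_left _ _).trans ht), by
      exact lt_of_lt_of_le (by norm_num) (le_max_right T 2)⟩
  refine ⟨T, hT1, R, hR0, fun t ht s hs x hx => ?_⟩
  obtain ⟨hx0, hfx⟩ := hx
  obtain ⟨hqt, hlog1⟩ := hT t ht
  have ht1 : 1 < t := hT1.trans_le ht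
  set u := logMapBase t x with hu
  set q := Real.exp (-δ * Real.log t) with hq
  have hqpos : 0 < q := Real.exp_pos _
  -- The three bounds serve to exclude the origin, to bound the complex-linear part below, and to
  -- make the perturbation and the radial defect small.
  have hq1 : q * (2 * (S + 1)) ≤ w₀ := by
    rw [← le_div_iff₀ (by positivity)]
    exact hqt.trans ((min_le_left _ _).trans (min_le_left _ _))
  have hq2 : q * (4 * (S + 1) * (W + 1)) ≤ b := by
    rw [← le_div_iff₀ (by positivity)]
    exact hqt.trans ((min_le_left _ _).trans (min_le_right _ _))
  have hq3 : q * (8 * (2 * S * W + S * Bχ + 1)) ≤ η * b := by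
    rw [← le_div_iff₀ (by positivity)]
    exact hqt.trans (min_le_right _ _)
  obtain ⟨a₀, E, hdom⟩ := exists_isDominatedBy_nearMax hA ν α hδ ht1 hx0
  set τ := nearMax A ν δ u with hτ
  set m := scaledMonomial ν α t x with hm
  have hE := hdom.pos
  have ha₀ : a₀ ∈ A := hdom.subset hdom.mem
  have hχ1 : ∀ a ∈ τ, χ a u = 1 := fun a ha =>
    hχ.eq_one a (hdom.subset ha) u (hδ₁' u a (nearMax_mono hδ1 u ha))
  have hcτ : ∀ a ∈ τ, cutoffCoeff χ t s x a = 1 := fun a ha => by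
    rw [cutoffCoeff, hχ1 a ha]; ring
  have hc01 : ∀ a ∈ A, cutoffCoeff χ t s x a ∈ Icc (0 : ℝ) 1 := fun a ha => by
    have h1 := hχ.mem_Icc a ha u
    have h2 : cutoffCoeff χ t s x a = (1 - s) + s * χ a u := rfl
    rw [h2]
    constructor <;> nlinarith [h1.1, h1.2, hs.1, hs.2]
  have hdomg := hdom.mul hc01 hcτ
  set g : (Fin k → ℤ) → ℂ := fun a => (cutoffCoeff χ t s x a : ℂ) * m a with hg
  have hg0 : ∑ a ∈ A, g a = 0 := by rw [← hfx, tailoredFun_eq]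
  -- the perturbation of the complex-linear part
  set P : (Fin k → ℂ) → (Fin k → ℤ) → ℂ := fun ζ a =>
    ((s * ((Real.log t)⁻¹ * fderiv ℝ (χ a) u (reL k ζ)) : ℝ) : ℂ) with hP
  -- A cutoff is maximal where it equals 1, so its differential vanishes there: only the small terms
  -- feel the cutoffs.
  have hPτ : ∀ ζ, ∀ a ∈ τ, P ζ a = 0 := fun ζ a ha => by
    simp [hP, hχ.fderiv_eq_zero (hdom.subset ha) (Or.inr (hχ1 a ha))]
  have hPn : ∀ ζ, ∀ a ∈ A, ‖P ζ a‖ ≤ Bχ * ‖reL k ζ‖ * (Real.log t)⁻¹ := fun ζ a ha => by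
    have h1 : ‖fderiv ℝ (χ a) u (reL k ζ)‖ ≤ Bχ * ‖reL k ζ‖ :=
      ((fderiv ℝ (χ a) u).le_opNorm _).trans (by gcongr; exact hfd a ha u)
    have h2 : 0 < (Real.log t)⁻¹ := by positivity
    simp only [hP, Complex.norm_real, norm_mul, Real.norm_eq_abs, abs_of_pos h2,
      abs_of_nonneg hs.1]
    rw [Real.norm_eq_abs] at h1
    calc s * ((Real.log t)⁻¹ * |fderiv ℝ (χ a) u (reL k ζ)|)
        ≤ 1 * ((Real.log t)⁻¹ * (Bχ * ‖reL k ζ‖)) := by gcongr; exact hs.2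
      _ = _ := by ring
  have hPsum : ∀ ζ, ‖∑ a ∈ A, m a * P ζ a‖ ≤
      S * (q * E) * (Bχ * ‖reL k ζ‖ * (Real.log t)⁻¹) := fun ζ => by
    rw [← Finset.sum_sdiff hdom.subset, Finset.sum_eq_zero (s := τ) fun a ha => by
      rw [hPτ ζ a ha, mul_zero], add_zero]
    exact hdom.norm_sum_sdiff_le (by positivity) (hPn ζ)
  have hDζ : ∀ ζ, torusDeriv (tailoredFun A ν α χ t s) x ζ =
      ∑ a ∈ A, g a * (∑ j, (a j : ℂ) * ζ j) + ∑ a ∈ A, m a * P ζ a := fun ζ => by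
    rw [torusDeriv_tailoredFun ν α hχ.smooth t s hx0 ζ, ← Finset.sum_add_distrib]
    refine Finset.sum_congr rfl fun a _ => ?_
    rw [mul_add]
    congr 1
    simp only [hg]
    ring
  set L : Fin k → ℂ := fun j => ∑ a ∈ A, g a * (a j : ℂ) with hL
  have hLζ : ∀ ζ : Fin k → ℂ, ∑ a ∈ A, g a * (∑ j, (a j : ℂ) * ζ j) = ∑ j, L j * ζ j := fun ζ => by
    simp only [hL, Finset.mul_sum, Finset.sum_mul]
    rw [Finset.sum_comm]
    exact Finset.sum_congr rfl fun j _ => Finset.sum_congr rfl fun a _ => by ring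
  have hSq : 0 ≤ S * q := by positivity
  have hSWq : 0 ≤ S * W * q := by positivity
  have hSBq : 0 ≤ S * Bχ * q := by positivity
  have hWq : 0 ≤ W * q := by positivity
  -- The complex-linear part has a coefficient of size at least b E / 4, the scale against which all
  -- errors are measured.
  obtain ⟨j₀, hj₀⟩ := hdomg.exists_le_norm_sum hg0 (c := c) (b := b)
    (fun N h1 h2 => hbound u τ (nearMax_mono hδ2 u) g N h1 h2 a₀ hdom.mem) hb0
    (by rw [hb]; gcongr; exact hw₀α a₀ ha₀) (by nlinarith) (by nlinarith)
  have hB0 : 0 < b / 4 * E := by positivity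
  have hD1 : ∀ ζ, ‖torusDeriv (tailoredFun A ν α χ t s) x ζ - ∑ j, L j * ζ j‖ ≤
      η * (b / 4 * E) * ‖ζ‖ := fun ζ => by
    rw [hDζ, hLζ, add_sub_cancel_left]
    refine (hPsum ζ).trans ?_
    have h1 : (Real.log t)⁻¹ ≤ 1 := inv_le_one_of_one_le₀ hlog1
    calc S * (q * E) * (Bχ * ‖reL k ζ‖ * (Real.log t)⁻¹)
        ≤ S * (q * E) * (Bχ * ‖ζ‖ * 1) := by
          gcongr
          exact norm_reL_le ζ
      _ = S * Bχ * q * (E * ‖ζ‖) := by ring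
      _ ≤ (η * b / 4) * (E * ‖ζ‖) := by
          gcongr
          nlinarith
      _ = _ := by ring
  refine ⟨fun y => ?_, fun ζ hζ => ?_, fun hxR => ?_, fun h0 hx00 => ?_⟩
  · obtain ⟨n, hn, -⟩ := exists_bounded_preimage hB0 hηhalf hj₀ hD1 y
    exact ⟨n, hn⟩
  · obtain ⟨ξ, hξ, hξn⟩ := exists_ker_near_I_smul hB0 hηhalf hj₀ hD1 hζ
    exact ⟨ξ, hξ, hξn.trans (by gcongr)⟩
  · have hlogt : 0 < Real.log t := by linarith
    have hux : logMap x = Real.log t • u := by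
      rw [hu, logMapBase_eq, smul_smul, mul_inv_cancel₀ hlogt.ne', one_smul]
    have hun : ‖logMap x‖ = Real.log t * ‖u‖ := by
      rw [hux, norm_smul, Real.norm_eq_abs, abs_of_pos hlogt]
    have huR : R ≤ ‖u‖ := by
      rw [hun, mul_comm] at hxR
      exact le_of_mul_le_mul_left hxR hlogt
    obtain ⟨v, hv, hvτ⟩ := hdir δ hδ4 u
    have h1 := hdomg.norm_sum_dotForm_le hg0 hC hv fun a ha => hvτ a ha a₀ hdom.mem
    have h2 := hPsum (ofRealL k u)
    have hDu : ‖torusDeriv (tailoredFun A ν α χ t s) x (ofRealL k u)‖ ≤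
        η * (b / 4 * E) * ‖ofRealL k u‖ := by
      rw [hDζ, norm_ofRealL]
      rw [reL_ofRealL] at h2
      have h3 : ∀ a : Fin k → ℤ, ∑ j, (a j : ℂ) * ofRealL k u j = (dotForm a u : ℂ) := fun a => by
        rw [dotForm_apply]; push_cast; rfl
      simp only [h3]
      refine (norm_add_le _ _).trans ((add_le_add h1 h2).trans ?_)
      have h4 : (Real.log t)⁻¹ ≤ 1 := inv_le_one_of_one_le₀ hlog1
      have h5 : S * (q * E) * (Bχ * ‖u‖ * (Real.log t)⁻¹) ≤ S * Bχ * q * (E * ‖u‖) := by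
        calc S * (q * E) * (Bχ * ‖u‖ * (Real.log t)⁻¹) ≤ S * (q * E) * (Bχ * ‖u‖ * 1) := by gcongr
          _ = _ := by ring
      have h6 : 2 * S * W * C ≤ η * b / 8 * ‖u‖ := by
        have h7 : 16 * S * W * C / (η * b) ≤ ‖u‖ := by linarith
        rw [div_le_iff₀ (by positivity)] at h7
        linarith
      have h8 : 2 * S * W * q + S * Bχ * q ≤ η * b / 8 := by nlinarith
      have h9 : (2 * S * W * q + S * Bχ * q) * ‖u‖ ≤ η * b / 8 * ‖u‖ := by gcongr
      calc S * W * E * (2 * q * ‖u‖ + 2 * C) + S * (q * E) * (Bχ * ‖u‖ * (Real.log t)⁻¹)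
          ≤ S * W * E * (2 * q * ‖u‖ + 2 * C) + S * Bχ * q * (E * ‖u‖) := by linarith
        _ = E * ((2 * S * W * q + S * Bχ * q) * ‖u‖ + 2 * S * W * C) := by ring
        _ ≤ E * (η * b / 8 * ‖u‖ + η * b / 8 * ‖u‖) := by gcongr
        _ = _ := by ring
    obtain ⟨ξ, hξ, hξn⟩ := exists_ker_near hB0 hηhalf hj₀ hD1 (ζ := ofRealL k (logMap x)) (by
      rw [hux, map_smul, map_smul, norm_smul, norm_smul, mul_left_comm]
      gcongr)
    rw [norm_ofRealL] at hξn
    exact ⟨ξ, hξ, hξn.trans (by gcongr; linarith)⟩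
  -- At the origin only one term is almost maximal, and the rest are too small to cancel it.
  · have hu0 : u = 0 := by rw [hu, logMapBase_eq, hx00, smul_zero]
    have hτ1 : τ = {a₀} := by
      refine Finset.eq_singleton_iff_unique_mem.2 ⟨hdom.mem, fun a ha => ?_⟩
      have hmono : ∀ d ∈ τ, d ∈ nearMax A ν δ₃ 0 := fun d hd => by
        rw [← hu0]; exact nearMax_mono hδ3 u hd
      exact hsub h0 a (hmono a ha) a₀ (hmono a₀ hdom.mem)
    have h1 := hdomg.norm_sum_mem_le hg0
    rw [hτ1, Finset.sum_singleton, hdomg.eq] at h1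
    have h2 := hw₀α a₀ ha₀
    have h3 : w₀ * E ≤ S * (q * E) := (mul_le_mul_of_nonneg_right h2 hE.le).trans h1
    have h4 : w₀ ≤ S * q := by
      rw [← mul_assoc] at h3
      exact le_of_mul_le_mul_right h3 hE
    nlinarith

end TailoredEstimates

/-! ### Symplectic linear algebra on a nearly complex subspace -/

section LinearSymplectic

variable {k : ℕ}

/-- The Kähler form at a point of the torus, in logarithmic coordinates, of a potential with
Hessian `H`. -/
def sympForm (H : (Fin k → ℝ) →L[ℝ] (Fin k → ℝ) →L[ℝ] ℝ) :
    (Fin k → ℂ) →L[ℝ] (Fin k → ℂ) →L[ℝ] ℝ :=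
  H.bilinearComp (reL k) (imL k) - H.bilinearComp (imL k) (reL k)

theorem sympForm_apply (H : (Fin k → ℝ) →L[ℝ] (Fin k → ℝ) →L[ℝ] ℝ) (ζ ξ : Fin k → ℂ) :
    sympForm H ζ ξ = H (reL k ζ) (imL k ξ) - H (imL k ζ) (reL k ξ) := rfl

/-- Uniform bounds for a scalar product on `ℝ^k`. -/
structure IsMetricBetween (H : (Fin k → ℝ) →L[ℝ] (Fin k → ℝ) →L[ℝ] ℝ) (l Λ : ℝ) : Prop where
  symm : ∀ v w, H v w = H w v
  lower : ∀ v, l * ‖v‖ ^ 2 ≤ H v v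
  upper : ∀ v w, |H v w| ≤ Λ * ‖v‖ * ‖w‖

/-- The kernel of `D` is nearly stable under multiplication by `i`. -/
def IsNearlyComplex (D : (Fin k → ℂ) →L[ℝ] ℂ) (κ : ℝ) : Prop :=
  ∀ ζ, D ζ = 0 → ∃ ξ, D ξ = 0 ∧ ‖ξ - Complex.I • ζ‖ ≤ κ * ‖ζ‖

namespace IsMetricBetween

variable {H : (Fin k → ℝ) →L[ℝ] (Fin k → ℝ) →L[ℝ] ℝ} {l Λ κ : ℝ} {D : (Fin k → ℂ) →L[ℝ] ℂ}

theorem abs_sympForm_le (hH : IsMetricBetween H l Λ) (hΛ : 0 ≤ Λ) (ζ ξ : Fin k → ℂ) :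
    |sympForm H ζ ξ| ≤ 2 * Λ * ‖ζ‖ * ‖ξ‖ := by
  have h1 := hH.upper (reL k ζ) (imL k ξ)
  have h2 := hH.upper (imL k ζ) (reL k ξ)
  have h3 : Λ * ‖reL k ζ‖ * ‖imL k ξ‖ ≤ Λ * ‖ζ‖ * ‖ξ‖ := by
    gcongr
    exacts [norm_reL_le ζ, norm_imL_le ξ]
  have h4 : Λ * ‖imL k ζ‖ * ‖reL k ξ‖ ≤ Λ * ‖ζ‖ * ‖ξ‖ := by
    gcongr
    exacts [norm_imL_le ζ, norm_reL_le ξ]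
  rw [sympForm_apply]
  have h5 := abs_sub (H (reL k ζ) (imL k ξ)) (H (imL k ζ) (reL k ξ))
  linarith

theorem le_sympForm_I_smul (hH : IsMetricBetween H l Λ) (hl : 0 ≤ l) (ζ : Fin k → ℂ) :
    l * ‖ζ‖ ^ 2 ≤ sympForm H ζ (Complex.I • ζ) := by
  have h1 : reL k (Complex.I • ζ) = -imL k ζ := by ext j; simp
  have h2 : imL k (Complex.I • ζ) = reL k ζ := by ext j; simp
  rw [sympForm_apply, h1, h2, map_neg, sub_neg_eq_add]
  have h3 := hH.lower (reL k ζ)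
  have h4 := hH.lower (imL k ζ)
  have h5 : ‖ζ‖ ^ 2 ≤ ‖reL k ζ‖ ^ 2 + ‖imL k ζ‖ ^ 2 := by
    rw [← Real.le_sqrt (norm_nonneg _) (by positivity)]
    refine (pi_norm_le_iff_of_nonneg (Real.sqrt_nonneg _)).2 fun j => ?_
    refine Real.le_sqrt_of_sq_le ?_
    have h6 := norm_le_pi_norm (reL k ζ) j
    have h7 := norm_le_pi_norm (imL k ζ) j
    rw [reL_apply, Real.norm_eq_abs] at h6
    rw [imL_apply, Real.norm_eq_abs] at h7
    rw [← Complex.normSq_eq_norm_sq, Complex.normSq_apply, ← sq, ← sq, ← sq_abs (ζ j).re,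
      ← sq_abs (ζ j).im]
    gcongr
  nlinarith

/-- The form is positive on the pair (ζ, iζ). Replacing iζ by a nearby kernel vector costs at most
2Λκ‖ζ‖², half of the lower bound. -/
theorem exists_coercive (hH : IsMetricBetween H l Λ) (hl : 0 ≤ l) (hΛ : 0 ≤ Λ) (hκ : κ ≤ 1)
    (hκl : 4 * Λ * κ ≤ l) (hD : IsNearlyComplex D κ) {ζ : Fin k → ℂ} (hζ : D ζ = 0) :
    ∃ ξ, D ξ = 0 ∧ ‖ξ‖ ≤ 2 * ‖ζ‖ ∧ l / 2 * ‖ζ‖ ^ 2 ≤ sympForm H ζ ξ := by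
  obtain ⟨ξ, hξ, hξn⟩ := hD ζ hζ
  have hn := norm_nonneg ζ
  refine ⟨ξ, hξ, ?_, ?_⟩
  · have h1 := norm_add_le (ξ - Complex.I • ζ) (Complex.I • ζ)
    rw [sub_add_cancel, norm_smul, Complex.norm_I, one_mul] at h1
    nlinarith
  · have h1 := hH.le_sympForm_I_smul hl ζ
    have h2 := (abs_le.1 (hH.abs_sympForm_le hΛ ζ (ξ - Complex.I • ζ))).1
    have h3 : 2 * Λ * ‖ζ‖ * ‖ξ - Complex.I • ζ‖ ≤ 2 * Λ * ‖ζ‖ * (κ * ‖ζ‖) := by gcongr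
    have h4 : sympForm H ζ ξ =
        sympForm H ζ (Complex.I • ζ) + sympForm H ζ (ξ - Complex.I • ζ) := by
      rw [← map_add, add_sub_cancel]
    nlinarith [sq_nonneg ‖ζ‖]

/-- Such a `z` is the symplectic projection of `p` to the kernel; coercivity bounds it after testing
against the vector ξ that pairs with `z`. -/
theorem norm_le_of_sympForm_eq (hH : IsMetricBetween H l Λ) (hl : 0 < l) (hΛ : 0 ≤ Λ) (hκ : κ ≤ 1)
    (hκl : 4 * Λ * κ ≤ l) (hD : IsNearlyComplex D κ) {z p : Fin k → ℂ} (hz : D z = 0)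
    (h : ∀ w, D w = 0 → sympForm H z w = sympForm H p w) : ‖z‖ ≤ 8 * Λ / l * ‖p‖ := by
  obtain ⟨ξ, hξ, hξn, hco⟩ := hH.exists_coercive hl.le hΛ hκ hκl hD hz
  have h1 := (abs_le.1 (hH.abs_sympForm_le hΛ p ξ)).2
  rw [h ξ hξ] at hco
  have h2 : 2 * Λ * ‖p‖ * ‖ξ‖ ≤ 2 * Λ * ‖p‖ * (2 * ‖z‖) := by gcongr
  rcases (norm_nonneg z).eq_or_lt with h0 | h0
  · rw [← h0]; positivity
  · have h3 : (l / 2 * ‖z‖) * ‖z‖ ≤ (4 * Λ * ‖p‖) * ‖z‖ := by nlinarith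
    have h4 := le_of_mul_le_mul_right h3 h0
    rw [div_mul_eq_mul_div, le_div_iff₀ hl]
    linarith

theorem eq_zero_of_sympForm_eq_zero (hH : IsMetricBetween H l Λ) (hl : 0 < l) (hΛ : 0 ≤ Λ)
    (hκ : κ ≤ 1) (hκl : 4 * Λ * κ ≤ l) (hD : IsNearlyComplex D κ) {z : Fin k → ℂ} (hz : D z = 0)
    (h : ∀ w, D w = 0 → sympForm H z w = 0) : z = 0 := by
  have := hH.norm_le_of_sympForm_eq hl hΛ hκ hκl hD (p := 0) hz fun w hw => by simp [h w hw]
  rw [norm_zero, mul_zero] at this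
  exact norm_le_zero_iff.1 this

/-- If `p'` lies in the kernel, then `z - p'` is the projection of `p - p'`, so a vector close to
the kernel is close to its own projection. -/
theorem norm_sub_le_of_sympForm_eq (hH : IsMetricBetween H l Λ) (hl : 0 < l) (hΛ : 0 ≤ Λ)
    (hκ : κ ≤ 1) (hκl : 4 * Λ * κ ≤ l) (hD : IsNearlyComplex D κ) {z p p' : Fin k → ℂ}
    (hz : D z = 0) (h : ∀ w, D w = 0 → sympForm H z w = sympForm H p w) (hp' : D p' = 0)
    (hpp : ‖p' - p‖ ≤ κ * ‖p‖) : ‖z - p‖ ≤ (8 * Λ / l + 1) * (κ * ‖p‖) := by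
  have h1 := hH.norm_le_of_sympForm_eq hl hΛ hκ hκl hD (z := z - p') (p := p - p')
    (by rw [map_sub, hz, hp', sub_zero]) fun w hw => by
      rw [map_sub, map_sub, sub_apply, sub_apply, h w hw]
  have h2 := norm_add_le (z - p') (p' - p)
  rw [sub_add_sub_cancel] at h2
  rw [norm_sub_rev p p'] at h1
  have h3 : 8 * Λ / l * ‖p' - p‖ ≤ 8 * Λ / l * (κ * ‖p‖) := by gcongr
  linarith

end IsMetricBetween

/-- The linear system for the Liouville vector at a point, with a Lagrange multiplier for the
condition to be in the kernel of `D`. -/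
def liouvilleOp (H : (Fin k → ℝ) →L[ℝ] (Fin k → ℝ) →L[ℝ] ℝ) (D : (Fin k → ℂ) →L[ℝ] ℂ) :
    ((Fin k → ℂ) × ℂ) →L[ℝ] (((Fin k → ℂ) →L[ℝ] ℝ) × ℂ) :=
  ((sympForm H).comp (ContinuousLinearMap.fst ℝ _ _) +
    ((Complex.reCLM.comp (ContinuousLinearMap.snd ℝ _ _)).smulRight (Complex.reCLM.comp D) +
      (Complex.imCLM.comp (ContinuousLinearMap.snd ℝ _ _)).smulRight (Complex.imCLM.comp D))).prod
    (D.comp (ContinuousLinearMap.fst ℝ _ _))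

theorem liouvilleOp_fst (H : (Fin k → ℝ) →L[ℝ] (Fin k → ℝ) →L[ℝ] ℝ) (D : (Fin k → ℂ) →L[ℝ] ℂ)
    (z w : Fin k → ℂ) (μ : ℂ) : (liouvilleOp H D (z, μ)).1 w =
      sympForm H z w + (μ.re * (D w).re + μ.im * (D w).im) := rfl

theorem liouvilleOp_snd (H : (Fin k → ℝ) →L[ℝ] (Fin k → ℝ) →L[ℝ] ℝ) (D : (Fin k → ℂ) →L[ℝ] ℂ)
    (z : Fin k → ℂ) (μ : ℂ) : (liouvilleOp H D (z, μ)).2 = D z := rfl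

theorem finrank_liouvilleOp : Module.finrank ℝ ((Fin k → ℂ) × ℂ) =
    Module.finrank ℝ (((Fin k → ℂ) →L[ℝ] ℝ) × ℂ) := by
  have h1 : Module.finrank ℝ ((Fin k → ℂ) →L[ℝ] ℝ) = Module.finrank ℝ (Fin k → ℂ) := by
    rw [← (LinearMap.toContinuousLinearMap (𝕜 := ℝ) (E := Fin k → ℂ) (F' := ℝ)).finrank_eq]
    exact Subspace.dual_finrank_eq
  rw [Module.finrank_prod, Module.finrank_prod, h1]

/-- For a null vector (z, μ), testing against kernel vectors gives z = 0, and then testing against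
`w` with D w = μ gives |μ|² = 0. The dimensions agree. -/
theorem isInvertible_liouvilleOp {H : (Fin k → ℝ) →L[ℝ] (Fin k → ℝ) →L[ℝ] ℝ}
    {D : (Fin k → ℂ) →L[ℝ] ℂ} (hD : ∀ y, ∃ ζ, D ζ = y)
    (h : ∀ z, D z = 0 → (∀ w, D w = 0 → sympForm H z w = 0) → z = 0) :
    (liouvilleOp H D).IsInvertible := by
  have hinj : Function.Injective (liouvilleOp H D).toLinearMap := by
    refine (injective_iff_map_eq_zero _).2 fun p hp => ?_
    obtain ⟨z, μ⟩ := p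
    have hp' : liouvilleOp H D (z, μ) = 0 := hp
    have h2 : D z = 0 := by rw [← liouvilleOp_snd H D z μ, hp']; rfl
    have h1 : ∀ w, sympForm H z w + (μ.re * (D w).re + μ.im * (D w).im) = 0 := fun w => by
      rw [← liouvilleOp_fst, hp']; rfl
    have hz : z = 0 := h z h2 fun w hw => by simpa [hw] using h1 w
    obtain ⟨w, hw⟩ := hD μ
    have h3 := h1 w
    rw [hz, map_zero, zero_apply, zero_add, hw] at h3
    have h4 : μ.re = 0 := by nlinarith [mul_self_nonneg μ.re, mul_self_nonneg μ.im]
    have h5 : μ.im = 0 := by nlinarith [mul_self_nonneg μ.re, mul_self_nonneg μ.im]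
    rw [hz, show μ = 0 from Complex.ext h4 h5]
    rfl
  exact ⟨(LinearMap.linearEquivOfInjective _ hinj finrank_liouvilleOp).toContinuousLinearEquiv, by
    ext p <;> rfl⟩

/-- The Liouville vector at a point, in logarithmic coordinates. -/
def liouvilleVector (H : (Fin k → ℝ) →L[ℝ] (Fin k → ℝ) →L[ℝ] ℝ) (D : (Fin k → ℂ) →L[ℝ] ℂ)
    (ρ : Fin k → ℝ) : Fin k → ℂ :=
  ((liouvilleOp H D).inverse (sympForm H (ofRealL k ρ), 0)).1

theorem liouvilleVector_spec {H : (Fin k → ℝ) →L[ℝ] (Fin k → ℝ) →L[ℝ] ℝ}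
    {D : (Fin k → ℂ) →L[ℝ] ℂ} (h : (liouvilleOp H D).IsInvertible) (ρ : Fin k → ℝ) :
    D (liouvilleVector H D ρ) = 0 ∧ ∀ w, D w = 0 →
      sympForm H (liouvilleVector H D ρ) w = sympForm H (ofRealL k ρ) w := by
  obtain ⟨e, he⟩ := h
  have h1 : liouvilleOp H D ((liouvilleOp H D).inverse (sympForm H (ofRealL k ρ), 0)) =
      (sympForm H (ofRealL k ρ), 0) := by
    rw [← he, ContinuousLinearMap.inverse_equiv]
    exact e.apply_symm_apply _
  set p := (liouvilleOp H D).inverse (sympForm H (ofRealL k ρ), 0) with hp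
  have hz : liouvilleVector H D ρ = p.1 := rfl
  refine ⟨congrArg Prod.snd h1, fun w hw => ?_⟩
  have h2 := congrArg (fun T : (Fin k → ℂ) →L[ℝ] ℝ => T w) (congrArg Prod.fst h1)
  have h3 := liouvilleOp_fst H D p.1 w p.2
  rw [hw] at h3
  simp only [Complex.zero_re, Complex.zero_im, mul_zero, add_zero] at h3
  rw [hz, ← h3]
  exact h2

theorem contDiffAt_sympForm {F : Type*} [NormedAddCommGroup F] [NormedSpace ℝ F]
    {n : WithTop ℕ∞} {H : F → (Fin k → ℝ) →L[ℝ] (Fin k → ℝ) →L[ℝ] ℝ} {y : F}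
    (hH : ContDiffAt ℝ n H y) : ContDiffAt ℝ n (fun y => sympForm (H y)) y := by
  have h1 : ContDiff ℝ n (sympForm (k := k)) :=
    contDiff_clm_apply_iff.2 fun z => contDiff_clm_apply_iff.2 fun w => by
      simp only [sympForm_apply]
      exact ((contDiff_id.clm_apply contDiff_const).clm_apply contDiff_const).sub
        ((contDiff_id.clm_apply contDiff_const).clm_apply contDiff_const)
  exact h1.contDiffAt.comp y hH

theorem contDiffAt_liouvilleOp {F : Type*} [NormedAddCommGroup F] [NormedSpace ℝ F]
    {n : WithTop ℕ∞} {H : F → (Fin k → ℝ) →L[ℝ] (Fin k → ℝ) →L[ℝ] ℝ} {D : F → (Fin k → ℂ) →L[ℝ] ℂ}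
    {y : F} (hH : ContDiffAt ℝ n H y) (hD : ContDiffAt ℝ n D y) :
    ContDiffAt ℝ n (fun y => liouvilleOp (H y) (D y)) y := by
  have h1 := ((contDiffAt_sympForm hH).clm_comp
    (contDiffAt_const (c := ContinuousLinearMap.fst ℝ (Fin k → ℂ) ℂ))).add
      ((ContDiffAt.smulRight
        (contDiffAt_const (c := Complex.reCLM.comp (ContinuousLinearMap.snd ℝ (Fin k → ℂ) ℂ)))
          ((contDiffAt_const (c := Complex.reCLM)).clm_comp hD)).add
      (ContDiffAt.smulRight
        (contDiffAt_const (c := Complex.imCLM.comp (ContinuousLinearMap.snd ℝ (Fin k → ℂ) ℂ)))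
          ((contDiffAt_const (c := Complex.imCLM)).clm_comp hD)))
  have h2 := hD.clm_comp (contDiffAt_const (c := ContinuousLinearMap.fst ℝ (Fin k → ℂ) ℂ))
  have h3 := ((contDiffAt_const (c := ContinuousLinearMap.inl ℝ ((Fin k → ℂ) →L[ℝ] ℝ) ℂ)).clm_comp
    h1).add ((contDiffAt_const (c := ContinuousLinearMap.inr ℝ ((Fin k → ℂ) →L[ℝ] ℝ) ℂ)).clm_comp h2)
  refine h3.congr_of_eventuallyEq (Filter.Eventually.of_forall fun y => ?_)
  refine ContinuousLinearMap.ext fun p => Prod.ext ?_ ?_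
  · exact (add_zero _).symm
  · exact (zero_add _).symm

theorem contDiffAt_liouvilleVector {F : Type*} [NormedAddCommGroup F] [NormedSpace ℝ F]
    {n : WithTop ℕ∞} {H : F → (Fin k → ℝ) →L[ℝ] (Fin k → ℝ) →L[ℝ] ℝ} {D : F → (Fin k → ℂ) →L[ℝ] ℂ}
    {ρ : F → Fin k → ℝ} {y : F} (hH : ContDiffAt ℝ n H y) (hD : ContDiffAt ℝ n D y)
    (hρ : ContDiffAt ℝ n ρ y) (h : (liouvilleOp (H y) (D y)).IsInvertible) :
    ContDiffAt ℝ n (fun y => liouvilleVector (H y) (D y) (ρ y)) y := by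
  have h1 : ContDiffAt ℝ n (fun y => (liouvilleOp (H y) (D y)).inverse) y :=
    ContDiffAt.comp (g := ContinuousLinearMap.inverse) y h.contDiffAt_map_inverse (contDiffAt_liouvilleOp hH hD)
  have h2 : ContDiffAt ℝ n (fun y => sympForm (H y) (ofRealL k (ρ y))) y := by
    have h3 : ContDiffAt ℝ n (fun y => (liouvilleOp (H y) 0) (ofRealL k (ρ y), 0)) y :=
      (contDiffAt_liouvilleOp hH contDiffAt_const).clm_apply
        (((ofRealL k).contDiff.contDiffAt.comp y hρ).prodMk contDiffAt_const)
    refine h3.fst.congr_of_eventuallyEq (Filter.Eventually.of_forall fun y => ?_)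
    ext w
    simp [liouvilleOp_fst]
  exact (h1.clm_apply (h2.prodMk contDiffAt_const)).fst

end LinearSymplectic

/-! ### Complete flows of vector fields of linear growth -/

section GlobalCurves

variable {E : Type*} [NormedAddCommGroup E] [NormedSpace ℝ E]

theorem exists_integralCurve_of_lipschitz [CompleteSpace E] {v : E → E} {K : NNReal}
    (hv : LipschitzWith K v) {B : ℝ} (hB : ∀ x, ‖v x‖ ≤ B) (x₀ : E) {T : ℝ} (hT : 0 < T) :
    ∃ γ : ℝ → E, γ 0 = x₀ ∧ ∀ r ∈ Ioo (-T) T, HasDerivAt γ (v (γ r)) r := by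
  have hB0 : 0 ≤ B := (norm_nonneg _).trans (hB x₀)
  -- A field of norm at most `B` cannot leave the ball of radius `B * T` in time `T`.
  have hpl : IsPicardLindelof (fun _ : ℝ => v) (tmin := -T) (tmax := T)
      ⟨0, by constructor <;> linarith⟩ x₀ (B.toNNReal * T.toNNReal) 0 B.toNNReal K := by
    refine IsPicardLindelof.of_time_independent (fun x _ => ?_) hv.lipschitzOnWith ?_
    · rw [Real.coe_toNNReal _ hB0]; exact hB x
    · simp [hT.le, hB0]
  obtain ⟨γ, hγ0, hγ⟩ := hpl.exists_eq_forall_mem_Icc_hasDerivWithinAt₀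
  exact ⟨γ, hγ0, fun r hr => (hγ r (Ioo_subset_Icc_self hr)).hasDerivAt (Icc_mem_nhds hr.1 hr.2)⟩

/-- A cut-off field is globally Lipschitz and bounded, so it has integral curves for any prescribed
time; on `K` they are integral curves of `Y`. -/
theorem exists_cutoff_vectorField [FiniteDimensional ℝ E] {K W : Set E} (hK : IsCompact K)
    (hW : IsOpen W) (hKW : K ⊆ W) {Y : E → E} (hY : ContDiffOn ℝ 1 Y W) :
    ∃ φ : E → ℝ, (∀ x, φ x ∈ Icc (0 : ℝ) 1) ∧ (∀ x ∈ K, φ x = 1) ∧ (∀ x, x ∉ W → φ x = 0) ∧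
      (∃ C, LipschitzWith C fun x => φ x • Y x) ∧ ∃ B : ℝ, ∀ x, ‖φ x • Y x‖ ≤ B := by
  obtain ⟨t, ht, hKt, htW⟩ := exists_compact_between hK hW hKW
  obtain ⟨f, hf1, hf0, hf⟩ := exists_contMDiffMap_one_nhds_of_subset_interior
    (modelWithCornersSelf ℝ E) (n := 1) hK.isClosed hKt
  have hfs : ContDiff ℝ 1 f := f.contMDiff.contDiff
  have hsupp : HasCompactSupport fun x => f x • Y x :=
    HasCompactSupport.intro ht fun x hx => by rw [hf0 x hx, zero_smul]
  have hs : ContDiff ℝ 1 fun x => f x • Y x := contDiff_iff_contDiffAt.2 fun x => by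
    by_cases hx : x ∈ W
    · exact hfs.contDiffAt.smul (hY.contDiffAt (hW.mem_nhds hx))
    · refine (contDiffAt_const (c := (0 : E))).congr_of_eventuallyEq ?_
      filter_upwards [ht.isClosed.isOpen_compl.mem_nhds fun h => hx (htW h)] with y hy
      rw [hf0 y hy, zero_smul]
  refine ⟨f, hf, fun x hx => hf1.self_of_nhdsSet x hx, fun x hx => hf0 x fun h => hx (htW h),
    hs.lipschitzWith_of_hasCompactSupport hsupp one_ne_zero, ?_⟩
  exact hsupp.exists_bound_of_continuous hs.continuous

/-- Grönwall's inequality, applied forwards and to the time-reversed curve. -/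
theorem norm_le_of_hasDerivAt_of_norm_le {γ γ' : ℝ → E} {C T : ℝ}
    (hγ : ∀ r ∈ Ioo (-T) T, HasDerivAt γ (γ' r) r) (hle : ∀ r ∈ Ioo (-T) T, ‖γ' r‖ ≤ C * ‖γ r‖)
    {r : ℝ} (hr : r ∈ Ioo (-T) T) : ‖γ r‖ ≤ ‖γ 0‖ * Real.exp (C * |r|) := by
  have key : ∀ (c c' : ℝ → E), (∀ r ∈ Ioo (-T) T, HasDerivAt c (c' r) r) →
      (∀ r ∈ Ioo (-T) T, ‖c' r‖ ≤ C * ‖c r‖) → ∀ r ∈ Ioo (-T) T, 0 ≤ r →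
        ‖c r‖ ≤ ‖c 0‖ * Real.exp (C * r) := by
    intro c c' hc hc' r hr hr0
    have hmem : ∀ x ∈ Icc 0 r, x ∈ Ioo (-T) T := fun x hx =>
      ⟨by linarith [hx.1, hr.2], hx.2.trans_lt hr.2⟩
    have := norm_le_gronwallBound_of_norm_deriv_right_le (f := c) (f' := c') (δ := ‖c 0‖) (K := C)
      (ε := 0) (a := 0) (b := r) (fun x hx => (hc x (hmem x hx)).continuousAt.continuousWithinAt)
      (fun x hx => (hc x (hmem x (Ico_subset_Icc_self hx))).hasDerivWithinAt) le_rfl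
      (fun x hx => by simpa using hc' x (hmem x (Ico_subset_Icc_self hx))) r ⟨hr0, le_rfl⟩
    simpa [gronwallBound_ε0] using this
  rcases le_total 0 r with h | h
  · rw [abs_of_nonneg h]; exact key γ γ' hγ hle r hr h
  · have hneg : ∀ x ∈ Ioo (-T) T, -x ∈ Ioo (-T) T := fun x hx =>
      ⟨by linarith [hx.2], by linarith [hx.1]⟩
    have := key (fun r => γ (-r)) (fun r => -γ' (-r)) (fun x hx => by
        simpa [Function.comp_def] using (hγ (-x) (hneg x hx)).scomp x (hasDerivAt_neg x))
      (fun x hx => by simpa using hle (-x) (hneg x hx)) (-r) (hneg r hr) (by linarith)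
    rw [abs_of_nonpos h]
    simpa using this

/-- A curve that starts on a level set of `F` and along which `F` is constant as long as it stays in
a neighbourhood `W` of the level set, stays on the level set. -/
theorem mem_of_hasDerivAt_of_fderiv_eq_zero {G : Type*} [NormedAddCommGroup G] [NormedSpace ℝ G]
    {N W : Set E} (hN : IsClosed N) (hW : IsOpen W) (hNW : N ⊆ W) {F : E → G}
    (hF : ∀ x ∈ W, DifferentiableAt ℝ F x) (hNF : ∀ x ∈ W, x ∈ N ↔ F x = 0) {γ γ' : ℝ → E} {T : ℝ}
    (hγ : ∀ r ∈ Ioo (-T) T, HasDerivAt γ (γ' r) r)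
    (hγF : ∀ r ∈ Ioo (-T) T, γ r ∈ W → fderiv ℝ F (γ r) (γ' r) = 0) (hγ0 : γ 0 ∈ N)
    {r : ℝ} (hr : r ∈ Ioo (-T) T) : γ r ∈ N := by
  have hT : (0 : ℝ) ∈ Ioo (-T) T := ⟨by linarith [hr.1, hr.2], by linarith [hr.1, hr.2]⟩
  have hcont : Continuous fun x : Ioo (-T) T => γ x :=
    continuousOn_iff_continuous_domRestrict.1 fun x hx => (hγ x hx).continuousAt.continuousWithinAt
  have : PreconnectedSpace (Ioo (-T) T) := Subtype.preconnectedSpace isPreconnected_Ioo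
  -- The times spent in `N` form a closed set, and an open one because `F` is constant along the
  -- curve near such a time; the interval is connected.
  have hclopen : IsClopen {x : Ioo (-T) T | γ x ∈ N} := by
    refine ⟨hN.preimage hcont, isOpen_iff_mem_nhds.2 fun x hx => ?_⟩
    have h1 : ∀ᶠ y in 𝓝 (x : ℝ), y ∈ Ioo (-T) T ∧ γ y ∈ W :=
      (eventually_mem_set.2 (isOpen_Ioo.mem_nhds x.2)).and (eventually_mem_set.2 <| (hγ x x.2).continuousAt.preimage_mem_nhds
        (hW.mem_nhds (hNW hx)))
    obtain ⟨ε, hε, hball⟩ := Metric.eventually_nhds_iff_ball.1 h1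
    have hderiv : ∀ y ∈ Metric.ball (x : ℝ) ε, HasDerivAt (fun r => F (γ r)) 0 y := fun y hy => by
      obtain ⟨hy1, hy2⟩ := hball y hy
      have := (hF _ hy2).hasFDerivAt.comp_hasDerivAt y (hγ y hy1)
      rwa [hγF y hy1 hy2] at this
    have hconst : ∀ y ∈ Metric.ball (x : ℝ) ε, F (γ y) = F (γ x) := fun y hy =>
      Metric.isOpen_ball.is_const_of_deriv_eq_zero
        (convex_ball _ _).isPreconnected
        (fun z hz => (hderiv z hz).differentiableAt.differentiableWithinAt)
        (fun z hz => (hderiv z hz).deriv) hy (Metric.mem_ball_self hε)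
    have h2 : ∀ᶠ y : Ioo (-T) T in 𝓝 x, (y : ℝ) ∈ Metric.ball (x : ℝ) ε :=
      continuous_subtype_val.continuousAt.preimage_mem_nhds (Metric.ball_mem_nhds _ hε)
    filter_upwards [h2] with y hy
    refine (hNF _ (hball y hy).2).2 ?_
    rw [hconst y hy]
    exact (hNF _ (hNW hx)).1 hx
  have huniv := hclopen.eq_univ ⟨⟨0, hT⟩, hγ0⟩
  exact (huniv ▸ mem_univ (⟨r, hr⟩ : Ioo (-T) T) : _ ∈ {x : Ioo (-T) T | γ x ∈ N})

variable {G : Type*} [NormedAddCommGroup G] [NormedSpace ℝ G] [FiniteDimensional ℝ E]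
  {N W : Set E} {F : E → G} {Y : E → E} {C : ℝ}

/-- The field is cut off outside the ball that Grönwall's bound allows within time `T`. The cut-off
field obeys the same growth bound on `N`, so its curve stays where the cutoff is 1. -/
theorem exists_integralCurve_Ioo (hN : IsClosed N) (hW : IsOpen W) (hNW : N ⊆ W)
    (hF : ∀ x ∈ W, DifferentiableAt ℝ F x) (hNF : ∀ x ∈ W, x ∈ N ↔ F x = 0)
    (hY : ContDiffOn ℝ 1 Y W) (hFY : ∀ x ∈ W, fderiv ℝ F x (Y x) = 0) (hC : 0 ≤ C)
    (hYC : ∀ x ∈ N, ‖Y x‖ ≤ C * ‖x‖) {x₀ : E} (hx₀ : x₀ ∈ N) {T : ℝ} (hT : 0 < T) :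
    ∃ γ : ℝ → E, γ 0 = x₀ ∧ ∀ r ∈ Ioo (-T) T, γ r ∈ N ∧ HasDerivAt γ (Y (γ r)) r ∧
      ‖γ r‖ ≤ ‖x₀‖ * Real.exp (C * T) := by
  obtain ⟨φ, hφ, hφ1, hφ0, ⟨K, hK⟩, B, hB⟩ := exists_cutoff_vectorField
    ((isCompact_closedBall (0 : E) (‖x₀‖ * Real.exp (C * T))).inter_left hN) hW
    (fun x hx => hNW hx.1) hY
  obtain ⟨γ, hγ0, hγ⟩ := exists_integralCurve_of_lipschitz hK hB x₀ hT
  have hmem : ∀ r ∈ Ioo (-T) T, γ r ∈ N := fun r hr =>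
    mem_of_hasDerivAt_of_fderiv_eq_zero hN hW hNW hF hNF hγ
      (fun r _ hr => by rw [map_smul, hFY _ hr, smul_zero]) (hγ0 ▸ hx₀) hr
  have hbound : ∀ r ∈ Ioo (-T) T, ‖γ r‖ ≤ ‖x₀‖ * Real.exp (C * T) := fun r hr => by
    refine (norm_le_of_hasDerivAt_of_norm_le (C := C) hγ (fun r hr => ?_) hr).trans ?_
    · rw [norm_smul, Real.norm_eq_abs, abs_of_nonneg (hφ _).1]
      exact (mul_le_of_le_one_left (norm_nonneg _) (hφ _).2).trans (hYC _ (hmem r hr))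
    · rw [hγ0]
      gcongr
      exact abs_le.2 ⟨hr.1.le, hr.2.le⟩
  refine ⟨γ, hγ0, fun r hr => ⟨hmem r hr, ?_, hbound r hr⟩⟩
  have := hγ r hr
  rwa [hφ1 (γ r) ⟨hmem r hr, by simpa using hbound r hr⟩, one_smul] at this

theorem eqOn_integralCurve_Ioo (hN : IsClosed N) (hW : IsOpen W) (hNW : N ⊆ W)
    (hY : ContDiffOn ℝ 1 Y W) {γ₁ γ₂ : ℝ → E} {T R : ℝ} (hT : 0 < T)
    (h₁ : ∀ r ∈ Ioo (-T) T, γ₁ r ∈ N ∧ HasDerivAt γ₁ (Y (γ₁ r)) r ∧ ‖γ₁ r‖ ≤ R)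
    (h₂ : ∀ r ∈ Ioo (-T) T, γ₂ r ∈ N ∧ HasDerivAt γ₂ (Y (γ₂ r)) r ∧ ‖γ₂ r‖ ≤ R)
    (h0 : γ₁ 0 = γ₂ 0) : EqOn γ₁ γ₂ (Ioo (-T) T) := by
  obtain ⟨φ, hφ, hφ1, hφ0, ⟨K, hK⟩, B, hB⟩ := exists_cutoff_vectorField
    ((isCompact_closedBall (0 : E) R).inter_left hN) hW (fun x hx => hNW hx.1) hY
  have hLip : LipschitzOnWith K Y (N ∩ Metric.closedBall 0 R) := fun x hx y hy => by
    simpa [hφ1 x hx, hφ1 y hy] using hK x y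
  exact ODE_solution_unique_of_mem_Ioo (v := fun _ => Y) (fun _ _ => hLip)
    (show (0 : ℝ) ∈ Ioo (-T) T from ⟨by linarith, hT⟩)
    (fun r hr => ⟨(h₁ r hr).2.1, (h₁ r hr).1, by simpa using (h₁ r hr).2.2⟩)
    (fun r hr => ⟨(h₂ r hr).2.1, (h₂ r hr).1, by simpa using (h₂ r hr).2.2⟩) h0

/-- A vector field of linear growth that is tangent to a closed level set has integral curves in the
level set that are defined for all times. -/
theorem exists_integralCurve (hN : IsClosed N) (hW : IsOpen W) (hNW : N ⊆ W)
    (hF : ∀ x ∈ W, DifferentiableAt ℝ F x) (hNF : ∀ x ∈ W, x ∈ N ↔ F x = 0)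
    (hY : ContDiffOn ℝ 1 Y W) (hFY : ∀ x ∈ W, fderiv ℝ F x (Y x) = 0) (hC : 0 ≤ C)
    (hYC : ∀ x ∈ N, ‖Y x‖ ≤ C * ‖x‖) {x₀ : E} (hx₀ : x₀ ∈ N) :
    ∃ γ : ℝ → E, γ 0 = x₀ ∧ ∀ r, γ r ∈ N ∧ HasDerivAt γ (Y (γ r)) r := by
  choose γ hγ0 hγ using fun n : ℕ => exists_integralCurve_Ioo hN hW hNW hF hNF hY hFY hC hYC hx₀
    (show (0 : ℝ) < n + 1 by positivity)
  -- Curves on larger intervals extend those on smaller ones, so they glue; at time r the curve with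
  -- index ⌊|r|⌋ is defined.
  have heq : ∀ m n : ℕ, m ≤ n → EqOn (γ m) (γ n) (Ioo (-((m : ℝ) + 1)) (m + 1)) := fun m n hmn => by
    have hmn' : (m : ℝ) ≤ n := by exact_mod_cast hmn
    refine eqOn_integralCurve_Ioo hN hW hNW hY (R := ‖x₀‖ * Real.exp (C * (n + 1)))
      (by positivity) (fun r hr => ?_) (fun r hr => ?_) ((hγ0 m).trans (hγ0 n).symm)
    · obtain ⟨h1, h2, h3⟩ := hγ m r hr
      exact ⟨h1, h2, h3.trans (by gcongr)⟩
    · exact hγ n r ⟨by linarith [hr.1], by linarith [hr.2]⟩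
  have hfloor : ∀ r : ℝ, r ∈ Ioo (-((⌊|r|⌋₊ : ℝ) + 1)) (⌊|r|⌋₊ + 1) := fun r =>
    abs_lt.1 (Nat.lt_floor_add_one |r|)
  refine ⟨fun r => γ ⌊|r|⌋₊ r, hγ0 _, fun r => ⟨(hγ _ r (hfloor r)).1, ?_⟩⟩
  set n := ⌊|r|⌋₊ with hn
  have hloc : (fun r => γ ⌊|r|⌋₊ r) =ᶠ[𝓝 r] γ n := by
    filter_upwards [isOpen_Ioo.mem_nhds (hfloor r)] with r' hr'
    have h1 : ⌊|r'|⌋₊ ≤ n := by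
      have : |r'| < n + 1 := abs_lt.2 hr'
      have := (Nat.floor_lt (abs_nonneg r')).2 (by exact_mod_cast this : |r'| < ((n + 1 : ℕ) : ℝ))
      omega
    exact heq _ _ h1 (hfloor r')
  have := (hγ n r (hfloor r)).2.1
  exact this.congr_of_eventuallyEq hloc

end GlobalCurves

/-! ### Tangent spaces of regular level sets -/

section LevelSets

variable {E G : Type*} [NormedAddCommGroup E] [NormedSpace ℝ E] [CompleteSpace E]
  [NormedAddCommGroup G] [NormedSpace ℝ G] [FiniteDimensional ℝ G]

/-- The tangent space of a regular level set is the kernel of the differential. -/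
theorem mem_tangentVectors_iff {N : Set E} {F : E → G} {x : E} (hF : ContDiffAt ℝ ∞ F x)
    (hN : ∀ᶠ y in 𝓝 x, y ∈ N ↔ F y = 0) (hsurj : Function.Surjective (fderiv ℝ F x)) (hx : x ∈ N)
    {v : E} : v ∈ tangentVectors N x ↔ fderiv ℝ F x v = 0 := by
  have hd : HasFDerivAt F (fderiv ℝ F x) x := (hF.differentiableAt (by simp)).hasFDerivAt
  have hx0 : F x = 0 := hN.self_of_nhds.1 hx
  constructor
  · rintro ⟨γ, hγ0, hγ, hγN⟩
    have h1 : HasDerivAt (fun r => F (γ r)) (fderiv ℝ F x v) 0 := by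
      rw [← hγ0] at hd ⊢
      exact hd.comp_hasDerivAt 0 hγ
    have h2 : (fun r => F (γ r)) =ᶠ[𝓝 0] fun _ => 0 := by
      have hcont : Tendsto γ (𝓝 0) (𝓝 x) := hγ0 ▸ hγ.continuousAt
      filter_upwards [hγN, hcont.eventually hN] with r hr hr'
      exact hr'.1 hr
    exact h1.unique ((hasDerivAt_const (0 : ℝ) (0 : G)).congr_of_eventuallyEq h2)
  · intro hv
    have hs : HasStrictFDerivAt F (fderiv ℝ F x) x := hF.hasStrictFDerivAt (by simp)
    have hr : (fderiv ℝ F x).range = ⊤ := LinearMap.range_eq_top.2 hsurj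
    -- The implicit function parametrizes the level set by the kernel; the image of the line through
    -- `v` is the required curve.
    let φ := hs.implicitFunction F (fderiv ℝ F x) hr (F x)
    have hφ : HasStrictFDerivAt φ (fderiv ℝ F x).ker.subtypeL 0 := hs.to_implicitFunction hr
    let c : ℝ → (fderiv ℝ F x).ker := fun r => r • ⟨v, hv⟩
    have hc : HasDerivAt c ⟨v, hv⟩ 0 := by
      simpa using (hasDerivAt_id (0 : ℝ)).smul_const (⟨v, hv⟩ : (fderiv ℝ F x).ker)
    have hc0 : c 0 = 0 := zero_smul _ _
    have hφ0 : φ 0 = x := hs.implicitFunction_apply_image hr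
    have hcomp : HasDerivAt (fun r => φ (c r)) v 0 := by
      have h := hφ.hasFDerivAt
      rw [← hc0] at h
      exact h.comp_hasDerivAt (0 : ℝ) hc
    refine ⟨fun r => φ (c r), by simp only [hc0, hφ0], hcomp, ?_⟩
    have h1 : Tendsto (fun r => φ (c r)) (𝓝 0) (𝓝 x) := by
      have := hcomp.continuousAt.tendsto
      simpa only [hc0, hφ0] using this
    have h2 : ∀ᶠ r in 𝓝 (0 : ℝ), F (φ (c r)) = F x := by
      have h3 := hs.map_implicitFunction_eq hr
      have h4 : Tendsto (fun r => (F x, c r)) (𝓝 0) (𝓝 (F x, 0)) := by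
        refine tendsto_const_nhds.prodMk_nhds ?_
        have := hc.continuousAt.tendsto
        rwa [hc0] at this
      exact h4.eventually h3
    filter_upwards [h1.eventually hN, h2] with r hr hr'
    exact hr.2 (hr'.trans hx0)

end LevelSets

/-! ### The Liouville form and the Kähler form in logarithmic coordinates -/

section TorusCalculus

variable {k : ℕ}

theorem logMap_mul_exp (x : Fin k → ℂ) (hx : ∀ j, x j ≠ 0) (ζ : Fin k → ℂ) (r : ℝ) :
    logMap (fun j => x j * Complex.exp (r * ζ j)) = logMap x + r • reL k ζ := by
  ext j
  simp only [logMap, norm_mul, Complex.norm_exp, Pi.add_apply, Pi.smul_apply, reL_apply,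
    smul_eq_mul]
  rw [Real.log_mul (norm_ne_zero_iff.2 (hx j)) (Real.exp_pos _).ne', Real.log_exp]
  simp

theorem mul_inv_mul_cancel_of_ne_zero {x : Fin k → ℂ} (hx : ∀ j, x j ≠ 0) (v : Fin k → ℂ) :
    x * (x⁻¹ * v) = v := by
  ext j
  simp [mul_inv_cancel_left₀ (hx j)]

theorem isOpen_torus : IsOpen {x : Fin k → ℂ | ∀ j, x j ≠ 0} := by
  simp only [ofPred_forall]
  exact isOpen_iInter_of_finite fun j => isOpen_ne_fun (continuous_apply j) continuous_const

theorem fderiv_logMap_mul {x : Fin k → ℂ} (hx : ∀ j, x j ≠ 0) (ζ : Fin k → ℂ) :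
    fderiv ℝ logMap x (x * ζ) = reL k ζ := by
  have hd : HasFDerivAt (logMap (k := k)) (fderiv ℝ logMap x) x :=
    ((contDiffAt_logMap (n := 1) hx).differentiableAt one_ne_zero).hasFDerivAt
  have h1 : HasDerivAt (fun r : ℝ => logMap fun j => x j * Complex.exp (r * ζ j))
      (fderiv ℝ logMap x (x * ζ)) 0 := by
    have hd' : HasFDerivAt (logMap (k := k)) (fderiv ℝ logMap x)
        ((fun (r : ℝ) (j : Fin k) => x j * Complex.exp (r * ζ j)) 0) := by simpa using hd
    exact hd'.comp_hasDerivAt (0 : ℝ) (hasDerivAt_mul_exp x ζ)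
  simp only [logMap_mul_exp x hx] at h1
  refine h1.unique ?_
  simpa using ((hasDerivAt_id (0 : ℝ)).smul_const (reL k ζ)).const_add (logMap x)

theorem liouvilleForm_eq {ψ : (Fin k → ℝ) → ℝ} {x : Fin k → ℂ} (hx : ∀ j, x j ≠ 0)
    (hψ : DifferentiableAt ℝ ψ (logMap x)) :
    liouvilleForm ψ x = (fderiv ℝ ψ (logMap x)).comp
      ((imL k).comp (ContinuousLinearMap.mul ℝ (Fin k → ℂ) x⁻¹)) := by
  ext v
  have h1 : fderiv ℝ (fun y : Fin k → ℂ => ψ (logMap y)) x =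
      (fderiv ℝ ψ (logMap x)).comp (fderiv ℝ logMap x) :=
    fderiv_comp x hψ ((contDiffAt_logMap (n := 1) hx).differentiableAt one_ne_zero)
  have h2 : Complex.I • v = x * (Complex.I • (x⁻¹ * v)) := by
    rw [mul_smul_comm, mul_inv_mul_cancel_of_ne_zero hx]
  have h3 : reL k (Complex.I • (x⁻¹ * v)) = -imL k (x⁻¹ * v) := by ext j; simp
  change -(fderiv ℝ (fun y : Fin k → ℂ => ψ (logMap y)) x (Complex.I • v)) =
    fderiv ℝ ψ (logMap x) (imL k (x⁻¹ * v))
  rw [h1, ContinuousLinearMap.comp_apply, h2, fderiv_logMap_mul hx, h3, map_neg, neg_neg]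

theorem liouvilleForm_apply_mul {ψ : (Fin k → ℝ) → ℝ} {x : Fin k → ℂ} (hx : ∀ j, x j ≠ 0)
    (hψ : DifferentiableAt ℝ ψ (logMap x)) (ζ : Fin k → ℂ) :
    liouvilleForm ψ x (x * ζ) = fderiv ℝ ψ (logMap x) (imL k ζ) := by
  rw [liouvilleForm_eq hx hψ]
  change fderiv ℝ ψ (logMap x) (imL k (x⁻¹ * (x * ζ))) = _
  congr 2
  ext j
  simp [inv_mul_cancel_left₀ (hx j)]

theorem contDiffAt_mul_inv {n : WithTop ℕ∞} {x : Fin k → ℂ} (hx : ∀ j, x j ≠ 0) :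
    ContDiffAt ℝ n (fun y : Fin k → ℂ => ContinuousLinearMap.mul ℝ (Fin k → ℂ) y⁻¹) x := by
  have h1 : ContDiffAt ℝ n (fun y : Fin k → ℂ => y⁻¹) x :=
    contDiffAt_pi.2 fun j => (contDiff_apply ℝ ℂ j).contDiffAt.inv (hx j)
  exact (ContinuousLinearMap.mul ℝ (Fin k → ℂ)).contDiff.contDiffAt.comp x h1

/-- Smoothness of the partial differential, for families over a parameter set. -/
theorem contDiffOn_fderiv_right {V F : Type*} [NormedAddCommGroup V] [NormedSpace ℝ V]
    [NormedAddCommGroup F] [NormedSpace ℝ F] {g : ℝ → V → F} {B : Set ℝ} {O : Set V}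
    (hB : UniqueDiffOn ℝ B) (hO : IsOpen O)
    (hg : ContDiffOn ℝ ∞ (fun p : ℝ × V => g p.1 p.2) (B ×ˢ O)) :
    ContDiffOn ℝ ∞ (fun p : ℝ × V => fderiv ℝ (g p.1) p.2) (B ×ˢ O) := by
  have hsm := hg.fderivWithin (m := ∞) (hB.prod hO.uniqueDiffOn) (by simp)
  refine (hsm.clm_comp (contDiffOn_const (c := ContinuousLinearMap.inr ℝ ℝ V))).congr ?_
  rintro ⟨s, ρ⟩ ⟨hs, hρ⟩
  have h1 := ((hg (s, ρ) ⟨hs, hρ⟩).differentiableWithinAt (by simp)).hasFDerivWithinAt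
  exact ((h1.comp ρ (hasFDerivAt_prodMk_right s ρ).hasFDerivWithinAt
    fun ρ' hρ' => ⟨hs, hρ'⟩).hasFDerivAt (hO.mem_nhds hρ)).fderiv

theorem ContDiffOn.right {V F : Type*} [NormedAddCommGroup V] [NormedSpace ℝ V]
    [NormedAddCommGroup F] [NormedSpace ℝ F] {g : ℝ → V → F} {B : Set ℝ} {O : Set V}
    (hg : ContDiffOn ℝ ∞ (fun p : ℝ × V => g p.1 p.2) (B ×ˢ O)) {s : ℝ} (hs : s ∈ B) :
    ContDiffOn ℝ ∞ (g s) O :=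
  hg.comp (contDiff_prodMk_right s).contDiffOn fun _ hρ => ⟨hs, hρ⟩

/-- Smoothness of the Liouville form, jointly in the point and in the parameter. -/
theorem contDiffOn_liouvilleForm {ψ : ℝ → (Fin k → ℝ) → ℝ} {B : Set ℝ} {O : Set (Fin k → ℝ)}
    (hB : UniqueDiffOn ℝ B) (hO : IsOpen O)
    (hψ : ContDiffOn ℝ ∞ (fun p : ℝ × (Fin k → ℝ) => ψ p.1 p.2) (B ×ˢ O)) :
    ContDiffOn ℝ ∞ (fun p : (Fin k → ℂ) × ℝ => liouvilleForm (ψ p.2) p.1)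
      ({x | (∀ j, x j ≠ 0) ∧ logMap x ∈ O} ×ˢ B) := by
  have h1 : ContDiffOn ℝ ∞ (fun p : (Fin k → ℂ) × ℝ => (p.2, logMap p.1))
      ({x | (∀ j, x j ≠ 0) ∧ logMap x ∈ O} ×ˢ B) := fun p hp =>
    (contDiffAt_snd.prodMk ((contDiffAt_logMap hp.1.1).comp p contDiffAt_fst)).contDiffWithinAt
  have h2 := (contDiffOn_fderiv_right hB hO hψ).comp h1 fun p hp => ⟨hp.2, hp.1.2⟩
  have h3 : ContDiffOn ℝ ∞ (fun p : (Fin k → ℂ) × ℝ => ContinuousLinearMap.mul ℝ (Fin k → ℂ) p.1⁻¹)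
      ({x | (∀ j, x j ≠ 0) ∧ logMap x ∈ O} ×ˢ B) := fun p hp =>
    ((contDiffAt_mul_inv hp.1.1).comp p contDiffAt_fst).contDiffWithinAt
  refine (h2.clm_comp ((contDiffOn_const (c := imL k)).clm_comp h3)).congr fun p hp => ?_
  exact liouvilleForm_eq hp.1.1 (((hψ.right hp.2).contDiffAt
    (hO.mem_nhds hp.1.2)).differentiableAt (by simp))

theorem contDiffAt_liouvilleForm {ψ : (Fin k → ℝ) → ℝ} {x : Fin k → ℂ} (hx : ∀ j, x j ≠ 0)
    {O : Set (Fin k → ℝ)} (hO : IsOpen O) (hxO : logMap x ∈ O) (hψ : ContDiffOn ℝ ∞ ψ O) :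
    ContDiffAt ℝ ∞ (liouvilleForm ψ) x := by
  have h1 : ContDiffAt ℝ ∞ (fun y => (fderiv ℝ ψ (logMap y)).comp
      ((imL k).comp (ContinuousLinearMap.mul ℝ (Fin k → ℂ) y⁻¹))) x := by
    have h2 : ContDiffAt ℝ ∞ (fun y => fderiv ℝ ψ (logMap y)) x :=
      ((hψ.contDiffAt (hO.mem_nhds hxO)).fderiv_right (m := ∞) (by simp)).comp x
        (contDiffAt_logMap hx)
    exact h2.clm_comp (contDiffAt_const.clm_comp (contDiffAt_mul_inv hx))
  refine h1.congr_of_eventuallyEq ?_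
  have h3 : ContinuousAt (logMap (k := k)) x := (contDiffAt_logMap (n := 1) hx).continuousAt
  filter_upwards [isOpen_torus.mem_nhds hx, h3.preimage_mem_nhds (hO.mem_nhds hxO)] with y hy hyO
  exact liouvilleForm_eq hy ((hψ.contDiffAt (hO.mem_nhds hyO)).differentiableAt (by simp))

/-- The exterior derivative of the Liouville form is the Kähler form. -/
theorem oneFormDeriv_liouvilleForm {ψ : (Fin k → ℝ) → ℝ} {x : Fin k → ℂ} (hx : ∀ j, x j ≠ 0)
    {O : Set (Fin k → ℝ)} (hO : IsOpen O) (hxO : logMap x ∈ O) (hψ : ContDiffOn ℝ ∞ ψ O)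
    (ζ ξ : Fin k → ℂ) : oneFormDeriv (liouvilleForm ψ) x (x * ζ) (x * ξ) =
      sympForm (fderiv ℝ (fderiv ℝ ψ) (logMap x)) ζ ξ := by
  have hψx : ContDiffAt ℝ ∞ ψ (logMap x) := hψ.contDiffAt (hO.mem_nhds hxO)
  have hd2 : HasFDerivAt (fderiv ℝ ψ) (fderiv ℝ (fderiv ℝ ψ) (logMap x)) (logMap x) :=
    ((hψx.fderiv_right (m := ∞) (by simp)).differentiableAt (by simp)).hasFDerivAt
  have hθ : HasFDerivAt (liouvilleForm ψ) (fderiv ℝ (liouvilleForm ψ) x) x :=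
    ((contDiffAt_liouvilleForm hx hO hxO hψ).differentiableAt (by simp)).hasFDerivAt
  -- The vector xξ is held fixed, so its logarithmic coordinate is exp(-rζ)ξ along the curve. The
  -- resulting term in ζξ is symmetric and cancels in the exterior derivative.
  have key : ∀ ζ ξ : Fin k → ℂ, fderiv ℝ (liouvilleForm ψ) x (x * ζ) (x * ξ) =
      fderiv ℝ (fderiv ℝ ψ) (logMap x) (reL k ζ) (imL k ξ) -
        fderiv ℝ ψ (logMap x) (imL k (ζ * ξ)) := by
    intro ζ ξ
    set c : ℝ → Fin k → ℂ := fun r j => x j * Complex.exp (r * ζ j) with hc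
    have hc0 : c 0 = x := by simp [hc]
    have hcd : HasDerivAt c (x * ζ) 0 := hasDerivAt_mul_exp x ζ
    have h1 : HasDerivAt (fun r => liouvilleForm ψ (c r) (x * ξ))
        (fderiv ℝ (liouvilleForm ψ) x (x * ζ) (x * ξ)) 0 := by
      have hθ' : HasFDerivAt (liouvilleForm ψ) (fderiv ℝ (liouvilleForm ψ) x) (c 0) := by
        rwa [hc0]
      simpa using (hθ'.comp_hasDerivAt (0 : ℝ) hcd).clm_apply (hasDerivAt_const (0 : ℝ) (x * ξ))
    have hcx : ∀ r j, c r j ≠ 0 := fun r j => mul_ne_zero (hx j) (Complex.exp_ne_zero _)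
    have hlin : HasDerivAt (fun r : ℝ => logMap x + r • reL k ζ) (reL k ζ) 0 := by
      simpa using ((hasDerivAt_id (0 : ℝ)).smul_const (reL k ζ)).const_add (logMap x)
    have h2 : (fun r => liouvilleForm ψ (c r) (x * ξ)) =ᶠ[𝓝 0] fun r =>
        fderiv ℝ ψ (logMap x + r • reL k ζ) (imL k fun j => Complex.exp (-(r * ζ j)) * ξ j) := by
      have h3 : ∀ᶠ r in 𝓝 (0 : ℝ), logMap x + r • reL k ζ ∈ O := by
        have := hlin.continuousAt.preimage_mem_nhds (t := O) (by simpa using hO.mem_nhds hxO)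
        exact this
      filter_upwards [h3] with r hr
      have hlog : logMap (c r) = logMap x + r • reL k ζ := logMap_mul_exp x hx ζ r
      have h4 : x * ξ = c r * fun j => Complex.exp (-(r * ζ j)) * ξ j := by
        ext j
        simp only [hc, Pi.mul_apply]
        rw [Complex.exp_neg]
        field_simp [Complex.exp_ne_zero]
      have hdiff : DifferentiableAt ℝ ψ (logMap (c r)) := by
        rw [hlog]
        exact (hψ.contDiffAt (hO.mem_nhds hr)).differentiableAt (by simp)
      rw [h4, liouvilleForm_apply_mul (hcx r) hdiff, hlog]
    have h5 : HasDerivAt (fun r : ℝ => imL k fun j => Complex.exp (-(r * ζ j)) * ξ j)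
        (imL k (-(ζ * ξ))) 0 := by
      refine (imL k).hasFDerivAt.comp_hasDerivAt (0 : ℝ) (hasDerivAt_pi.2 fun j => ?_)
      have h6 : HasDerivAt (fun r : ℝ => -((r : ℂ) * ζ j)) (-ζ j) 0 := by
        simpa using ((hasDerivAt_id (0 : ℝ)).ofReal_comp.mul_const (ζ j)).fun_neg
      simpa using h6.cexp.mul_const (ξ j)
    have h7 : HasDerivAt (fun r : ℝ => fderiv ℝ ψ (logMap x + r • reL k ζ))
        (fderiv ℝ (fderiv ℝ ψ) (logMap x) (reL k ζ)) 0 := by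
      have hd2' : HasFDerivAt (fderiv ℝ ψ) (fderiv ℝ (fderiv ℝ ψ) (logMap x))
          (logMap x + (0 : ℝ) • reL k ζ) := by simpa using hd2
      exact hd2'.comp_hasDerivAt (0 : ℝ) hlin
    have h8 := h7.clm_apply h5
    rw [(h1.congr_of_eventuallyEq h2.symm).unique h8]
    simp [sub_eq_add_neg]
  have hsymm : ∀ v w, fderiv ℝ (fderiv ℝ ψ) (logMap x) v w =
      fderiv ℝ (fderiv ℝ ψ) (logMap x) w v := fun v w =>
    (hψx.isSymmSndFDerivAt (by simpa using WithTop.coe_le_coe.2 (le_top : (2 : ℕ∞) ≤ ⊤))).eq v w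
  rw [oneFormDeriv, key, key, sympForm_apply, hsymm (imL k ζ), mul_comm ξ ζ]
  ring

/-- The componentwise exponential function. -/
def expMap (w : Fin k → ℂ) : Fin k → ℂ := fun j => Complex.exp (w j)

theorem expMap_ne_zero (w : Fin k → ℂ) (j : Fin k) : expMap w j ≠ 0 := Complex.exp_ne_zero _

@[simp] theorem logMap_expMap (w : Fin k → ℂ) : logMap (expMap w) = reL k w := by
  ext j
  simp [logMap, expMap, Complex.norm_exp]

theorem exists_expMap_eq {x : Fin k → ℂ} (hx : ∀ j, x j ≠ 0) : ∃ w, expMap w = x :=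
  ⟨fun j => Complex.log (x j), funext fun j => Complex.exp_log (hx j)⟩

theorem contDiff_expMap {n : WithTop ℕ∞} : ContDiff ℝ n (expMap (k := k)) :=
  contDiff_pi.2 fun j => (contDiff_apply ℝ ℂ j).cexp

theorem hasFDerivAt_expMap (w : Fin k → ℂ) :
    HasFDerivAt expMap (ContinuousLinearMap.mul ℝ (Fin k → ℂ) (expMap w)) w := by
  have hd : HasFDerivAt (expMap (k := k)) (fderiv ℝ expMap w) w :=
    ((contDiff_expMap (n := 1)).differentiable one_ne_zero w).hasFDerivAt
  suffices h : ContinuousLinearMap.mul ℝ (Fin k → ℂ) (expMap w) = fderiv ℝ expMap w by rwa [h]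
  ext1 ζ
  have h1 : HasDerivAt (fun r : ℝ => w + r • ζ) ζ 0 := by
    simpa using ((hasDerivAt_id (0 : ℝ)).smul_const ζ).const_add w
  have h2 : HasDerivAt (fun r : ℝ => expMap (w + r • ζ)) (fderiv ℝ expMap w ζ) 0 := by
    have hd' : HasFDerivAt (expMap (k := k)) (fderiv ℝ expMap w) (w + (0 : ℝ) • ζ) := by
      simpa using hd
    exact hd'.comp_hasDerivAt (0 : ℝ) h1
  have h3 := hasDerivAt_mul_exp (expMap w) ζ
  have h4 : (fun (r : ℝ) (j : Fin k) => expMap w j * Complex.exp (r * ζ j)) =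
      fun r => expMap (w + r • ζ) := by
    funext r j
    simp [expMap, Complex.exp_add]
  rw [h4] at h3
  exact h3.unique h2

theorem fderiv_comp_expMap {f : (Fin k → ℂ) → ℂ} {w : Fin k → ℂ}
    (hf : DifferentiableAt ℝ f (expMap w)) :
    fderiv ℝ (fun w => f (expMap w)) w = torusDeriv f (expMap w) :=
  (hf.hasFDerivAt.comp w (hasFDerivAt_expMap w)).fderiv

theorem HasDerivAt.expMap {c : ℝ → Fin k → ℂ} {ζ : Fin k → ℂ} {r : ℝ} (hc : HasDerivAt c ζ r) :
    HasDerivAt (fun r => _root_.expMap (c r)) (_root_.expMap (c r) * ζ) r :=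
  (hasFDerivAt_expMap (c r)).comp_hasDerivAt r hc

end TorusCalculus

/-! ### From the estimates to a Liouville manifold -/

section TorusHypersurface

variable {k : ℕ}

/-- The zero set of a function in the torus. -/
def torusHypersurface (f : (Fin k → ℂ) → ℂ) : Set (Fin k → ℂ) :=
  {x | (∀ j, x j ≠ 0) ∧ f x = 0}

/-- The square of the Euclidean norm of `Log x`. -/
def logNormSq (x : Fin k → ℂ) : ℝ := ∑ j, logMap x j ^ 2

theorem logNormSq_nonneg (x : Fin k → ℂ) : 0 ≤ logNormSq x :=
  Finset.sum_nonneg fun _ _ => sq_nonneg _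

theorem norm_sq_le_logNormSq (x : Fin k → ℂ) : ‖logMap x‖ ^ 2 ≤ logNormSq x := by
  rw [← Real.le_sqrt (norm_nonneg _) (logNormSq_nonneg x)]
  refine (pi_norm_le_iff_of_nonneg (Real.sqrt_nonneg _)).2 fun j => ?_
  refine Real.le_sqrt_of_sq_le ?_
  rw [Real.norm_eq_abs, sq_abs]
  exact Finset.single_le_sum (f := fun j => logMap x j ^ 2) (fun _ _ => sq_nonneg _)
    (Finset.mem_univ j)

theorem logNormSq_le (x : Fin k → ℂ) : logNormSq x ≤ k * ‖logMap x‖ ^ 2 := by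
  calc logNormSq x ≤ ∑ _j : Fin k, ‖logMap x‖ ^ 2 := Finset.sum_le_sum fun j _ => by
        rw [← sq_abs]
        gcongr
        exact norm_le_pi_norm (logMap x) j
    _ = _ := by simp

theorem contDiffAt_logNormSq {n : WithTop ℕ∞} {x : Fin k → ℂ} (hx : ∀ j, x j ≠ 0) :
    ContDiffAt ℝ n logNormSq x :=
  ContDiffAt.sum fun j _ => ((contDiff_apply ℝ ℝ j).contDiffAt.comp x (contDiffAt_logMap hx)).pow 2

theorem fderiv_logNormSq_mul {x : Fin k → ℂ} (hx : ∀ j, x j ≠ 0) (ζ : Fin k → ℂ) :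
    fderiv ℝ logNormSq x (x * ζ) = 2 * ∑ j, logMap x j * (ζ j).re := by
  have hd : HasFDerivAt (logNormSq (k := k)) (fderiv ℝ logNormSq x) x :=
    ((contDiffAt_logNormSq (n := 1) hx).differentiableAt one_ne_zero).hasFDerivAt
  have h1 : HasDerivAt (fun r : ℝ => logNormSq fun j => x j * Complex.exp (r * ζ j))
      (fderiv ℝ logNormSq x (x * ζ)) 0 := by
    have hd' : HasFDerivAt (logNormSq (k := k)) (fderiv ℝ logNormSq x)
        ((fun (r : ℝ) (j : Fin k) => x j * Complex.exp (r * ζ j)) 0) := by simpa using hd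
    exact hd'.comp_hasDerivAt (0 : ℝ) (hasDerivAt_mul_exp x ζ)
  simp only [logNormSq, logMap_mul_exp x hx, Pi.add_apply, Pi.smul_apply, reL_apply,
    smul_eq_mul] at h1
  refine h1.unique ?_
  rw [Finset.mul_sum]
  refine HasDerivAt.fun_sum fun j _ => ?_
  have h2 : HasDerivAt (fun r : ℝ => logMap x j + r * (ζ j).re) (ζ j).re 0 := by
    simpa using ((hasDerivAt_id (0 : ℝ)).mul_const (ζ j).re).const_add (logMap x j)
  refine (h2.fun_pow 2).congr_deriv ?_
  simp
  ring

/-- The hypotheses under which the zero set of `f` in the torus, with the Liouville form of the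
potential `ψ`, is a Liouville manifold. -/
structure LiouvilleData (f : (Fin k → ℂ) → ℂ) (ψ : (Fin k → ℝ) → ℝ) (O : Set (Fin k → ℝ))
    (l Λ κ R : ℝ) : Prop where
  contDiffAt : ∀ x, (∀ j, x j ≠ 0) → ContDiffAt ℝ ∞ f x
  isOpen : IsOpen O
  contDiffOn : ContDiffOn ℝ ∞ ψ O
  metric : ∀ ρ ∈ O, IsMetricBetween (fderiv ℝ (fderiv ℝ ψ) ρ) l Λ
  euler : ∀ ρ ∈ O, ∀ v, fderiv ℝ ψ ρ v = fderiv ℝ (fderiv ℝ ψ) ρ ρ v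
  mem : ∀ x ∈ torusHypersurface f, logMap x ∈ O
  surj : ∀ x ∈ torusHypersurface f, ∀ y, ∃ ζ, torusDeriv f x ζ = y
  nearly : ∀ x ∈ torusHypersurface f, IsNearlyComplex (torusDeriv f x) κ
  radial : ∀ x ∈ torusHypersurface f, R ≤ ‖logMap x‖ →
    ∃ ξ, torusDeriv f x ξ = 0 ∧ ‖ξ - ofRealL k (logMap x)‖ ≤ κ * ‖logMap x‖
  dim_pos : 0 < k
  l_pos : 0 < l
  nonneg : 0 ≤ Λ
  R_pos : 0 < R
  κ_le : κ ≤ 1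
  mul_κ_le : 4 * Λ * κ ≤ l
  dim_mul_κ_le : k * ((8 * Λ / l + 1) * κ) ≤ 1 / 2

namespace LiouvilleData

variable {f : (Fin k → ℂ) → ℂ} {ψ : (Fin k → ℝ) → ℝ} {O : Set (Fin k → ℝ)} {l Λ κ R : ℝ}

theorem fderiv_surjective (h : LiouvilleData f ψ O l Λ κ R) {x : Fin k → ℂ}
    (hx : x ∈ torusHypersurface f) : Function.Surjective (fderiv ℝ f x) := fun y => by
  obtain ⟨ζ, hζ⟩ := h.surj x hx y
  exact ⟨x * ζ, hζ⟩

theorem mem_tangentVectors_iff (h : LiouvilleData f ψ O l Λ κ R) {x : Fin k → ℂ}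
    (hx : x ∈ torusHypersurface f) {v : Fin k → ℂ} :
    v ∈ tangentVectors (torusHypersurface f) x ↔ fderiv ℝ f x v = 0 := by
  refine _root_.mem_tangentVectors_iff (h.contDiffAt x hx.1) ?_ (h.fderiv_surjective hx) hx
  filter_upwards [isOpen_torus.mem_nhds hx.1] with y hy
  exact ⟨fun hy' => hy'.2, fun hy' => ⟨hy, hy'⟩⟩

theorem mul_mem_tangentVectors_iff (h : LiouvilleData f ψ O l Λ κ R) {x : Fin k → ℂ}
    (hx : x ∈ torusHypersurface f) {ζ : Fin k → ℂ} :
    x * ζ ∈ tangentVectors (torusHypersurface f) x ↔ torusDeriv f x ζ = 0 :=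
  h.mem_tangentVectors_iff hx

/-- Euler's identity: the Liouville form is the contraction of the Kähler form with the radial
vector Log x. -/
theorem liouvilleForm_mul (h : LiouvilleData f ψ O l Λ κ R) {x : Fin k → ℂ}
    (hx : x ∈ torusHypersurface f) (ζ : Fin k → ℂ) : liouvilleForm ψ x (x * ζ) =
      sympForm (fderiv ℝ (fderiv ℝ ψ) (logMap x)) (ofRealL k (logMap x)) ζ := by
  have hO := h.mem x hx
  rw [liouvilleForm_apply_mul hx.1 ((h.contDiffOn.contDiffAt
    (h.isOpen.mem_nhds hO)).differentiableAt (by simp)), h.euler _ hO, sympForm_apply]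
  simp

theorem oneFormDeriv_mul (h : LiouvilleData f ψ O l Λ κ R) {x : Fin k → ℂ}
    (hx : x ∈ torusHypersurface f) (ζ ξ : Fin k → ℂ) :
    oneFormDeriv (liouvilleForm ψ) x (x * ζ) (x * ξ) =
      sympForm (fderiv ℝ (fderiv ℝ ψ) (logMap x)) ζ ξ :=
  oneFormDeriv_liouvilleForm hx.1 h.isOpen (h.mem x hx) h.contDiffOn ζ ξ

theorem isLiouvilleVector_mul_iff (h : LiouvilleData f ψ O l Λ κ R) {x : Fin k → ℂ}
    (hx : x ∈ torusHypersurface f) (ζ : Fin k → ℂ) :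
    IsLiouvilleVector (torusHypersurface f) (liouvilleForm ψ) x (x * ζ) ↔
      torusDeriv f x ζ = 0 ∧ ∀ w, torusDeriv f x w = 0 →
        sympForm (fderiv ℝ (fderiv ℝ ψ) (logMap x)) ζ w =
          sympForm (fderiv ℝ (fderiv ℝ ψ) (logMap x)) (ofRealL k (logMap x)) w := by
  refine and_congr (h.mul_mem_tangentVectors_iff hx) ⟨fun H w hw => ?_, fun H w hw => ?_⟩
  · rw [← h.oneFormDeriv_mul hx, ← h.liouvilleForm_mul hx]
    exact H _ ((h.mul_mem_tangentVectors_iff hx).2 hw)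
  · rw [← mul_inv_mul_cancel_of_ne_zero hx.1 w] at hw ⊢
    rw [h.oneFormDeriv_mul hx, h.liouvilleForm_mul hx]
    exact H _ ((h.mul_mem_tangentVectors_iff hx).1 hw)

theorem surjective_fderiv_equivFunL (h : LiouvilleData f ψ O l Λ κ R) {x : Fin k → ℂ}
    (hx : x ∈ torusHypersurface f) :
    Function.Surjective (fderiv ℝ (fun y => Complex.basisOneI.equivFunL (f y)) x) := by
  have : fderiv ℝ (fun y => Complex.basisOneI.equivFunL (f y)) x =
      (Complex.basisOneI.equivFunL : ℂ →L[ℝ] (Fin 2 → ℝ)).comp (fderiv ℝ f x) :=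
    (Complex.basisOneI.equivFunL.hasFDerivAt.comp x
      ((h.contDiffAt x hx.1).differentiableAt (by simp)).hasFDerivAt).fderiv
  rw [this]
  exact Complex.basisOneI.equivFunL.surjective.comp (h.fderiv_surjective hx)

theorem isEmbeddedSubmanifold (h : LiouvilleData f ψ O l Λ κ R) :
    IsEmbeddedSubmanifold 2 (torusHypersurface f) := fun x hx => by
  refine ⟨{y | ∀ j, y j ≠ 0}, isOpen_torus, hx.1, fun y => Complex.basisOneI.equivFunL (f y),
    fun y hy => ?_, fun y hy => ?_, h.surjective_fderiv_equivFunL hx⟩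
  · exact (Complex.basisOneI.equivFunL.contDiff.contDiffAt.comp y
      (h.contDiffAt y hy)).contDiffWithinAt
  · rw [EmbeddingLike.map_eq_zero_iff]
    exact ⟨fun hy' => hy'.2, fun hy' => ⟨hy, hy'⟩⟩

theorem isExactSymplectic (h : LiouvilleData f ψ O l Λ κ R) :
    IsExactSymplectic 2 (torusHypersurface f) (liouvilleForm ψ) where
  submanifold := h.isEmbeddedSubmanifold
  smooth x hx := by
    have hcont : ContinuousOn (logMap (k := k)) {y | ∀ j, y j ≠ 0} := fun y hy =>
      (contDiffAt_logMap (n := 1) hy).continuousAt.continuousWithinAt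
    exact ⟨{y | ∀ j, y j ≠ 0} ∩ logMap ⁻¹' O, hcont.isOpen_inter_preimage isOpen_torus h.isOpen,
      ⟨hx.1, h.mem x hx⟩, fun y hy =>
        (contDiffAt_liouvilleForm hy.1 h.isOpen hy.2 h.contDiffOn).contDiffWithinAt⟩
  nondegenerate x hx v hv H := by
    rw [← mul_inv_mul_cancel_of_ne_zero hx.1 v] at hv H ⊢
    rw [(h.metric _ (h.mem x hx)).eq_zero_of_sympForm_eq_zero h.l_pos h.nonneg h.κ_le h.mul_κ_le
      (h.nearly x hx) ((h.mul_mem_tangentVectors_iff hx).1 hv) fun w hw => by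
        rw [← h.oneFormDeriv_mul hx]
        exact H _ ((h.mul_mem_tangentVectors_iff hx).2 hw), mul_zero]

theorem isInvertible_liouvilleOp (h : LiouvilleData f ψ O l Λ κ R) {x : Fin k → ℂ}
    (hx : x ∈ torusHypersurface f) :
    (liouvilleOp (fderiv ℝ (fderiv ℝ ψ) (logMap x)) (torusDeriv f x)).IsInvertible :=
  _root_.isInvertible_liouvilleOp (h.surj x hx) fun _ hz hw =>
    (h.metric _ (h.mem x hx)).eq_zero_of_sympForm_eq_zero h.l_pos h.nonneg h.κ_le h.mul_κ_le
      (h.nearly x hx) hz hw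

/-- The Liouville vector field has integral curves that are defined for all times. -/
theorem exists_liouvilleCurve (h : LiouvilleData f ψ O l Λ κ R) {x : Fin k → ℂ}
    (hx : x ∈ torusHypersurface f) :
    ∃ γ : ℝ → Fin k → ℂ, IsLiouvilleCurve (torusHypersurface f) (liouvilleForm ψ) γ ∧ γ 0 = x := by
  -- The flow is built on the cover w ↦ exp(w). There the hypersurface is closed in the whole vector
  -- space and the Liouville field grows linearly.
  set F : (Fin k → ℂ) → ℂ := fun w => f (expMap w) with hF
  set N : Set (Fin k → ℂ) := {w | F w = 0} with hN
  have hNmem : ∀ w ∈ N, expMap w ∈ torusHypersurface f := fun w hw => ⟨expMap_ne_zero w, hw⟩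
  have hFs : ContDiff ℝ ∞ F := contDiff_iff_contDiffAt.2 fun w =>
    (h.contDiffAt _ (expMap_ne_zero w)).comp w contDiff_expMap.contDiffAt
  have hFd : ∀ w, fderiv ℝ F w = torusDeriv f (expMap w) := fun w =>
    fderiv_comp_expMap ((h.contDiffAt _ (expMap_ne_zero w)).differentiableAt (by simp))
  set H : (Fin k → ℂ) → (Fin k → ℝ) →L[ℝ] (Fin k → ℝ) →L[ℝ] ℝ :=
    fun w => fderiv ℝ (fderiv ℝ ψ) (reL k w) with hH
  set U : Set (Fin k → ℂ) := reL k ⁻¹' O with hU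
  have hUo : IsOpen U := h.isOpen.preimage (reL k).continuous
  have hHs : ∀ w ∈ U, ContDiffAt ℝ 1 H w := fun w hw => by
    have h1 : ContDiffAt ℝ ∞ ψ (reL k w) := h.contDiffOn.contDiffAt (h.isOpen.mem_nhds hw)
    have h2 : ContDiffAt ℝ ∞ (fderiv ℝ (fderiv ℝ ψ)) (reL k w) :=
      (h1.fderiv_right (m := ∞) (by simp)).fderiv_right (m := ∞) (by simp)
    exact (h2.of_le (by exact_mod_cast le_top)).comp w (reL k).contDiff.contDiffAt
  have hDs : ∀ w, ContDiffAt ℝ 1 (fderiv ℝ F) w := fun w =>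
    ((hFs.fderiv_right (m := ∞) (by simp)).of_le (by exact_mod_cast le_top)).contDiffAt
  -- Invertibility is an open condition, so the linear system defines a smooth field in a
  -- neighbourhood of the hypersurface that is tangent to all level sets of `F`.
  set W : Set (Fin k → ℂ) := U ∩ (fun w => liouvilleOp (H w) (fderiv ℝ F w)) ⁻¹'
    {T | T.IsInvertible} with hW
  have hWo : IsOpen W := by
    refine ContinuousOn.isOpen_inter_preimage (fun w hw => ?_) hUo ?_
    · exact (contDiffAt_liouvilleOp (hHs w hw) (hDs w)).continuousAt.continuousWithinAt
    · exact ContinuousLinearEquiv.isOpen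
  set Y : (Fin k → ℂ) → Fin k → ℂ := fun w => liouvilleVector (H w) (fderiv ℝ F w) (reL k w) with hY
  have hNW : N ⊆ W := fun w hw => by
    have h1 := h.mem _ (hNmem w hw)
    have h2 := h.isInvertible_liouvilleOp (hNmem w hw)
    rw [logMap_expMap] at h1 h2
    refine ⟨h1, ?_⟩
    change (liouvilleOp (H w) (fderiv ℝ F w)).IsInvertible
    rwa [hFd]
  have hYs : ContDiffOn ℝ 1 Y W := fun w hw =>
    (contDiffAt_liouvilleVector (hHs w hw.1) (hDs w) (reL k).contDiff.contDiffAt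
      hw.2).contDiffWithinAt
  have hYspec : ∀ w ∈ W, fderiv ℝ F w (Y w) = 0 ∧ ∀ v, fderiv ℝ F w v = 0 →
      sympForm (H w) (Y w) v = sympForm (H w) (ofRealL k (reL k w)) v := fun w hw =>
    liouvilleVector_spec hw.2 _
  obtain ⟨w₀, hw₀⟩ := exists_expMap_eq hx.1
  have hw₀N : w₀ ∈ N := by
    change f (expMap w₀) = 0
    rw [hw₀]; exact hx.2
  have hC : 0 ≤ 8 * Λ / l := div_nonneg (by linarith [h.nonneg]) h.l_pos.le
  obtain ⟨c, hc0, hc⟩ := exists_integralCurve (N := N) (W := W) (F := F) (Y := Y)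
    (isClosed_eq hFs.continuous continuous_const) hWo hNW
    (fun w _ => hFs.differentiable (by simp) w) (fun w _ => Iff.rfl) hYs
    (fun w hw => (hYspec w hw).1) hC (fun w hw => by
      have h1 := hYspec w (hNW hw)
      rw [hFd] at h1
      have h2 := h.metric _ (h.mem _ (hNmem w hw))
      rw [logMap_expMap] at h2
      refine (h2.norm_le_of_sympForm_eq h.l_pos h.nonneg h.κ_le h.mul_κ_le
        (h.nearly _ (hNmem w hw)) h1.1 h1.2).trans ?_
      rw [norm_ofRealL]
      gcongr
      exact norm_reL_le w) hw₀N
  refine ⟨fun r => expMap (c r), fun r => ⟨hNmem _ (hc r).1, expMap (c r) * Y (c r), ?_,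
    (hc r).2.expMap⟩, by simp only [hc0, hw₀]⟩
  refine (h.isLiouvilleVector_mul_iff (hNmem _ (hc r).1) _).2 ?_
  have := hYspec _ (hNW (hc r).1)
  rw [hFd] at this
  rw [logMap_expMap]
  exact this

theorem exists_isLiouvilleVector (h : LiouvilleData f ψ O l Λ κ R) {x : Fin k → ℂ}
    (hx : x ∈ torusHypersurface f) :
    ∃ z, IsLiouvilleVector (torusHypersurface f) (liouvilleForm ψ) x z := by
  obtain ⟨γ, hγ, hγ0⟩ := h.exists_liouvilleCurve hx
  obtain ⟨-, z, hz, -⟩ := hγ 0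
  exact ⟨z, hγ0 ▸ hz⟩

/-- Far away, the Liouville vector field points outward. -/
theorem le_fderiv_logNormSq (h : LiouvilleData f ψ O l Λ κ R) {x z : Fin k → ℂ}
    (hx : x ∈ torusHypersurface f)
    (hz : IsLiouvilleVector (torusHypersurface f) (liouvilleForm ψ) x z)
    (hxR : k * R ^ 2 ≤ logNormSq x) : R ^ 2 ≤ fderiv ℝ logNormSq x z := by
  have hk : (0 : ℝ) < k := by exact_mod_cast h.dim_pos
  rw [← mul_inv_mul_cancel_of_ne_zero hx.1 z] at hz ⊢
  set ζ := x⁻¹ * z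
  set ρ := logMap x with hρ
  obtain ⟨hζ, hζw⟩ := (h.isLiouvilleVector_mul_iff hx ζ).1 hz
  -- The sum of squares is at most `k` times the squared sup norm, which is why the level is k R².
  have h1 : R ^ 2 ≤ ‖ρ‖ ^ 2 := by
    have := hxR.trans (logNormSq_le x)
    exact le_of_mul_le_mul_left this hk
  have hRρ : R ≤ ‖ρ‖ := (sq_le_sq₀ h.R_pos.le (norm_nonneg _)).1 h1
  obtain ⟨ξ, hξ, hξn⟩ := h.radial x hx hRρ
  have h2 := (h.metric _ (h.mem x hx)).norm_sub_le_of_sympForm_eq h.l_pos h.nonneg h.κ_le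
    h.mul_κ_le (h.nearly x hx) hζ hζw hξ (by rwa [norm_ofRealL])
  rw [norm_ofRealL] at h2
  -- The Liouville vector is close to the radial one. Summed over the coordinates, the errors use up
  -- at most half of ‖ρ‖², and the factor 2 in the derivative of the square restores R².
  have h3 : ∀ j, ρ j ^ 2 - ‖ρ‖ * ((8 * Λ / l + 1) * (κ * ‖ρ‖)) ≤ ρ j * (ζ j).re := fun j => by
    have h4 : |(ζ j).re - ρ j| ≤ (8 * Λ / l + 1) * (κ * ‖ρ‖) := by
      have h5 := (Complex.abs_re_le_norm ((ζ - ofRealL k ρ) j)).trans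
        ((norm_le_pi_norm (ζ - ofRealL k ρ) j).trans h2)
      simpa using h5
    have h6 : |ρ j| ≤ ‖ρ‖ := norm_le_pi_norm ρ j
    have h7 : |ρ j * ((ζ j).re - ρ j)| ≤ ‖ρ‖ * ((8 * Λ / l + 1) * (κ * ‖ρ‖)) := by
      rw [abs_mul]; gcongr
    nlinarith [(abs_le.1 h7).1]
  have h8 : ∑ j, (ρ j ^ 2 - ‖ρ‖ * ((8 * Λ / l + 1) * (κ * ‖ρ‖))) ≤ ∑ j, ρ j * (ζ j).re :=
    Finset.sum_le_sum fun j _ => h3 j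
  rw [Finset.sum_sub_distrib, Finset.sum_const, Finset.card_univ, Fintype.card_fin,
    nsmul_eq_mul] at h8
  have h9 : ‖ρ‖ ^ 2 ≤ ∑ j, ρ j ^ 2 := norm_sq_le_logNormSq x
  have h10 := h.dim_mul_κ_le
  have h11 : (k : ℝ) * (‖ρ‖ * ((8 * Λ / l + 1) * (κ * ‖ρ‖))) ≤ 1 / 2 * ‖ρ‖ ^ 2 := by
    calc (k : ℝ) * (‖ρ‖ * ((8 * Λ / l + 1) * (κ * ‖ρ‖)))
        = (k * ((8 * Λ / l + 1) * κ)) * ‖ρ‖ ^ 2 := by ring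
      _ ≤ 1 / 2 * ‖ρ‖ ^ 2 := by gcongr
  rw [fderiv_logNormSq_mul hx.1]
  linarith

/-- The sublevel set of `|Log x|²` that is a generating Liouville domain. -/
def domain (f : (Fin k → ℂ) → ℂ) (R : ℝ) : Set (Fin k → ℂ) :=
  {x | x ∈ torusHypersurface f ∧ logNormSq x ≤ k * R ^ 2}

theorem hasDerivAt_logNormSq {N : Set (Fin k → ℂ)} (hN : ∀ x ∈ N, ∀ j, x j ≠ 0)
    {θ : (Fin k → ℂ) → (Fin k → ℂ) →L[ℝ] ℝ} {γ : ℝ → Fin k → ℂ} (hγ : IsLiouvilleCurve N θ γ)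
    (r : ℝ) : ∃ z, IsLiouvilleVector N θ (γ r) z ∧
      HasDerivAt (fun r => logNormSq (γ r)) (fderiv ℝ logNormSq (γ r) z) r := by
  obtain ⟨h1, z, hz, hd⟩ := hγ r
  exact ⟨z, hz, ((contDiffAt_logNormSq (n := 1) (hN _ h1)).differentiableAt
    one_ne_zero).hasFDerivAt.comp_hasDerivAt r hd⟩

/-- Outside the domain |Log x|² decreases backwards in time at rate at least R²; being nonnegative,
it must reach the level k R² in finite time. -/
theorem exists_curve_from_domain (h : LiouvilleData f ψ O l Λ κ R) {x : Fin k → ℂ}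
    (hx : x ∈ torusHypersurface f) :
    ∃ γ : ℝ → Fin k → ℂ, IsLiouvilleCurve (torusHypersurface f) (liouvilleForm ψ) γ ∧
      γ 0 ∈ domain f R ∧ ∃ r : ℝ, 0 ≤ r ∧ γ r = x := by
  obtain ⟨γ, hγ, hγ0⟩ := h.exists_liouvilleCurve hx
  have hback : ∃ r : ℝ, 0 ≤ r ∧ logNormSq (γ (-r)) ≤ k * R ^ 2 := by
    by_contra! hcon
    have hR2 : 0 < R ^ 2 := by have := h.R_pos; positivity
    have hd := fun r => hasDerivAt_logNormSq (N := torusHypersurface f) (fun x hx => hx.1) hγ r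
    set r₀ : ℝ := logNormSq x / R ^ 2 + 1 with hr₀
    have hr₀0 : 0 ≤ r₀ := by have := logNormSq_nonneg x; positivity
    have hmvt := (convex_Icc (-r₀) 0).mul_sub_le_image_sub_of_le_deriv
      (f := fun r => logNormSq (γ r)) (C := R ^ 2)
      (fun r _ => by
        obtain ⟨z, -, hz⟩ := hd r
        exact hz.continuousAt.continuousWithinAt)
      (fun r _ => by
        obtain ⟨z, -, hz⟩ := hd r
        exact hz.differentiableAt.differentiableWithinAt)
      (fun r hr => by
        obtain ⟨z, hz, hz'⟩ := hd r
        rw [hz'.deriv]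
        refine h.le_fderiv_logNormSq (hγ r).1 hz ?_
        rw [interior_Icc] at hr
        have := hcon (-r) (by linarith [hr.2])
        rw [neg_neg] at this
        exact this.le)
      (-r₀) ⟨le_rfl, by linarith⟩ 0 ⟨by linarith, le_rfl⟩ (by linarith)
    simp only [hγ0, sub_neg_eq_add, zero_add] at hmvt
    have h1 := logNormSq_nonneg (γ (-r₀))
    have h2 : R ^ 2 * r₀ = logNormSq x + R ^ 2 := by
      rw [hr₀, mul_add, mul_div_cancel₀ _ (pow_ne_zero 2 h.R_pos.ne'), mul_one]
    linarith
  obtain ⟨r, hr, hle⟩ := hback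
  refine ⟨fun r' => γ (r' - r), fun r' => ?_, ⟨(hγ _).1, by simpa using hle⟩, r, hr, by simpa⟩
  obtain ⟨h1, z, hz, hd⟩ := hγ (r' - r)
  exact ⟨h1, z, hz, hd.comp_sub_const r' r⟩

/-- The Liouville vector itself is transverse to the level set. -/
theorem isBoundaryDefining_logNormSq (h : LiouvilleData f ψ O l Λ κ R) {x : Fin k → ℂ}
    (hx : x ∈ torusHypersurface f) (hxR : logNormSq x = k * R ^ 2) :
    ∃ v ∈ tangentVectors (torusHypersurface f) x,
      fderiv ℝ (fun y => logNormSq y - k * R ^ 2) x v ≠ 0 := by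
  obtain ⟨z, hz⟩ := h.exists_isLiouvilleVector hx
  refine ⟨z, hz.1, ?_⟩
  rw [fderiv_sub_const]
  have h1 := h.le_fderiv_logNormSq hx hz hxR.ge
  have h2 : 0 < R ^ 2 := by have := h.R_pos; positivity
  exact (h2.trans_le h1).ne'

theorem isClosed_annulus (C : ℝ) :
    IsCompact {x : Fin k → ℂ | ∀ j, Real.exp (-C) ≤ ‖x j‖ ∧ ‖x j‖ ≤ Real.exp C} := by
  have h1 : {x : Fin k → ℂ | ∀ j, Real.exp (-C) ≤ ‖x j‖ ∧ ‖x j‖ ≤ Real.exp C} =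
      Set.univ.pi fun _ => {z : ℂ | Real.exp (-C) ≤ ‖z‖ ∧ ‖z‖ ≤ Real.exp C} := by
    ext; simp
  rw [h1]
  refine isCompact_univ_pi fun _ => ?_
  refine (isCompact_closedBall (0 : ℂ) (Real.exp C)).of_isClosed_subset ?_ fun z hz => by
    simpa using hz.2
  exact (isClosed_le continuous_const continuous_norm).inter
    (isClosed_le continuous_norm continuous_const)

theorem mem_annulus {x : Fin k → ℂ} (hx : ∀ j, x j ≠ 0) {c : ℝ} (hxc : logNormSq x ≤ c) (j : Fin k) :
    Real.exp (-Real.sqrt c) ≤ ‖x j‖ ∧ ‖x j‖ ≤ Real.exp (Real.sqrt c) := by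
  have h1 : |logMap x j| ≤ Real.sqrt c := by
    refine (norm_le_pi_norm (logMap x) j).trans (Real.le_sqrt_of_sq_le ?_)
    exact (norm_sq_le_logNormSq x).trans hxc
  have h2 : ‖x j‖ = Real.exp (logMap x j) := (Real.exp_log (norm_pos_iff.2 (hx j))).symm
  rw [h2]
  exact ⟨Real.exp_le_exp.2 (abs_le.1 h1).1, Real.exp_le_exp.2 (abs_le.1 h1).2⟩

/-- The total space of a family of sublevel sets of `|Log x|²` is compact. -/
theorem isCompact_total_domain {f : ℝ → (Fin k → ℂ) → ℂ}
    (hf : ∀ x s, (∀ j, x j ≠ 0) → ContinuousAt (fun p : (Fin k → ℂ) × ℝ => f p.2 p.1) (x, s))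
    {K : Set ℝ} (hK : IsCompact K) (R : ℝ) :
    IsCompact {p : (Fin k → ℂ) × ℝ | p.2 ∈ K ∧ p.1 ∈ domain (f p.2) R} := by
  set c : ℝ := k * R ^ 2 with hc
  -- A bound on |Log x| confines x to a compact product of annuli away from the coordinate
  -- hyperplanes, on which the defining conditions are closed.
  set S : Set (Fin k → ℂ) :=
    {x | ∀ j, Real.exp (-Real.sqrt c) ≤ ‖x j‖ ∧ ‖x j‖ ≤ Real.exp (Real.sqrt c)} with hS
  have hS0 : ∀ x ∈ S, ∀ j, x j ≠ 0 := fun x hx j =>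
    norm_pos_iff.1 ((Real.exp_pos _).trans_le (hx j).1)
  have hSc : IsCompact (S ×ˢ K) := (isClosed_annulus _).prod hK
  have h1 : {p : (Fin k → ℂ) × ℝ | p.2 ∈ K ∧ p.1 ∈ domain (f p.2) R} =
      (S ×ˢ K) ∩ (fun p : (Fin k → ℂ) × ℝ => (f p.2 p.1, logNormSq p.1)) ⁻¹' ({0} ×ˢ Iic c) := by
    ext p
    constructor
    · rintro ⟨h1, ⟨h2, h3⟩, h4⟩
      exact ⟨⟨mem_annulus h2 h4, h1⟩, h3, h4⟩
    · rintro ⟨⟨h1, h2⟩, h3, h4⟩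
      exact ⟨h2, ⟨hS0 _ h1, h3⟩, h4⟩
  rw [h1]
  refine hSc.of_isClosed_subset ?_ inter_subset_left
  refine ContinuousOn.preimage_isClosed_of_isClosed (fun p hp => ?_) hSc.isClosed
    (isClosed_singleton.prod isClosed_Iic)
  have h2 := hS0 _ hp.1
  exact ((hf p.1 p.2 h2).prodMk ((contDiffAt_logNormSq (n := 1) h2).continuousAt.comp
    continuousAt_fst)).continuousWithinAt

theorem isCompact_domain (h : LiouvilleData f ψ O l Λ κ R) : IsCompact (domain f R) := by
  have h1 := (isCompact_total_domain (f := fun _ => f) (fun x s hx =>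
    ContinuousAt.comp (g := f) (f := Prod.fst) (x := (x, s)) (h.contDiffAt x hx).continuousAt
      continuousAt_fst) (isCompact_singleton (x := (0 : ℝ))) R).image continuous_fst
  convert h1 using 1
  ext x
  simp

theorem eventually_mem_domain {x : Fin k → ℂ} (hx : ∀ j, x j ≠ 0)
    (hxR : logNormSq x < k * R ^ 2) : ∀ᶠ y in 𝓝 x, y ∈ torusHypersurface f → y ∈ domain f R := by
  filter_upwards [(contDiffAt_logNormSq (n := 1) hx).continuousAt.eventually_lt_const hxR]
    with y hy hyN
  exact ⟨hyN, hy.le⟩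

/-- Outwardness is required for every defining function, not just |Log x|². At an interior point of
the sublevel set, `g` would have a local maximum along every curve in the hypersurface, so its
differential could not be nonzero. At the boundary, dg is nonnegative on the tangent half-space
where |Log x|² grows. The Liouville vector is interior to it, so dg vanishing there would vanish on
the whole tangent space. -/
theorem pos_of_isBoundaryDefining (h : LiouvilleData f ψ O l Λ κ R) {x z : Fin k → ℂ}
    (hx : x ∈ domain f R) {g : (Fin k → ℂ) → ℝ}
    (hg : IsBoundaryDefining (torusHypersurface f) (domain f R) x g)
    (hz : IsLiouvilleVector (torusHypersurface f) (liouvilleForm ψ) x z) :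
    0 < fderiv ℝ g x z := by
  obtain ⟨hg0, ⟨v, hv, hgv⟩, U, hU, hxU, hgs, hgU⟩ := hg
  have hxN := hx.1
  have hgd : HasFDerivAt g (fderiv ℝ g x) x :=
    ((hgs.contDiffAt (hU.mem_nhds hxU)).differentiableAt (by simp)).hasFDerivAt
  have hqd : HasFDerivAt logNormSq (fderiv ℝ logNormSq x) x :=
    ((contDiffAt_logNormSq (n := 1) hxN.1).differentiableAt one_ne_zero).hasFDerivAt
  -- tangent vectors along which `|Log x|²` grows point out of `M`
  have hout : ∀ u ∈ tangentVectors (torusHypersurface f) x, logNormSq x = k * R ^ 2 →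
      0 < fderiv ℝ logNormSq x u → 0 ≤ fderiv ℝ g x u := by
    rintro u ⟨γ, hγ0, hγ, hγN⟩ hxR hu
    have h1 : HasDerivAt (fun r => g (γ r)) (fderiv ℝ g x u) 0 := by
      rw [← hγ0] at hgd ⊢
      exact hgd.comp_hasDerivAt 0 hγ
    have h2 : HasDerivAt (fun r => logNormSq (γ r)) (fderiv ℝ logNormSq x u) 0 := by
      rw [← hγ0] at hqd ⊢
      exact hqd.comp_hasDerivAt 0 hγ
    have h3 : ∀ᶠ r in 𝓝[>] (0 : ℝ), k * R ^ 2 < logNormSq (γ r) := by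
      have h4 := (hasDerivAt_iff_tendsto_slope.1 h2).mono_left
        (nhdsWithin_mono 0 fun r (hr : r ∈ Ioi (0 : ℝ)) => (ne_of_gt hr : r ≠ 0))
      filter_upwards [h4.eventually_const_lt hu, self_mem_nhdsWithin] with r hr hr0
      rw [slope_def_field, hγ0, hxR, sub_zero] at hr
      have := (div_pos_iff_of_pos_right (show (0 : ℝ) < r from hr0)).1 hr
      linarith
    have h5 : ∀ᶠ r in 𝓝[>] (0 : ℝ), 0 < g (γ r) := by
      have h6 : Tendsto γ (𝓝 0) (𝓝 x) := hγ0 ▸ hγ.continuousAt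
      filter_upwards [h3, nhdsWithin_le_nhds (h6.eventually (hU.mem_nhds hxU)),
        nhdsWithin_le_nhds hγN] with r hr hrU hrN
      by_contra hcon
      exact absurd ((hgU _ ⟨hrU, hrN⟩).2 (not_lt.1 hcon)).2 (not_le.2 hr)
    have h7 := (hasDerivAt_iff_tendsto_slope.1 h1).mono_left
      (nhdsWithin_mono 0 fun r (hr : r ∈ Ioi (0 : ℝ)) => (ne_of_gt hr : r ≠ 0))
    refine ge_of_tendsto h7 ?_
    filter_upwards [h5, self_mem_nhdsWithin] with r hr hr0
    rw [slope_def_field, hγ0, hg0, sub_zero, sub_zero]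
    exact (div_pos hr hr0).le
  have htan : ∀ u, u ∈ tangentVectors (torusHypersurface f) x ↔ fderiv ℝ f x u = 0 := fun u =>
    h.mem_tangentVectors_iff hxN
  rcases hx.2.lt_or_eq with hlt | hxR
  · obtain ⟨γ, hγ0, hγ, hγN⟩ := hv
    have h1 : HasDerivAt (fun r => g (γ r)) (fderiv ℝ g x v) 0 := by
      rw [← hγ0] at hgd ⊢
      exact hgd.comp_hasDerivAt 0 hγ
    have h6 : Tendsto γ (𝓝 0) (𝓝 x) := hγ0 ▸ hγ.continuousAt
    have hmax : IsLocalMax (fun r => g (γ r)) 0 := by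
      filter_upwards [h6.eventually (eventually_mem_domain hxN.1 hlt),
        h6.eventually (hU.mem_nhds hxU), hγN] with r hr hrU hrN
      rw [hγ0, hg0]
      exact (hgU _ ⟨hrU, hrN⟩).1 (hr hrN)
    exact absurd (hmax.hasDerivAt_eq_zero h1) hgv
  · have hR2 : 0 < R ^ 2 := by have := h.R_pos; positivity
    have hqz : 0 < fderiv ℝ logNormSq x z :=
      hR2.trans_le (h.le_fderiv_logNormSq hxN hz hxR.ge)
    refine lt_of_le_of_ne (hout z hz.1 hxR hqz) fun h0 => ?_
    have hz0 := (htan z).1 hz.1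
    have hv0 := (htan v).1 hv
    -- a small perturbation of `z` contradicts `hout`
    have key : ∀ u, fderiv ℝ f x u = 0 → 0 ≤ fderiv ℝ g x u := fun u hu => by
      have h1 : ∀ᶠ e in 𝓝[>] (0 : ℝ), 0 < fderiv ℝ logNormSq x (z + e • u) := by
        have h2 : ContinuousAt (fun e : ℝ => fderiv ℝ logNormSq x (z + e • u)) 0 := by fun_prop
        exact nhdsWithin_le_nhds (h2.eventually_const_lt (by simpa using hqz))
      obtain ⟨e, he, he0⟩ := (h1.and self_mem_nhdsWithin).exists
      have h3 := hout (z + e • u) ((htan _).2 (by simp [hz0, hu])) hxR he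
      rw [map_add, ← h0, zero_add, map_smul, smul_eq_mul] at h3
      exact nonneg_of_mul_nonneg_right h3 he0
    have h1 := key v hv0
    have h2 := key (-v) (by rw [map_neg, hv0, neg_zero])
    rw [map_neg] at h2
    exact hgv (le_antisymm (by linarith) h1)

theorem isGeneratingLiouvilleDomain (h : LiouvilleData f ψ O l Λ κ R) :
    IsGeneratingLiouvilleDomain (torusHypersurface f) (liouvilleForm ψ) (domain f R) where
  subset := fun x hx => hx.1
  compact := h.isCompact_domain
  submanifold x hx := by
    rcases hx.2.lt_or_eq with hlt | hxR
    · exact Or.inl (mem_nhdsWithin_iff_eventually.2 (eventually_mem_domain hx.1.1 hlt))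
    · refine Or.inr ⟨fun y => logNormSq y - k * R ^ 2, by simp [hxR],
        h.isBoundaryDefining_logNormSq hx.1 hxR, {y | ∀ j, y j ≠ 0}, isOpen_torus, hx.1.1,
        fun y hy => ((contDiffAt_logNormSq hy).sub contDiffAt_const).contDiffWithinAt,
        fun y hy => ?_⟩
      exact ⟨fun hy' => sub_nonpos.2 hy'.2, fun hy' => ⟨hy.2, sub_nonpos.1 hy'⟩⟩
  outward x hx g hg z hz := h.pos_of_isBoundaryDefining hx hg hz
  generates x hx := h.exists_curve_from_domain hx

theorem isLiouvilleManifold (h : LiouvilleData f ψ O l Λ κ R) :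
    IsLiouvilleManifold 2 (torusHypersurface f) (liouvilleForm ψ) where
  exactSymplectic := h.isExactSymplectic
  complete _ hx := h.exists_liouvilleCurve hx
  exists_domain := ⟨_, h.isGeneratingLiouvilleDomain⟩

end LiouvilleData

end TorusHypersurface

/-! ### Homogeneous potentials and their uniform bounds -/

section Potentials

variable {k : ℕ}

/-- The differential of a function homogeneous of degree two is homogeneous of degree one. -/
theorem fderiv_smul_of_homogeneous {V : Type*} [NormedAddCommGroup V] [NormedSpace ℝ V]
    {ψ : V → ℝ} {O : Set V} (hO : IsOpen O)
    (hψ : ∀ ρ ∈ O, ∀ r : ℝ, 0 < r → ψ (r • ρ) = r ^ 2 * ψ ρ) {ρ : V} (hρ : ρ ∈ O) {r : ℝ}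
    (hr : 0 < r) : fderiv ℝ ψ (r • ρ) = r • fderiv ℝ ψ ρ := by
  have h1 : (fun ρ' => ψ (r • ρ')) =ᶠ[𝓝 ρ] fun ρ' => r ^ 2 • ψ ρ' := by
    filter_upwards [hO.mem_nhds hρ] with ρ' hρ' using hψ ρ' hρ' r hr
  have h2 := h1.fderiv_eq (𝕜 := ℝ)
  have h3 : (fun ρ' => r ^ 2 • ψ ρ') = r ^ 2 • ψ := rfl
  rw [fderiv_comp_smul, h3, fderiv_const_smul_field, sq, mul_smul] at h2
  exact smul_right_injective _ hr.ne' h2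

/-- The Hessian of a function homogeneous of degree two is homogeneous of degree zero. -/
theorem fderiv_fderiv_smul_of_homogeneous {V : Type*} [NormedAddCommGroup V] [NormedSpace ℝ V]
    {ψ : V → ℝ} {O : Set V} (hO : IsOpen O)
    (hψ : ∀ ρ ∈ O, ∀ r : ℝ, 0 < r → ψ (r • ρ) = r ^ 2 * ψ ρ) {ρ : V} (hρ : ρ ∈ O) {r : ℝ}
    (hr : 0 < r) : fderiv ℝ (fderiv ℝ ψ) (r • ρ) = fderiv ℝ (fderiv ℝ ψ) ρ := by
  have h1 : (fun ρ' => fderiv ℝ ψ (r • ρ')) =ᶠ[𝓝 ρ] fun ρ' => r • fderiv ℝ ψ ρ' := by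
    filter_upwards [hO.mem_nhds hρ] with ρ' hρ' using fderiv_smul_of_homogeneous hO hψ hρ' hr
  have h2 := h1.fderiv_eq (𝕜 := ℝ)
  have h3 : fderiv ℝ (fun ρ' => r • fderiv ℝ ψ ρ') ρ = r • fderiv ℝ (fderiv ℝ ψ) ρ :=
    congr_fun (fderiv_const_smul_field (𝕜 := ℝ) (f := fderiv ℝ ψ) r) ρ
  rw [fderiv_comp_smul, h3] at h2
  exact smul_right_injective _ hr.ne' h2

/-- Euler's identity. -/
theorem fderiv_eq_of_homogeneous {V : Type*} [NormedAddCommGroup V] [NormedSpace ℝ V]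
    {ψ : V → ℝ} {O : Set V} (hO : IsOpen O)
    (hψ : ∀ ρ ∈ O, ∀ r : ℝ, 0 < r → ψ (r • ρ) = r ^ 2 * ψ ρ) (hs : ContDiffOn ℝ ∞ ψ O) {ρ : V}
    (hρ : ρ ∈ O) : fderiv ℝ ψ ρ = fderiv ℝ (fderiv ℝ ψ) ρ ρ := by
  have h1 : HasFDerivAt (fderiv ℝ ψ) (fderiv ℝ (fderiv ℝ ψ) ρ) ((1 : ℝ) • ρ) := by
    rw [one_smul]
    exact (((hs.contDiffAt (hO.mem_nhds hρ)).fderiv_right (m := ∞) (by simp)).differentiableAt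
      (by simp)).hasFDerivAt
  have h2 : HasDerivAt (fun r : ℝ => fderiv ℝ ψ (r • ρ)) (fderiv ℝ (fderiv ℝ ψ) ρ ρ) 1 :=
    h1.comp_hasDerivAt (1 : ℝ) (by simpa using (hasDerivAt_id (1 : ℝ)).smul_const ρ)
  have h3 : HasDerivAt (fun r : ℝ => r • fderiv ℝ ψ ρ) (fderiv ℝ ψ ρ) 1 := by
    simpa using (hasDerivAt_id (1 : ℝ)).smul_const (fderiv ℝ ψ ρ)
  refine (h2.congr_of_eventuallyEq ?_).unique h3 |>.symm
  filter_upwards [lt_mem_nhds (zero_lt_one (α := ℝ))] with r hr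
  exact (fderiv_smul_of_homogeneous hO hψ hρ hr).symm

theorem smul_normalize {V : Type*} [NormedAddCommGroup V] [NormedSpace ℝ V] {v : V} (hv : v ≠ 0) :
    ‖v‖ • (‖v‖⁻¹ • v) = v ∧ ‖v‖⁻¹ • v ∈ Metric.sphere (0 : V) 1 :=
  ⟨smul_inv_smul₀ (norm_ne_zero_iff.2 hv) v, by
    simp [norm_smul, inv_mul_cancel₀ (norm_ne_zero_iff.2 hv)]⟩

/-- The Hessians of a family of homogeneous potentials are uniformly bounded and positive. -/
theorem exists_isMetricBetween {ψ : ℝ → (Fin k → ℝ) → ℝ}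
    (hψ : ContDiffOn ℝ ∞ (fun p : ℝ × (Fin k → ℝ) => ψ p.1 p.2) (Icc (0 : ℝ) 1 ×ˢ {0}ᶜ))
    (hh : ∀ s ∈ Icc (0 : ℝ) 1, IsHomogeneousPotential (ψ s)) :
    ∃ l Λ : ℝ, 0 < l ∧ 0 ≤ Λ ∧ ∀ s ∈ Icc (0 : ℝ) 1, ∀ ρ ≠ 0,
      IsMetricBetween (fderiv ℝ (fderiv ℝ (ψ s)) ρ) l Λ := by
  have hO : IsOpen ({0}ᶜ : Set (Fin k → ℝ)) := isOpen_compl_singleton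
  have hB : UniqueDiffOn ℝ (Icc (0 : ℝ) 1) := uniqueDiffOn_Icc zero_lt_one
  have hc : ContinuousOn (fun p : ℝ × (Fin k → ℝ) => fderiv ℝ (fderiv ℝ (ψ p.1)) p.2)
      (Icc (0 : ℝ) 1 ×ˢ {0}ᶜ) :=
    (contDiffOn_fderiv_right (g := fun s ρ => fderiv ℝ (ψ s) ρ) hB hO
      (contDiffOn_fderiv_right hB hO hψ)).continuousOn
  set S : Set (Fin k → ℝ) := Metric.sphere 0 1 with hS
  have hSc : IsCompact S := isCompact_sphere 0 1
  have hS0 : S ⊆ {0}ᶜ := fun v hv => by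
    rintro rfl
    simp [hS] at hv
  obtain ⟨Λ, hΛ⟩ := (isCompact_Icc.prod hSc).exists_bound_of_continuousOn
    (f := fun p : ℝ × (Fin k → ℝ) => fderiv ℝ (fderiv ℝ (ψ p.1)) p.2)
    (hc.mono (prod_mono le_rfl hS0))
  have hc2 : ContinuousOn (fun p : (ℝ × (Fin k → ℝ)) × (Fin k → ℝ) =>
      fderiv ℝ (fderiv ℝ (ψ p.1.1)) p.1.2 p.2 p.2) ((Icc (0 : ℝ) 1 ×ˢ S) ×ˢ S) :=
    (((hc.mono (prod_mono le_rfl hS0)).comp continuousOn_fst fun p hp => hp.1).clm_apply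
      continuousOn_snd).clm_apply continuousOn_snd
  -- The Hessian is homogeneous of degree 0, so compactness of the parameter interval times unit
  -- spheres gives bounds on all of ρ ≠ 0.
  obtain ⟨l, hl, hl'⟩ := ((isCompact_Icc.prod hSc).prod hSc).exists_forall_le' hc2 (a := 0)
    fun p hp => (hh _ hp.1.1).posDef _ (hS0 hp.1.2) _ (hS0 hp.2)
  refine ⟨l, max Λ 0, hl, le_max_right _ _, fun s hs ρ hρ => ?_⟩
  have hhom : fderiv ℝ (fderiv ℝ (ψ s)) ρ = fderiv ℝ (fderiv ℝ (ψ s)) (‖ρ‖⁻¹ • ρ) := by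
    rw [fderiv_fderiv_smul_of_homogeneous hO (hh s hs).homogeneous hρ
      (inv_pos.2 (norm_pos_iff.2 hρ))]
  refine ⟨?_, fun v => ?_, fun v w => ?_⟩
  · exact (((hh s hs).smooth.contDiffAt (hO.mem_nhds hρ)).isSymmSndFDerivAt
      (by simpa using WithTop.coe_le_coe.2 (le_top : (2 : ℕ∞) ≤ ⊤))).eq
  · rcases eq_or_ne v 0 with rfl | hv
    · simp
    obtain ⟨h1, h2⟩ := smul_normalize hv
    have h3 := hl' ((s, ‖ρ‖⁻¹ • ρ), ‖v‖⁻¹ • v) ⟨⟨hs, (smul_normalize hρ).2⟩, h2⟩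
    rw [hhom]
    nth_rewrite 2 3 [← h1]
    simp only [map_smul, _root_.smul_apply, smul_eq_mul] at h3 ⊢
    have h4 : ‖v‖ * ‖v‖⁻¹ = 1 := mul_inv_cancel₀ (norm_ne_zero_iff.2 hv)
    nlinarith [mul_le_mul_of_nonneg_left h3 (sq_nonneg ‖v‖)]
  · have h1 := hΛ (s, ‖ρ‖⁻¹ • ρ) ⟨hs, (smul_normalize hρ).2⟩
    rw [hhom, ← Real.norm_eq_abs]
    refine (ContinuousLinearMap.le_opNorm₂ _ v w).trans ?_
    gcongr
    exact h1.trans (le_max_left _ _)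

/-- A family of quadratic forms that depends smoothly on the parameter away from the origin does so
everywhere. -/
theorem contDiffOn_of_isToricPotential {ψ : ℝ → (Fin k → ℝ) → ℝ} {B : Set ℝ}
    (hψ : ContDiffOn ℝ ∞ (fun p : ℝ × (Fin k → ℝ) => ψ p.1 p.2) (B ×ˢ {0}ᶜ))
    (ht : ∀ s ∈ B, IsToricPotential (ψ s)) :
    ContDiffOn ℝ ∞ (fun p : ℝ × (Fin k → ℝ) => ψ p.1 p.2) (B ×ˢ univ) := by
  -- Polarization recovers the matrix entries from values at the nonzero vectors e_i and e_i + e_j,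
  -- where the dependence on the parameter is smooth.
  let e : Fin k → Fin k → ℝ := fun i => Pi.single i 1
  have he : ∀ i j, e i + e j ≠ 0 := fun i j h => by
    have h1 := congr_fun h i
    have h2 : 0 ≤ (Pi.single j (1 : ℝ) : Fin k → ℝ) i := by
      rw [Pi.single_apply]
      split_ifs <;> norm_num
    simp only [e, Pi.add_apply, Pi.single_eq_same, Pi.zero_apply] at h1
    linarith
  have he0 : ∀ i, e i ≠ 0 := fun i => by simp [e]
  have hsm : ∀ v : Fin k → ℝ, v ≠ 0 →
      ContDiffOn ℝ ∞ (fun p : ℝ × (Fin k → ℝ) => ψ p.1 v) (B ×ˢ univ) := fun v hv =>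
    hψ.comp (contDiff_fst.prodMk contDiff_const).contDiffOn fun p hp => ⟨hp.1, hv⟩
  have hcoord : ∀ i : Fin k,
      ContDiffOn ℝ ∞ (fun p : ℝ × (Fin k → ℝ) => p.2 i) (B ×ˢ univ) := fun i =>
    ((contDiff_apply ℝ ℝ i).comp contDiff_snd).contDiffOn
  have key : ContDiffOn ℝ ∞ (fun p : ℝ × (Fin k → ℝ) => ∑ i, ∑ j,
      p.2 i * p.2 j * ((ψ p.1 (e i + e j) - ψ p.1 (e i) - ψ p.1 (e j)) / 2)) (B ×ˢ univ) :=
    ContDiffOn.sum fun i _ => ContDiffOn.sum fun j _ => ((hcoord i).mul (hcoord j)).mul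
      ((((hsm _ (he i j)).sub (hsm _ (he0 i))).sub (hsm _ (he0 j))).div_const 2)
  refine key.congr fun p hp => ?_
  obtain ⟨Q, hQ, hQψ⟩ := ht p.1 hp.1
  have hs : ∀ i j, Q i j = Q j i := fun i j => by simpa using (hQ.1.apply i j).symm
  have h1 : ∀ i j, (ψ p.1 (e i + e j) - ψ p.1 (e i) - ψ p.1 (e j)) / 2 = Q i j := fun i j => by
    simp only [hQψ, e, Matrix.mulVec_add, dotProduct_add, add_dotProduct, Matrix.mulVec_single_one,
      single_one_dotProduct, Matrix.col_apply]
    rw [hs j i]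
    ring
  simp only [h1]
  simp only [hQψ, dotProduct, Matrix.mulVec, Finset.mul_sum]
  exact Finset.sum_congr rfl fun i _ => Finset.sum_congr rfl fun j _ => by ring

/-- `O` is a set of points on which the potentials `ψ s`, `0 ≤ s ≤ 1`, are well behaved. -/
structure IsUniformFamily (ψ : ℝ → (Fin k → ℝ) → ℝ) (O : Set (Fin k → ℝ)) (l Λ : ℝ) : Prop where
  isOpen : IsOpen O
  contDiffOn : ContDiffOn ℝ ∞ (fun p : ℝ × (Fin k → ℝ) => ψ p.1 p.2) (Icc (0 : ℝ) 1 ×ˢ O)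
  metric : ∀ s ∈ Icc (0 : ℝ) 1, ∀ ρ ∈ O, IsMetricBetween (fderiv ℝ (fderiv ℝ (ψ s)) ρ) l Λ
  euler : ∀ s ∈ Icc (0 : ℝ) 1, ∀ ρ ∈ O, fderiv ℝ (ψ s) ρ = fderiv ℝ (fderiv ℝ (ψ s)) ρ ρ

theorem isUniformFamily_compl_zero {ψ : ℝ → (Fin k → ℝ) → ℝ}
    (hψ : ContDiffOn ℝ ∞ (fun p : ℝ × (Fin k → ℝ) => ψ p.1 p.2) (Icc (0 : ℝ) 1 ×ˢ {0}ᶜ))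
    (hh : ∀ s ∈ Icc (0 : ℝ) 1, IsHomogeneousPotential (ψ s)) {l Λ : ℝ}
    (hl : ∀ s ∈ Icc (0 : ℝ) 1, ∀ ρ ≠ 0, IsMetricBetween (fderiv ℝ (fderiv ℝ (ψ s)) ρ) l Λ) :
    IsUniformFamily ψ {0}ᶜ l Λ where
  isOpen := isOpen_compl_singleton
  contDiffOn := hψ
  metric := hl
  euler s hs _ hρ := fderiv_eq_of_homogeneous isOpen_compl_singleton (hh s hs).homogeneous
    (hh s hs).smooth hρ

/-- At the origin the bounds follow by continuity: the Hessian is constant along each ray, so its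
value at 0 is its value at any nonzero vector. -/
theorem isUniformFamily_univ (hk : 0 < k) {ψ : ℝ → (Fin k → ℝ) → ℝ}
    (hψ : ContDiffOn ℝ ∞ (fun p : ℝ × (Fin k → ℝ) => ψ p.1 p.2) (Icc (0 : ℝ) 1 ×ˢ {0}ᶜ))
    (ht : ∀ s ∈ Icc (0 : ℝ) 1, IsToricPotential (ψ s)) {l Λ : ℝ}
    (hl : ∀ s ∈ Icc (0 : ℝ) 1, ∀ ρ ≠ 0, IsMetricBetween (fderiv ℝ (fderiv ℝ (ψ s)) ρ) l Λ) :
    IsUniformFamily ψ univ l Λ := by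
  have hψ' := contDiffOn_of_isToricPotential hψ ht
  have hhom : ∀ s ∈ Icc (0 : ℝ) 1, ∀ ρ ∈ (univ : Set (Fin k → ℝ)), ∀ r : ℝ, 0 < r →
      ψ s (r • ρ) = r ^ 2 * ψ s ρ := fun s hs ρ _ r _ => by
    obtain ⟨Q, -, hQ⟩ := ht s hs
    simp only [hQ, Matrix.mulVec_smul, dotProduct_smul, smul_dotProduct, smul_eq_mul]
    ring
  refine ⟨isOpen_univ, hψ', fun s hs ρ _ => ?_, fun s hs ρ hρ =>
    fderiv_eq_of_homogeneous isOpen_univ (hhom s hs) (hψ'.right hs) hρ⟩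
  rcases eq_or_ne ρ 0 with rfl | hρ
  · let v : Fin k → ℝ := fun _ => 1
    have hv : v ≠ 0 := fun h => one_ne_zero (congr_fun h ⟨0, hk⟩)
    have hc : Continuous (fderiv ℝ (fderiv ℝ (ψ s))) := by
      have h1 : ContDiff ℝ ∞ (ψ s) := contDiffOn_univ.1 (hψ'.right hs)
      exact ((h1.fderiv_right (m := ∞) (by simp)).fderiv_right (m := ∞) (by simp)).continuous
    have h1 : Tendsto (fun r : ℝ => fderiv ℝ (fderiv ℝ (ψ s)) (r • v)) (𝓝[>] 0)
        (𝓝 (fderiv ℝ (fderiv ℝ (ψ s)) 0)) := by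
      have h2 : Continuous fun r : ℝ => fderiv ℝ (fderiv ℝ (ψ s)) (r • v) :=
        hc.comp (continuous_id.smul continuous_const)
      simpa using (h2.tendsto 0).mono_left nhdsWithin_le_nhds
    have h2 : (fun _ : ℝ => fderiv ℝ (fderiv ℝ (ψ s)) v) =ᶠ[𝓝[>] 0]
        fun r : ℝ => fderiv ℝ (fderiv ℝ (ψ s)) (r • v) := by
      filter_upwards [self_mem_nhdsWithin] with r hr
      exact (fderiv_fderiv_smul_of_homogeneous isOpen_univ (hhom s hs) (mem_univ v) hr).symm
    rw [tendsto_nhds_unique h1 (tendsto_const_nhds.congr' h2)]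
    exact hl s hs v hv
  · exact hl s hs ρ hρ

end Potentials

/-! ### Zeros of Laurent polynomials -/

section LaurentPolynomials

variable {k : ℕ}

/-- Finitely many integer vectors are separated by an integral linear form. -/
theorem exists_injOn_sum_mul (A : Finset (Fin k → ℤ)) :
    ∃ v : Fin k → ℤ, Set.InjOn (fun a : Fin k → ℤ => ∑ j, a j * v j) A := by
  classical
  let L : (Fin k → ℤ) → MvPolynomial (Fin k) ℤ := fun a =>
    ∑ j, MvPolynomial.C (a j) * MvPolynomial.X j
  have hL : ∀ a v, MvPolynomial.eval v (L a) = ∑ j, a j * v j := fun a v => by simp [L]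
  have hL0 : ∀ a, a ≠ 0 → L a ≠ 0 := fun a ha h0 => ha <| funext fun j => by
    simpa [h0, Pi.single_apply] using (hL a (Pi.single j 1)).symm
  -- A product of nonzero linear polynomials is a nonzero polynomial, so it does not vanish at some
  -- integer point.
  have hP : ∏ p ∈ A.offDiag, L (p.1 - p.2) ≠ 0 := Finset.prod_ne_zero_iff.2 fun p hp =>
    hL0 _ (sub_ne_zero.2 (Finset.mem_offDiag.1 hp).2.2)
  obtain ⟨v, hv⟩ : ∃ v, MvPolynomial.eval v (∏ p ∈ A.offDiag, L (p.1 - p.2)) ≠ 0 := by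
    by_contra! h
    exact hP (MvPolynomial.funext fun v => by rw [h v, map_zero])
  refine ⟨v, fun a ha b hb hab => by_contra fun hne => ?_⟩
  rw [map_prod] at hv
  refine Finset.prod_ne_zero_iff.1 hv (a, b) (Finset.mem_offDiag.2 ⟨ha, hb, hne⟩) ?_
  rw [hL]
  simp only [Pi.sub_apply, sub_mul, Finset.sum_sub_distrib]
  exact sub_eq_zero.2 hab

theorem zpow_sum_of_ne_zero {ι : Type*} {z : ℂ} (hz : z ≠ 0) (s : Finset ι) (m : ι → ℤ) :
    z ^ (∑ j ∈ s, m j) = ∏ j ∈ s, z ^ m j := by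
  classical
  induction s using Finset.induction_on with
  | empty => simp
  | insert j s hj ih => rw [Finset.sum_insert hj, Finset.prod_insert hj, zpow_add₀ hz, ih]

/-- A Laurent polynomial with at least two terms has a zero in the torus. -/
theorem exists_zero_of_one_lt_card {A : Finset (Fin k → ℤ)} (hA : 1 < A.card)
    {c : (Fin k → ℤ) → ℂ} (hc : ∀ a ∈ A, c a ≠ 0) :
    ∃ x : Fin k → ℂ, (∀ j, x j ≠ 0) ∧ ∑ a ∈ A, c a * ∏ j, x j ^ a j = 0 := by
  classical
  obtain ⟨v, hv⟩ := exists_injOn_sum_mul A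
  -- On the one-parameter subgroup z ↦ (z^(v j)) the exponents stay distinct. Subtracting the least
  -- one leaves a nonconstant polynomial with nonzero constant term, whose roots are nonzero.
  set m : (Fin k → ℤ) → ℤ := fun a => ∑ j, a j * v j with hm
  obtain ⟨a₀, ha₀, hmin⟩ := A.exists_min_image m (Finset.card_pos.1 (zero_lt_one.trans hA))
  obtain ⟨b, hb, hba⟩ := Finset.exists_mem_ne hA a₀
  let n : (Fin k → ℤ) → ℕ := fun a => (m a - m a₀).toNat
  have hn : ∀ a ∈ A, (n a : ℤ) = m a - m a₀ := fun a ha =>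
    Int.toNat_of_nonneg (sub_nonneg.2 (hmin a ha))
  have hninj : ∀ a ∈ A, ∀ a' ∈ A, n a = n a' → a = a' := fun a ha a' ha' h => by
    refine hv ha ha' ?_
    have h1 := hn a ha
    have h2 := hn a' ha'
    change m a = m a'
    omega
  let P : Polynomial ℂ := ∑ a ∈ A, Polynomial.C (c a) * Polynomial.X ^ n a
  have hcoeff : ∀ a ∈ A, P.coeff (n a) = c a := fun a ha => by
    simp only [P, Polynomial.finsetSum_coeff, Polynomial.coeff_C_mul_X_pow]
    rw [Finset.sum_eq_single_of_mem a ha fun a' ha' hne => if_neg fun h => hne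
      (hninj a' ha' a ha h.symm), if_pos rfl]
  have hn0 : n a₀ = 0 := by simp [n]
  have hdeg : P.degree ≠ 0 := fun h => by
    have h1 := Polynomial.eq_C_of_degree_eq_zero h
    have h2 := hcoeff b hb
    rw [h1, Polynomial.coeff_C, if_neg fun h3 => hba (hninj b hb a₀ ha₀ (h3.trans hn0.symm))] at h2
    exact hc b hb h2.symm
  obtain ⟨z, hz⟩ := IsAlgClosed.exists_root P hdeg
  have hz0 : z ≠ 0 := by
    rintro rfl
    have h1 := hcoeff a₀ ha₀
    rw [hn0, Polynomial.coeff_zero_eq_eval_zero, hz.eq_zero] at h1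
    exact hc a₀ ha₀ h1.symm
  refine ⟨fun j => z ^ v j, fun j => zpow_ne_zero _ hz0, ?_⟩
  have h1 : ∀ a ∈ A, c a * ∏ j, (z ^ v j) ^ a j = z ^ m a₀ * (c a * z ^ n a) := fun a ha => by
    have h2 : ∏ j, (z ^ v j) ^ a j = z ^ m a := by
      rw [hm, zpow_sum_of_ne_zero hz0]
      exact Finset.prod_congr rfl fun j _ => by rw [← zpow_mul, mul_comm]
    have h3 : m a = m a₀ + n a := by rw [hn a ha]; ring
    rw [h2, h3, zpow_add₀ hz0, zpow_natCast]
    ring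
  rw [Finset.sum_congr rfl h1, ← Finset.mul_sum]
  have h4 : P.eval z = ∑ a ∈ A, c a * z ^ n a := by simp [P, Polynomial.eval_finsetSum]
  rw [← h4, hz.eq_zero, mul_zero]

theorem nonempty_tailoredHypersurface_zero {A : Finset (Fin k → ℤ)} (hA : 1 < A.card)
    (ν : (Fin k → ℤ) → ℝ) {α : (Fin k → ℤ) → ℂ} (hα : ∀ a ∈ A, α a ≠ 0)
    (χ : (Fin k → ℤ) → (Fin k → ℝ) → ℝ) {t : ℝ} (ht : 0 < t) :
    (tailoredHypersurface A ν α χ t 0).Nonempty := by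
  obtain ⟨x, hx, h⟩ := exists_zero_of_one_lt_card hA
    (c := fun a => α a * ((t ^ (-ν a) : ℝ) : ℂ)) fun a ha =>
      mul_ne_zero (hα a ha) (Complex.ofReal_ne_zero.2 (Real.rpow_pos_of_pos ht _).ne')
  exact ⟨x, hx, by simpa [tailoredFun] using h⟩

end LaurentPolynomials

/-! ### Families over the parameter interval -/

section Families

variable {k : ℕ} {f : ℝ → (Fin k → ℂ) → ℂ} {ψ : ℝ → (Fin k → ℝ) → ℝ} {O : Set (Fin k → ℝ)}
  {l Λ κ R : ℝ}

/-- If one member of the family is nonempty, then so are the nearby ones. -/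
theorem eventually_nonempty_torusHypersurface {x : Fin k → ℂ} {s : ℝ}
    (hf : ContDiffAt ℝ ∞ (fun p : (Fin k → ℂ) × ℝ => f p.2 p.1) (x, s))
    (hx : x ∈ torusHypersurface (f s)) (hsurj : Function.Surjective (fderiv ℝ (f s) x)) :
    ∀ᶠ s' in 𝓝 s, (torusHypersurface (f s')).Nonempty := by
  set L := fderiv ℝ (fun p : (Fin k → ℂ) × ℝ => f p.2 p.1) (x, s) with hL
  have hd : HasStrictFDerivAt (fun p : (Fin k → ℂ) × ℝ => f p.2 p.1) L (x, s) :=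
    hf.hasStrictFDerivAt (by simp)
  have hLx : fderiv ℝ (f s) x = L.comp (ContinuousLinearMap.inl ℝ (Fin k → ℂ) ℝ) :=
    (hd.hasFDerivAt.comp (f := fun y => (y, s)) x (hasFDerivAt_prodMk_left x s)).fderiv
  -- The map (x, s) ↦ (f_s(x), s) is a submersion at the given zero, so it is open there and its
  -- image contains (0, s') for all nearby s'.
  have hd2 := hd.prodMk (hasStrictFDerivAt_snd (𝕜 := ℝ) (p := (x, s)))
  have hsurj2 : (L.prod (ContinuousLinearMap.snd ℝ (Fin k → ℂ) ℝ)).range = ⊤ := by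
    refine LinearMap.range_eq_top.2 fun ⟨y, r⟩ => ?_
    obtain ⟨v, hv⟩ := hsurj (y - L (0, r))
    rw [hLx] at hv
    refine ⟨(v, r), Prod.ext ?_ rfl⟩
    have h1 : ((v, r) : (Fin k → ℂ) × ℝ) = (v, 0) + (0, r) := by simp
    change L (v, r) = y
    rw [h1, map_add]
    exact add_eq_of_eq_sub hv
  have hmap := hd2.map_nhds_eq_of_surj hsurj2
  have hU : {p : (Fin k → ℂ) × ℝ | ∀ j, p.1 j ≠ 0} ∈ 𝓝 (x, s) :=
    (isOpen_torus.preimage continuous_fst).mem_nhds hx.1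
  have h2 := image_mem_map (m := fun p : (Fin k → ℂ) × ℝ => (f p.2 p.1, p.2)) hU
  rw [hmap] at h2
  simp only [hx.2] at h2
  have h3 : Tendsto (fun s' : ℝ => ((0 : ℂ), s')) (𝓝 s) (𝓝 (0, s)) :=
    tendsto_const_nhds.prodMk_nhds tendsto_id
  filter_upwards [h3.eventually h2] with s' hs'
  obtain ⟨⟨y, r⟩, hy, hyr⟩ := hs'
  obtain ⟨h4, rfl⟩ := Prod.ext_iff.1 hyr
  exact ⟨y, hy, h4⟩

/-- Connectedness of the interval. The condition is open by the submersion property. It is closed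
because each nonempty fiber meets its generating domain and the total space of these domains is
compact. -/
theorem nonempty_torusHypersurface
    (hf : ∀ x s, (∀ j, x j ≠ 0) → ContDiffAt ℝ ∞ (fun p : (Fin k → ℂ) × ℝ => f p.2 p.1) (x, s))
    (h : ∀ s ∈ Icc (0 : ℝ) 1, LiouvilleData (f s) (ψ s) O l Λ κ R)
    (h0 : (torusHypersurface (f 0)).Nonempty) {s : ℝ} (hs : s ∈ Icc (0 : ℝ) 1) :
    (torusHypersurface (f s)).Nonempty := by
  set S : Set ℝ := {s | (torusHypersurface (f s)).Nonempty} with hS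
  suffices Icc (0 : ℝ) 1 ⊆ S from this hs
  refine IsClosed.Icc_subset_of_forall_mem_nhdsWithin ?_ h0 fun s hs => ?_
  · have h1 : S ∩ Icc 0 1 = Prod.snd '' {p : (Fin k → ℂ) × ℝ |
        p.2 ∈ Icc (0 : ℝ) 1 ∧ p.1 ∈ LiouvilleData.domain (f p.2) R} := by
      ext s
      constructor
      · rintro ⟨⟨x, hx⟩, hs⟩
        obtain ⟨γ, -, hγ, -⟩ := (h s hs).isGeneratingLiouvilleDomain.generates x hx
        exact ⟨(γ 0, s), ⟨hs, hγ⟩, rfl⟩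
      · rintro ⟨⟨x, s⟩, ⟨hs, hx⟩, rfl⟩
        exact ⟨⟨x, hx.1⟩, hs⟩
    rw [h1]
    exact ((LiouvilleData.isCompact_total_domain (fun x s hx => (hf x s hx).continuousAt)
      isCompact_Icc R).image continuous_snd).isClosed
  · obtain ⟨⟨x, hx⟩, hs⟩ := hs
    exact mem_nhdsWithin_of_mem_nhds (eventually_nonempty_torusHypersurface (hf x s hx.1) hx
      ((h s ⟨hs.1, hs.2.le⟩).fderiv_surjective hx))

theorem isLiouvilleFamily
    (hf : ∀ x s, (∀ j, x j ≠ 0) → ContDiffAt ℝ ∞ (fun p : (Fin k → ℂ) × ℝ => f p.2 p.1) (x, s))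
    (hψ : IsUniformFamily ψ O l Λ)
    (h : ∀ s ∈ Icc (0 : ℝ) 1, LiouvilleData (f s) (ψ s) O l Λ κ R)
    (h0 : (torusHypersurface (f 0)).Nonempty) :
    IsLiouvilleFamily 2 (Icc (0 : ℝ) 1) (fun s => torusHypersurface (f s))
      (fun s => liouvilleForm (ψ s)) where
  family :=
    { nonempty := fun s hs => nonempty_torusHypersurface hf h h0 hs
      submersion := fun s hs x hx => by
        refine ⟨{p | ∀ j, p.1 j ≠ 0}, isOpen_torus.preimage continuous_fst, hx.1,
          fun p => Complex.basisOneI.equivFunL (f p.2 p.1), fun p hp => ?_, fun p hp _ => ?_,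
          (h s hs).surjective_fderiv_equivFunL hx⟩
        · exact (Complex.basisOneI.equivFunL.contDiff.contDiffAt.comp p
            (hf p.1 p.2 hp.1)).contDiffWithinAt
        · rw [EmbeddingLike.map_eq_zero_iff]
          exact ⟨fun hy => hy.2, fun hy => ⟨hp, hy⟩⟩ }
  smooth s hs x hx := by
    have hcont : ContinuousOn (logMap (k := k)) {y | ∀ j, y j ≠ 0} := fun y hy =>
      (contDiffAt_logMap (n := 1) hy).continuousAt.continuousWithinAt
    have hopen : IsOpen {x : Fin k → ℂ | (∀ j, x j ≠ 0) ∧ logMap x ∈ O} :=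
      hcont.isOpen_inter_preimage isOpen_torus hψ.isOpen
    exact ⟨{x | (∀ j, x j ≠ 0) ∧ logMap x ∈ O} ×ˢ univ, hopen.prod isOpen_univ,
      ⟨⟨hx.1, (h s hs).mem x hx⟩, mem_univ s⟩,
      (contDiffOn_liouvilleForm (uniqueDiffOn_Icc zero_lt_one) hψ.isOpen hψ.contDiffOn).mono
        fun p hp => ⟨hp.1.1, hp.2.2⟩⟩
  fiber s hs := (h s hs).isLiouvilleManifold

theorem locallyHasGeneratingDomains
    (hf : ∀ x s, (∀ j, x j ≠ 0) → ContDiffAt ℝ ∞ (fun p : (Fin k → ℂ) × ℝ => f p.2 p.1) (x, s))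
    (h : ∀ s ∈ Icc (0 : ℝ) 1, LiouvilleData (f s) (ψ s) O l Λ κ R) :
    LocallyHasGeneratingDomains (Icc (0 : ℝ) 1) (fun s => torusHypersurface (f s))
      (fun s => liouvilleForm (ψ s)) := fun s _ => by
  -- The radius does not depend on s, so one family of domains serves the whole interval.
  refine ⟨univ, isOpen_univ, mem_univ s, fun s => LiouvilleData.domain (f s) R, ?_⟩
  rw [univ_inter]
  refine ⟨fun K _ hK => LiouvilleData.isCompact_total_domain
    (fun x s hx => (hf x s hx).continuousAt) hK R, fun s hs x hx => ?_,
    fun s hs => (h s hs).isGeneratingLiouvilleDomain⟩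
  have hopen : IsOpen {p : (Fin k → ℂ) × ℝ | ∀ j, p.1 j ≠ 0} :=
    isOpen_torus.preimage continuous_fst
  have hsm : ∀ p : (Fin k → ℂ) × ℝ, (∀ j, p.1 j ≠ 0) →
      ContDiffAt ℝ ∞ (fun p : (Fin k → ℂ) × ℝ => logNormSq p.1 - k * R ^ 2) p := fun p hp =>
    ((contDiffAt_logNormSq hp).comp p contDiffAt_fst).sub contDiffAt_const
  rcases hx.2.lt_or_eq with hlt | hxR
  · have hcont : ContinuousOn (fun p : (Fin k → ℂ) × ℝ => logNormSq p.1 - k * R ^ 2)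
        {p | ∀ j, p.1 j ≠ 0} := fun p hp => (hsm p hp).continuousAt.continuousWithinAt
    exact ⟨_, hcont.isOpen_inter_preimage hopen (isOpen_Iio (a := 0)),
      ⟨hx.1.1, sub_neg.2 hlt⟩, Or.inl fun p hp _ hpN => ⟨hpN, (sub_neg.1 hp.2).le⟩⟩
  · refine ⟨_, hopen, hx.1.1, Or.inr ⟨fun p => logNormSq p.1 - k * R ^ 2,
      fun p hp => (hsm p hp.1).contDiffWithinAt, sub_eq_zero.2 hxR,
      (h s hs).isBoundaryDefining_logNormSq hx.1 hxR, fun p _ _ hpN => ?_⟩⟩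
    exact ⟨fun hp => sub_nonpos.2 hp.2, fun hp => ⟨hpN, sub_nonpos.1 hp⟩⟩

end Families

end

/-! ### The main theorem -/

theorem mainTheorem10 (k : ℕ) (A : Finset (Fin k → ℤ)) (hA : 1 < A.card)
    (ν : (Fin k → ℤ) → ℝ) (hν : InducesTriangulation A ν)
    (G : Matrix (Fin k) (Fin k) ℝ) (hG : G.PosDef) :
    ∃ ε₀ : ℝ, 0 < ε₀ ∧ ∀ ε₁ ε₂ : ℝ, 0 < ε₁ → ε₁ < ε₂ → ε₂ ≤ ε₀ →
      ∀ (χ : (Fin k → ℤ) → (Fin k → ℝ) → ℝ), IsCutoffFamily A ν G ε₁ ε₂ χ →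
      ∀ (α : (Fin k → ℤ) → ℂ), (∀ a ∈ A, α a ≠ 0) →
      ∀ (ψ : ℝ → (Fin k → ℝ) → ℝ),
        ContDiffOn ℝ ∞ (fun p : ℝ × (Fin k → ℝ) => ψ p.1 p.2) (Icc (0 : ℝ) 1 ×ˢ {0}ᶜ) →
        (∀ s ∈ Icc (0 : ℝ) 1, IsHomogeneousPotential (ψ s)) →
        (0 ∉ tropicalAmoeba A ν ∨ ∀ s ∈ Icc (0 : ℝ) 1, IsToricPotential (ψ s)) →
      ∃ T : ℝ, 1 < T ∧ ∀ t : ℝ, T ≤ t →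
        IsLiouvilleFamily 2 (Icc (0 : ℝ) 1) (tailoredHypersurface A ν α χ t)
            (fun s => liouvilleForm (ψ s)) ∧
          LocallyHasGeneratingDomains (Icc (0 : ℝ) 1) (tailoredHypersurface A ν α χ t)
            (fun s => liouvilleForm (ψ s)) := by
  -- The bound 1 is arbitrary: the width δ of the almost maximal terms is adapted to ε₁, and T is
  -- chosen after it.
  refine ⟨1, one_pos, fun ε₁ ε₂ hε₁ _ _ χ hχ α hα ψ hψ hhom hcase => ?_⟩
  have hAne : A.Nonempty := Finset.card_pos.1 (zero_lt_one.trans hA)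
  -- In dimension 0 there is only one exponent.
  have hk : 0 < k := by
    by_contra hk
    obtain rfl : k = 0 := by omega
    exact absurd (Finset.card_le_one_of_subsingleton A) (not_le.2 hA)
  obtain ⟨l, Λ, hl, hΛ, hmetric⟩ := exists_isMetricBetween hψ hhom
  -- The potentials are used away from the origin, or everywhere in the toric case; in either case
  -- `O` contains the Log image of every fiber for large t.
  obtain ⟨O, hO, hmem⟩ : ∃ O, IsUniformFamily ψ O l Λ ∧
      ∀ ρ : Fin k → ℝ, (0 ∉ tropicalAmoeba A ν → ρ ≠ 0) → ρ ∈ O := by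
    rcases hcase with h0 | ht
    · exact ⟨{0}ᶜ, isUniformFamily_compl_zero hψ hhom hmetric, fun ρ hρ => hρ h0⟩
    · exact ⟨univ, isUniformFamily_univ hk hψ ht hmetric, fun ρ _ => mem_univ ρ⟩
  obtain ⟨κ, hκ, hκ1, hκ2, hκ3⟩ : ∃ κ : ℝ, 0 < κ ∧ κ ≤ 1 ∧ 4 * Λ * κ ≤ l ∧
      k * ((8 * Λ / l + 1) * κ) ≤ 1 / 2 := by
    have hk' : (0 : ℝ) < k := Nat.cast_pos.2 hk
    have h1 : ∀ᶠ κ : ℝ in 𝓝[>] 0, κ < 1 ∧ 4 * Λ * κ < l ∧ k * ((8 * Λ / l + 1) * κ) < 1 / 2 := by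
      refine nhdsWithin_le_nhds (Filter.Eventually.and ?_ (Filter.Eventually.and ?_ ?_))
      · exact gt_mem_nhds one_pos
      · exact (Continuous.tendsto (f := fun κ : ℝ => 4 * Λ * κ) (by fun_prop)
          0).eventually_lt_const (by simpa using hl)
      · exact (Continuous.tendsto (f := fun κ : ℝ => k * ((8 * Λ / l + 1) * κ)) (by fun_prop)
          0).eventually_lt_const (by simp)
    obtain ⟨κ, h, hκ⟩ := (h1.and self_mem_nhdsWithin).exists
    exact ⟨κ, hκ, h.1.le, h.2.1.le, h.2.2.le⟩
  obtain ⟨T, hT, R, hR, hest⟩ := tailored_estimates hAne hν hG hε₁ hχ hα hκ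
  refine ⟨T, hT, fun t ht => ?_⟩
  have ht1 : 1 < t := hT.trans_le ht
  have hf : ∀ (x : Fin k → ℂ) (s : ℝ), (∀ j, x j ≠ 0) → ContDiffAt ℝ ∞
      (fun p : (Fin k → ℂ) × ℝ => tailoredFun A ν α χ t p.2 p.1) (x, s) := fun x s hx =>
    contDiffAt_tailoredFun ν α hχ.smooth t s hx
  have hdata : ∀ s ∈ Icc (0 : ℝ) 1,
      -- The estimates are in the scale Log_t, so the radius in the scale Log is R log t.
      LiouvilleData (tailoredFun A ν α χ t s) (ψ s) O l Λ κ (R * Real.log t) := fun s hs =>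
    { contDiffAt := fun x hx => contDiffAt_tailoredFun_left ν α hχ.smooth t s hx
      isOpen := hO.isOpen
      contDiffOn := hO.contDiffOn.right hs
      metric := hO.metric s hs
      euler := fun ρ hρ v => by rw [← hO.euler s hs ρ hρ]
      mem := fun x hx => hmem _ (hest t ht s hs x hx).2.2.2
      surj := fun x hx => (hest t ht s hs x hx).1
      nearly := fun x hx => (hest t ht s hs x hx).2.1
      radial := fun x hx => (hest t ht s hs x hx).2.2.1
      dim_pos := hk
      l_pos := hl
      nonneg := hΛ
      R_pos := mul_pos hR (Real.log_pos ht1)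
      κ_le := hκ1
      mul_κ_le := hκ2
      dim_mul_κ_le := hκ3 }
  exact ⟨isLiouvilleFamily hf hO hdata
    (nonempty_tailoredHypersurface_zero hA ν hα χ (zero_lt_one.trans ht1)),
    locallyHasGeneratingDomains hf hdata⟩
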